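/- Let $k,n$ be integers with $2\le k\le n-2$, and put $d=(k-1)(n-k-1)$. **Noncrossing complex.** A $k$-element subset $J=\{j_1<\cdots<j_k\}$ of $[n]=\{1,\dots,n\}$ is *frozen* if it is an interval for the cyclic order $(1,2,\dots,n)$, and *nonfrozen* otherwise. Sets $A,B\subseteq[n]$ are *weakly separated* if there are no $a<b<c<d$ in $[n]$ with $a,c\in A\setminus B$ and $b,d\in B\setminus A$, or with $a,c\in B\setminus A$ and $b,d\in A\setminus B$. Two $k$-element subsets $I=\{i_1<\dots<i_k\}$ and $J=\{j_1<\dots<j_k\}$ are *noncrossing* if for all $1\le a<b\le k$ either $\{i_a,\dots,i_b\}$ and $\{j_a,\dots,j_b\}$ are weakly separated, or $\{i_{a+1},\dots,i_{b-1}\}\neq\{j_{a+1},\dots,j_{b-1}\}$. The reduced noncrossing complex $\mathbf{NC}_{k,n}$ is the set of all collections of pairwise noncrossing nonfrozen $k$-element subsets of $[n]$. **Root polytope.** Let $e_{i,j}$ be the standard basis and $\alpha_{i,j}$ the coordinate functions of $\mathbb{R}^{(k-1)\times(n-k)}$, and let $\mathcal{H}_{k,n}$ be the subspace on which all row sums $\sum_j\alpha_{i,j}$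 vanish. Put $f_{i,j}=e_{i,j}-e_{i,j+1}$ for $1\le j\le n-k-1$ and $f_{i,n-k}=e_{i,n-k}-e_{i,1}$. For a $k$-element subset $J=\{j_1<\cdots<j_k\}$ of $[n]$ put $$\gamma_J=\sum_{\ell=1}^{k-1}\ \sum_{c=j_\ell-(\ell-1)}^{j_{\ell+1}-\ell-1}\alpha_{\ell,c},\qquad v_J=\sum_{\ell=1}^{k-1}\ \sum_{c=j_\ell-(\ell-1)}^{j_{\ell+1}-\ell-1}f_{\ell,c}\in\mathcal{H}_{k,n}.$$ The generalized root polytope $\mathcal{R}^{(k)}_{n-k}$ is the convex hull of the linear functions $\gamma_J|_{\mathcal{H}_{k,n}}$, $J$ nonfrozen, in the dual space $\mathcal{H}_{k,n}^\ast$. There is a linear isomorphism $\mathcal{H}_{k,n}^\ast\to\mathcal{H}_{k,n}$ with $\alpha_{i,j}|_{\mathcal{H}_{k,n}}\mapsto f_{i,j}$ for all $i,j$; it maps $\gamma_J|_{\mathcal{H}_{k,n}}$ to $v_J$ for every $J$, and so identifies $\mathcal{R}^{(k)}_{n-k}$ with the convex hull of the $v_J$, $J$ nonfrozen, in $\mathcal{H}_{k,n}$.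 Volume on the $d$-dimensional space $\mathcal{H}_{k,n}$ is normalized so that the lattice $\mathcal{L}$ with basis $f_{i,j}$ ($1\le i\le k-1$, $1\le j\le n-k-1$) has covolume $1$; the normalized volume is $d!$ times this volume. **Statement.** The points $0$ and $v_J$, for $J$ nonfrozen, are pairwise distinct, and the simplices $$[\mathcal{J}]=\operatorname{conv}\bigl(\{0\}\cup\{v_J:J\in\mathcal{J}\}\bigr),\qquad \mathcal{J}\in\mathbf{NC}_{k,n},$$ together with all their faces, form a triangulation of $\mathcal{R}^{(k)}_{n-k}$: for every $\mathcal{J}\in\mathbf{NC}_{k,n}$ the points $0$, $v_J$ ($J\in\mathcal{J}$) are affinely independent, any two of these simplices and faces intersect in the convex hull of their common vertices, and their union is $\mathcal{R}^{(k)}_{n-k}$. This triangulation is flag (every nonempty finite set of vertices that are pairwise joined by edges of the triangulation is the vertex set of a simplex of it) and unimodular (its vertices lie in $\mathcal{L}$ and each of its maximal simplices has volume $1/d!$). Consequently the normalized volume of $\mathcal{R}^{(k)}_{n-k}$ equals the $k$-dimensional Catalan number $C^{(k)}_{n-k}$, the number of standard Young tableaux of rectangular shape $k\times(n-k)$. 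-/

import Mathlib

open scoped ENNReal Nat

noncomputable section

namespace RootPolytope

/-! ### The noncrossing complex

The ground set `{1, …, n}` is modelled by `Fin n`, the number `x` being `⟨x - 1, _⟩`; positions
inside a `k`-element subset and rows and columns of the grid are shifted by one in the same way. -/

/-- The `k`-element subsets of an `n`-element linearly ordered set. -/
abbrev KSubset (k n : ℕ) : Type := {J : Finset (Fin n) // J.card = k}

variable {k n : ℕ}

/-- The elements of `J` listed increasingly. -/
def elt (J : KSubset k n) (a : Fin k) : Fin n := J.1.orderEmbOfFin J.2 a

/-- `J` is frozen if it is an interval for the cyclic order on the ground set. -/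
def Frozen (J : KSubset k n) : Prop :=
  ∃ s : ℕ, ∀ x : Fin n, x ∈ J.1 ↔ ∃ t < k, (x : ℕ) = (s + t) % n

/-- The set of nonfrozen `k`-element subsets. -/
def nonfrozen (k n : ℕ) : Set (KSubset k n) := {J | ¬ Frozen J}

/-- `e_A - e_B` does not contain the sign pattern `+ - + -` (in the linear order `a < b < c < d`),
nor its cyclic rotation `- + - +`. -/
def WeaklySeparated (A B : Finset (Fin n)) : Prop :=
  ¬ ∃ a b c d : Fin n, a < b ∧ b < c ∧ c < d ∧
    ((a ∈ A \ B ∧ b ∈ B \ A ∧ c ∈ A \ B ∧ d ∈ B \ A) ∨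
      (a ∈ B \ A ∧ b ∈ A \ B ∧ c ∈ B \ A ∧ d ∈ A \ B))

/-- The subset `{j_a, j_{a+1}, …, j_b}` of `J`. -/
def segment (J : KSubset k n) (a b : Fin k) : Finset (Fin n) := (Finset.Icc a b).image (elt J)

/-- The subset `{j_{a+1}, …, j_{b-1}}` of `J`. -/
def interiorSegment (J : KSubset k n) (a b : Fin k) : Finset (Fin n) :=
  (Finset.Ioo a b).image (elt J)

/-- The noncrossing relation on `k`-element subsets. -/
def Noncrossing (I J : KSubset k n) : Prop :=
  ∀ a b : Fin k, a < b →
    WeaklySeparated (segment I a b) (segment J a b) ∨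
      interiorSegment I a b ≠ interiorSegment J a b

/-- The reduced noncrossing complex: collections of pairwise noncrossing nonfrozen subsets. -/
def NC (k n : ℕ) : Set (Finset (KSubset k n)) :=
  {𝒥 | (∀ J ∈ 𝒥, J ∈ nonfrozen k n) ∧ ∀ I ∈ 𝒥, ∀ J ∈ 𝒥, Noncrossing I J}

/-! ### Generalized roots and the root polytope -/

/-- The space of real `(k - 1) × (n - k)` arrays. -/
abbrev Grid (k n : ℕ) : Type := Fin (k - 1) × Fin (n - k) → ℝ

/-- The subspace of arrays all of whose row sums vanish. -/
def rowZero (k n : ℕ) : Submodule ℝ (Grid k n) where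
  carrier := {x | ∀ i, ∑ j, x (i, j) = 0}
  add_mem' := by
    intro x y hx hy i
    simp [Finset.sum_add_distrib, hx i, hy i]
  zero_mem' := by
    intro i
    simp
  smul_mem' := by
    intro c x hx i
    simp [← Finset.mul_sum, hx i]

/-- The standard basis vector `e_{i,j}`. -/
def e (q : Fin (k - 1) × Fin (n - k)) : Grid k n := Pi.single q 1

/-- `f_{i,j} = e_{i,j} - e_{i,j+1}`, the column index being cyclic: `f_{i,n-k} = e_{i,n-k} - e_{i,1}`.
-/
def f (q : Fin (k - 1) × Fin (n - k)) : Grid k n := e q - e (q.1, finRotate (n - k) q.2)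

/-- The cells `(ℓ, c)` with `j_ℓ - (ℓ - 1) ≤ c ≤ j_{ℓ+1} - ℓ - 1`, for `J = {j_1 < ⋯ < j_k}`. In
terms of the shifted values `ℓ = q.1 + 1`, `c = q.2 + 1`, `j_ℓ = elt J q.1 + 1` this reads as
follows. -/
def cells (J : KSubset k n) : Finset (Fin (k - 1) × Fin (n - k)) :=
  Finset.univ.filter fun q =>
    (elt J ⟨q.1, by omega⟩ : ℕ) ≤ (q.2 : ℕ) + q.1 ∧
      (q.2 : ℕ) + q.1 + 1 < (elt J ⟨(q.1 : ℕ) + 1, by omega⟩ : ℕ)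

/-- The generalized root `γ_J`, a sum of coordinate functions `α_{i,j}`. -/
def gamma (J : KSubset k n) : Module.Dual ℝ (Grid k n) := ∑ q ∈ cells J, LinearMap.proj q

/-- The vector `v_J`, the corresponding sum of the vectors `f_{i,j}`. -/
def v (J : KSubset k n) : Grid k n := ∑ q ∈ cells J, f q

/-- The root polytope in the space of linear functions on `rowZero k n`. -/
def dualRootPolytope (k n : ℕ) : Set (Module.Dual ℝ (rowZero k n)) :=
  convexHull ℝ ((fun J => (gamma J).domRestrict (rowZero k n)) '' nonfrozen k n)

/-- The root polytope, realized in `rowZero k n` as the convex hull of the vectors `v_J`. -/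
def rootPolytope (k n : ℕ) : Set (Grid k n) := convexHull ℝ (v '' nonfrozen k n)

/-! ### Lattice and volume -/

/-- The vectors `f_{i,j}` with `1 ≤ j ≤ n - k - 1`; they form a basis of `rowZero k n`. -/
def simpleRoot (q : Fin (k - 1) × Fin (n - k - 1)) : Grid k n :=
  f (q.1, Fin.castLE (Nat.sub_le _ _) q.2)

/-- The lattice generated by the `f_{i,j}` with `1 ≤ j ≤ n - k - 1`. -/
def rootLattice (k n : ℕ) : Submodule ℤ (Grid k n) :=
  Submodule.span ℤ (Set.range simpleRoot)

/-- The `(k - 1) (n - k - 1)`-dimensional volume on `rowZero k n`, normalized so that the root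
lattice has covolume one: Lebesgue measure in the coordinates given by the lattice basis
`simpleRoot`. -/
def relVolume (S : Set (Grid k n)) : ℝ≥0∞ :=
  MeasureTheory.volume
    {c : Fin (k - 1) × Fin (n - k - 1) → ℝ | ∑ q, c q • (simpleRoot q : Grid k n) ∈ S}

/-- The normalized volume: a unimodular simplex has normalized volume one. -/
def normalizedVolume (S : Set (Grid k n)) : ℝ≥0∞ :=
  (((k - 1) * (n - k - 1))! : ℝ≥0∞) * relVolume S

/-- A simplicial complex with vertices in the root lattice is unimodular if each of its maximal
simplices has volume `1 / d!`, where `d = (k - 1) (n - k - 1)`. -/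
def IsUnimodular (K : Geometry.SimplicialComplex ℝ (Grid k n)) : Prop :=
  K.vertices ⊆ (rootLattice k n : Set (Grid k n)) ∧
    ∀ s ∈ K.facets,
      relVolume (convexHull ℝ (s : Set (Grid k n))) = 1 / (((k - 1) * (n - k - 1))! : ℝ≥0∞)

/-- A simplicial complex is flag if every finite nonempty set of vertices which are pairwise joined
by edges is the vertex set of a simplex. -/
def IsFlag {E : Type*} [AddCommGroup E] [Module ℝ E] [DecidableEq E]
    (K : Geometry.SimplicialComplex ℝ E) : Prop :=
  ∀ s : Finset E, s.Nonempty → (∀ x ∈ s, ∀ y ∈ s, ({x, y} : Finset E) ∈ K.faces) → s ∈ K.faces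

/-! ### Multidimensional Catalan numbers -/

/-- The `k`-dimensional Catalan number: the number of standard Young tableaux of rectangular shape
`k × m`, that is, of arrangements of `1, …, km` in a `k × m` array with increasing rows and
columns. -/
def multiCatalan (k m : ℕ) : ℕ :=
  Nat.card {T : Fin k × Fin m ≃ Fin (k * m) //
    (∀ i, StrictMono fun j => T (i, j)) ∧ (∀ j, StrictMono fun i => T (i, j))}

end RootPolytope

end

/-!
A nonnegative weighting of the `k`-element subsets of `Fin n` can be changed into one with
noncrossing support by uncrossing: if `I` and `J` cross, exchanging their tails keeps the
distribution of every single entry and lowers a quadratic potential, so that a minimizer of the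
potential is noncrossing. A weighting with noncrossing support is determined by its entry
distributions. The sum `∑ J, c J • v J` depends on the weighting `c` only through its entry
distributions, and it determines them once the frozen subsets, on which `v` vanishes, are
suitably reweighted. Hence every point of `rowZero k n` is a nonnegative combination of vectors
`v J`, with `J` ranging over pairwise noncrossing nonfrozen subsets, in exactly one way, and
integrally so for points of the root lattice. These unique representations are the flag unimodular
triangulation.

The sum of the coefficients of the representation of `x` is therefore the gauge of the root
polytope, and `d!` times the volume is the integral of `exp (-gauge)`. Adding the frozen subsets,
which contribute `n` exponential coordinates, turns it into the integral of `exp (-F)`, with `F` the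
largest entry, over the cone of nonnegative arrays that are monotone along rows and columns. That
cone is the union of one unimodular orthant for each standard Young tableau, and each of these
contributes `1`.
-/

open MeasureTheory

namespace RootPolytope

variable {k n : ℕ}

/-! ### Entries and crossings -/

theorem elt_strictMono (J : KSubset k n) : StrictMono (elt J) :=
  (J.1.orderEmbOfFin J.2).strictMono

theorem range_elt (J : KSubset k n) : Set.range (elt J) = J.1 :=
  J.1.range_orderEmbOfFin J.2

theorem elt_injective : Function.Injective (elt : KSubset k n → Fin k → Fin n) := by
  intro I J h
  rw [← Subtype.coe_inj, ← Finset.coe_inj, ← range_elt, ← range_elt, h]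

/-- The `l`-th smallest element of `J` as a natural number, counting from `0`; for `l ≥ k` it has
the junk value `0`. -/
def entry (J : KSubset k n) (l : ℕ) : ℕ := if h : l < k then elt J ⟨l, h⟩ else 0

theorem entry_of_lt (J : KSubset k n) {l : ℕ} (h : l < k) : entry J l = elt J ⟨l, h⟩ := dif_pos h

theorem entry_coe (J : KSubset k n) (l : Fin k) : entry J l = elt J l := dif_pos l.2

theorem entry_lt_entry (J : KSubset k n) {a b : ℕ} (h : a < b) (hb : b < k) :
    entry J a < entry J b := by
  rw [entry_of_lt J (h.trans hb), entry_of_lt J hb]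
  exact elt_strictMono J h

theorem entry_lt (J : KSubset k n) {l : ℕ} (h : l < k) : entry J l < n := by
  rw [entry_of_lt J h]
  exact Fin.is_lt _

theorem entry_le (J : KSubset k n) (l : ℕ) : entry J l ≤ n := by
  unfold entry
  split_ifs
  exacts [(Fin.is_lt _).le, Nat.zero_le _]

theorem mem_iff_exists_entry (J : KSubset k n) (x : Fin n) : x ∈ J.1 ↔ ∃ l < k, entry J l = x := by
  rw [← Finset.mem_coe, ← range_elt, Set.mem_range, Fin.exists_iff]
  refine exists_congr fun l => ⟨fun ⟨hl, h⟩ => ⟨hl, ?_⟩, fun ⟨hl, h⟩ => ⟨hl, Fin.ext ?_⟩⟩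
  · rw [entry_of_lt J hl, h]
  · rw [← entry_of_lt J hl, h]

theorem ext_entry {I J : KSubset k n} (h : ∀ l < k, entry I l = entry J l) : I = J := by
  refine elt_injective (funext fun l => Fin.ext ?_)
  rw [← entry_coe, ← entry_coe, h l l.2]

theorem entry_add_sub_le (J : KSubset k n) {a b : ℕ} (h : a ≤ b) (hb : b < k) :
    entry J a + (b - a) ≤ entry J b := by
  induction b, h using Nat.le_induction with
  | base => simp
  | succ b hab ih =>
    have := ih (by omega)
    have := entry_lt_entry J (lt_add_one b) hb
    omega

theorem le_entry (J : KSubset k n) {l : ℕ} (h : l < k) : l ≤ entry J l := by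
  have := entry_add_sub_le J (Nat.zero_le l) h
  omega

theorem entry_le_add (J : KSubset k n) {l : ℕ} (h : l < k) : entry J l ≤ n - k + l := by
  have := entry_add_sub_le J (a := l) (b := k - 1) (by omega) (by omega)
  have := entry_lt J (l := k - 1) (by omega)
  omega

theorem exists_entry_eq {x : ℕ → ℕ} (hx : ∀ l, l + 1 < k → x l < x (l + 1))
    (hn : ∀ l < k, x l < n) : ∃ J : KSubset k n, ∀ l < k, entry J l = x l := by
  have hlt : ∀ a b, a < b → b < k → x a < x b := by
    intro a b hab
    induction b, hab using Nat.le_induction with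
    | base => exact hx a
    | succ b _ ih => exact fun h => (ih (by omega)).trans (hx b h)
  let y : Fin k → Fin n := fun l => ⟨x l, hn l l.2⟩
  have hy : StrictMono y := fun a b hab => Fin.lt_def.2 (hlt a b hab b.2)
  let J : KSubset k n :=
    ⟨Finset.univ.image y, by simp [Finset.card_image_of_injective _ hy.injective]⟩
  have hJ : y = elt J :=
    Finset.orderEmbOfFin_unique J.2 (fun l => Finset.mem_image_of_mem y (Finset.mem_univ l)) hy
  exact ⟨J, fun l hl => by rw [entry_of_lt J hl, ← hJ]⟩

/-- The sequences `x` and `y` cross at the positions `a` and `b`: they agree strictly in between,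
and their values at `a` and `b` interlace. -/
def CrossAt {ι α : Type*} [Preorder ι] [LT α] (x y : ι → α) (a b : ι) : Prop :=
  Set.EqOn x y (Set.Ioo a b) ∧ x a < y a ∧ y a < x b ∧ x b < y b

theorem interiorSegment_eq_iff {I J : KSubset k n} {a b : Fin k} :
    interiorSegment I a b = interiorSegment J a b ↔
      Set.EqOn (elt I) (elt J) (Set.Ioo a b) := by
  have hmono (K : KSubset k n) : StrictMono ((Set.Ioo a b).domRestrict (elt K)) :=
    (elt_strictMono K).comp (Subtype.strictMono_coe _)
  rw [← Set.domRestrict_eq_domRestrict_iff, ← (hmono I).range_inj (hmono J), Set.range_domRestrict,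
    Set.range_domRestrict, ← Finset.coe_inj]
  simp only [interiorSegment, Finset.coe_image, Finset.coe_Ioo]

theorem mem_segment_sdiff_iff {I J : KSubset k n} {a b : Fin k} (hab : a < b)
    (h : Set.EqOn (elt I) (elt J) (Set.Ioo a b)) {x : Fin n} :
    x ∈ segment I a b \ segment J a b ↔
      (x = elt I a ∨ x = elt I b) ∧ x ≠ elt J a ∧ x ≠ elt J b := by
  have split : Finset.Icc a b = insert a (insert b (Finset.Ioo a b)) := by
    ext l
    simp only [Finset.mem_Icc, Finset.mem_insert, Finset.mem_Ioo]
    omega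
  have hI : ∀ l ∈ Finset.Ioo a b, elt I l ≠ elt I a ∧ elt I l ≠ elt I b := by
    intro l hl
    rw [Finset.mem_Ioo] at hl
    exact ⟨(elt_strictMono I hl.1).ne', (elt_strictMono I hl.2).ne⟩
  have hint : interiorSegment J a b = interiorSegment I a b := (interiorSegment_eq_iff.2 h).symm
  have hnot : x = elt I a ∨ x = elt I b → x ∉ interiorSegment I a b := by
    rintro hx hmem
    obtain ⟨l, hl, rfl⟩ := Finset.mem_image.1 hmem
    exact hx.elim (hI l hl).1 (hI l hl).2
  unfold interiorSegment at hint hnot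
  simp only [segment, split, Finset.image_insert, hint, Finset.mem_sdiff, Finset.mem_insert]
  tauto

theorem weaklySeparated_segment_iff {I J : KSubset k n} {a b : Fin k} (hab : a < b)
    (h : Set.EqOn (elt I) (elt J) (Set.Ioo a b)) :
    WeaklySeparated (segment I a b) (segment J a b) ↔
      ¬ CrossAt (elt I) (elt J) a b ∧ ¬ CrossAt (elt J) (elt I) a b := by
  have hI := elt_strictMono I hab
  have hJ := elt_strictMono J hab
  simp only [WeaklySeparated, mem_segment_sdiff_iff hab h, mem_segment_sdiff_iff hab h.symm,
    ← not_or, CrossAt, h, h.symm, true_and]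
  refine not_congr ⟨?_, ?_⟩
  · rintro ⟨p, q, r, s, hpq, hqr, hrs, H | H⟩
    · left; omega
    · right; omega
  · rintro (H | H)
    · refine ⟨elt I a, elt J a, elt I b, elt J b, H.1, H.2.1, H.2.2, Or.inl ?_⟩
      omega
    · refine ⟨elt J a, elt I a, elt J b, elt I b, H.1, H.2.1, H.2.2, Or.inr ?_⟩
      omega

theorem crossAt_entry_iff {I J : KSubset k n} {a b : Fin k} :
    CrossAt (entry I) (entry J) a b ↔ CrossAt (elt I) (elt J) a b := by
  simp only [CrossAt, entry_coe, Fin.lt_def]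
  refine and_congr_left fun _ => ⟨fun h l hl => Fin.ext ?_, fun h l hl => ?_⟩
  · rw [← entry_coe, ← entry_coe, h hl]
  · rw [entry_of_lt I (hl.2.trans b.2), entry_of_lt J (hl.2.trans b.2), h hl]

theorem noncrossing_iff {I J : KSubset k n} :
    Noncrossing I J ↔ ∀ a b, a < b → b < k →
      ¬ CrossAt (entry I) (entry J) a b ∧ ¬ CrossAt (entry J) (entry I) a b := by
  have hfin : Noncrossing I J ↔ ∀ a b : Fin k, a < b →
      ¬ CrossAt (entry I) (entry J) a b ∧ ¬ CrossAt (entry J) (entry I) a b := by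
    refine forall₃_congr fun a b hab => ?_
    rw [or_iff_not_imp_right, not_not, interiorSegment_eq_iff, crossAt_entry_iff,
      crossAt_entry_iff]
    refine ⟨fun H => ?_, fun H h => (weaklySeparated_segment_iff hab h).2 H⟩
    by_cases h : Set.EqOn (elt I) (elt J) (Set.Ioo a b)
    · exact (weaklySeparated_segment_iff hab h).1 (H h)
    · exact ⟨fun hc => h hc.1, fun hc => h hc.1.symm⟩
  rw [hfin]
  exact ⟨fun H a b hab hb => H ⟨a, hab.trans hb⟩ ⟨b, hb⟩ hab, fun H a b hab => H a b hab b.2⟩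

theorem Noncrossing.symm {I J : KSubset k n} (h : Noncrossing I J) : Noncrossing J I := by
  rw [noncrossing_iff] at h ⊢
  exact fun a b hab hb => (h a b hab hb).symm

theorem Noncrossing.refl (I : KSubset k n) : Noncrossing I I := by
  rw [noncrossing_iff]
  exact fun a b _ _ => ⟨fun h => lt_irrefl _ h.2.1, fun h => lt_irrefl _ h.2.1⟩

/-! ### Uncrossing -/

section LeadingTerm

variable {R : Type*} [CommRing R] [LinearOrder R] [IsStrictOrderedRing R] {N : R} {d : ℕ → R}

theorem abs_sum_pow_mul_lt (hN : 0 < N) (hd : ∀ l, |d l| ≤ N - 1) (a : ℕ) :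
    |∑ l ∈ Finset.range a, N ^ l * d l| < N ^ a := by
  induction a with
  | zero => simp
  | succ a ih =>
    have hlast : |N ^ a * d a| ≤ N ^ a * (N - 1) := by
      rw [abs_mul, abs_of_pos (by positivity)]
      exact mul_le_mul_of_nonneg_left (hd a) (by positivity)
    calc |∑ l ∈ Finset.range (a + 1), N ^ l * d l|
        ≤ |∑ l ∈ Finset.range a, N ^ l * d l| + |N ^ a * d a| := by
          rw [Finset.sum_range_succ]
          exact abs_add_le _ _
      _ < N ^ a + N ^ a * (N - 1) := add_lt_add_of_lt_of_le ih hlast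
      _ = N ^ (a + 1) := by ring

theorem sum_pow_mul_pos (hN : 0 < N) (hd : ∀ l, |d l| ≤ N - 1) {a b : ℕ} (hab : a < b)
    (hzero : ∀ l ∈ Set.Ioo a b, d l = 0) (ha : 1 ≤ d a) :
    0 < ∑ l ∈ Finset.range b, N ^ l * d l := by
  have htrunc : ∑ l ∈ Finset.range b, N ^ l * d l = ∑ l ∈ Finset.range (a + 1), N ^ l * d l := by
    refine (Finset.sum_subset (Finset.range_subset_range.2 hab) fun l hl hl' => ?_).symm
    rw [Finset.mem_range] at hl hl'
    rw [hzero l ⟨by omega, hl⟩, mul_zero]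
  have hhead := (abs_lt.1 (abs_sum_pow_mul_lt hN hd a)).1
  have hlead : N ^ a * 1 ≤ N ^ a * d a := mul_le_mul_of_nonneg_left ha (by positivity)
  rw [htrunc, Finset.sum_range_succ]
  linarith

theorem sum_pow_sub_mul_pos (hN : 0 < N) (hd : ∀ l, |d l| ≤ N - 1) {b m : ℕ} (hbm : b < m)
    (hb : 1 ≤ d b) : 0 < ∑ l ∈ Finset.Ico b m, N ^ (m - l) * d l := by
  have hreflect : ∑ l ∈ Finset.Ico b m, N ^ (m - l) * d l
      = N * ∑ i ∈ Finset.range (m - b), N ^ i * d (m - 1 - i) := by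
    rw [Finset.mul_sum, Finset.sum_Ico_eq_sum_range, ← Finset.sum_range_reflect]
    refine Finset.sum_congr rfl fun i hi => ?_
    rw [Finset.mem_range] at hi
    rw [show b + (m - b - 1 - i) = m - 1 - i by omega, show m - (m - 1 - i) = i + 1 by omega]
    ring
  rw [hreflect]
  refine mul_pos hN (sum_pow_mul_pos hN (fun l => hd _) (a := m - b - 1) (by omega) ?_ ?_)
  · rintro l ⟨hl, hl'⟩
    omega
  · rwa [show m - 1 - (m - b - 1) = b by omega]

end LeadingTerm

/-- The quadratic form `∑_{a < b < m} N ^ (m - b + a) x_a x_b`. It favours pairs with large `a` and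
small `b`, so that exchanging the tails of two crossing sequences makes it drop. -/
def nestedForm {R : Type*} [CommRing R] (m : ℕ) (N : R) (x : ℕ → R) : R :=
  ∑ b ∈ Finset.range m, N ^ (m - b) * x b * ∑ a ∈ Finset.range b, N ^ a * x a

theorem nestedForm_exchange {R : Type*} [CommRing R] (N : R) {t m : ℕ} (ht : t ≤ m)
    {x y x' y' : ℕ → R} (hx : ∀ l < m, x' l = if l < t then x l else y l)
    (hy : ∀ l < m, y' l = if l < t then y l else x l) :
    nestedForm m N x + nestedForm m N y - (nestedForm m N x' + nestedForm m N y') =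
      (∑ l ∈ Finset.range t, N ^ l * (x l - y l)) *
        ∑ l ∈ Finset.Ico t m, N ^ (m - l) * (x l - y l) := by
  have hhead {z z' w : ℕ → R} (hz : ∀ l < m, z' l = if l < t then z l else w l) {b : ℕ}
      (hb : b ≤ t) : ∑ a ∈ Finset.range b, N ^ a * z' a = ∑ a ∈ Finset.range b, N ^ a * z a := by
    refine Finset.sum_congr rfl fun a ha => ?_
    rw [Finset.mem_range] at ha
    rw [hz a (by omega), if_pos (by omega)]
  have htail {z z' w : ℕ → R} (hz : ∀ l < m, z' l = if l < t then z l else w l) {b : ℕ}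
      (hb : b < m) : ∑ a ∈ Finset.Ico t b, N ^ a * z' a = ∑ a ∈ Finset.Ico t b, N ^ a * w a := by
    refine Finset.sum_congr rfl fun a ha => ?_
    rw [Finset.mem_Ico] at ha
    rw [hz a (by omega), if_neg (by omega)]
  unfold nestedForm
  simp only [← Finset.sum_add_distrib, ← Finset.sum_sub_distrib, Finset.mul_sum _ _ (∑ _ ∈ _, _)]
  rw [← Finset.sum_range_add_sum_Ico _ ht, ← zero_add (∑ l ∈ Finset.Ico t m, _ * (_ * _))]
  congr 1
  · refine Finset.sum_eq_zero fun b hb => ?_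
    rw [Finset.mem_range] at hb
    rw [hx b (by omega), hy b (by omega), if_pos hb, if_pos hb, hhead hx hb.le, hhead hy hb.le]
    ring
  · refine Finset.sum_congr rfl fun b hb => ?_
    obtain ⟨htb, hbm⟩ := Finset.mem_Ico.1 hb
    simp only [← Finset.sum_range_add_sum_Ico _ htb, mul_sub, Finset.sum_sub_distrib]
    rw [hx b hbm, hy b hbm, if_neg (by omega), if_neg (by omega), hhead hx le_rfl,
      hhead hy le_rfl, htail hx hbm, htail hy hbm]
    ring

/-- The quantity that is minimized in order to resolve all crossings. -/
def potential (J : KSubset k n) : ℝ := nestedForm k ((n : ℝ) + 1) fun l => (entry J l : ℝ)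

theorem abs_entry_sub_entry_le (I J : KSubset k n) (l : ℕ) :
    |(entry J l : ℝ) - entry I l| ≤ (n : ℝ) + 1 - 1 := by
  have hI : (entry I l : ℝ) ≤ n := by exact_mod_cast entry_le I l
  have hJ : (entry J l : ℝ) ≤ n := by exact_mod_cast entry_le J l
  rw [add_sub_cancel_right, abs_sub_le_iff]
  constructor <;> linarith [(entry I l).cast_nonneg (α := ℝ), (entry J l).cast_nonneg (α := ℝ)]

theorem potential_exchange_lt {I J I' J' : KSubset k n} {a b : ℕ} (hab : a < b) (hb : b < k)
    (h : CrossAt (entry I) (entry J) a b)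
    (hI' : ∀ l < k, entry I' l = if l < b then entry I l else entry J l)
    (hJ' : ∀ l < k, entry J' l = if l < b then entry J l else entry I l) :
    potential I' + potential J' < potential I + potential J := by
  obtain ⟨heq, hlt_a, -, hlt_b⟩ := h
  have hN : (0 : ℝ) < n + 1 := by positivity
  have hhead := sum_pow_mul_pos hN (abs_entry_sub_entry_le I J) hab
    (fun l hl => by rw [heq hl, sub_self]) (le_sub_iff_add_le'.2 (by exact_mod_cast hlt_a))
  have htail := sum_pow_sub_mul_pos hN (abs_entry_sub_entry_le I J) hb
    (le_sub_iff_add_le'.2 (by exact_mod_cast hlt_b))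
  have hdrop := nestedForm_exchange (n + 1 : ℝ) hb.le (x := fun l => (entry J l : ℝ))
    (y := fun l => (entry I l : ℝ)) (x' := fun l => (entry J' l : ℝ))
    (y' := fun l => (entry I' l : ℝ)) (fun l hl => by simp only [hJ' l hl, Nat.cast_ite])
    (fun l hl => by simp only [hI' l hl, Nat.cast_ite])
  have := hdrop ▸ mul_pos hhead htail
  unfold potential
  linarith

theorem exists_entry_eq_ite {I J : KSubset k n} {b : ℕ} (h : entry I (b - 1) < entry J b) :
    ∃ K : KSubset k n, ∀ l < k, entry K l = if l < b then entry I l else entry J l := by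
  refine exists_entry_eq (fun l hl => ?_) fun l hl => ?_
  · have hI := entry_lt_entry I (lt_add_one l) hl
    have hJ := entry_lt_entry J (lt_add_one l) hl
    split_ifs with h1 h2
    · exact hI
    · obtain rfl : b = l + 1 := by omega
      exact h
    · omega
    · exact hJ
  · split_ifs
    exacts [entry_lt I hl, entry_lt J hl]

theorem exists_uncrossing {I J : KSubset k n} {a b : ℕ} (hab : a < b) (hb : b < k)
    (h : CrossAt (entry I) (entry J) a b) :
    ∃ I' J' : KSubset k n, potential I' + potential J' < potential I + potential J ∧
      ∀ l < k, ∀ g : ℕ → ℝ,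
        g (entry I' l) + g (entry J' l) = g (entry I l) + g (entry J l) := by
  obtain ⟨heq, hlt_a, hlt_ab, hlt_b⟩ := id h
  have hIb := entry_lt_entry I (a := b - 1) (b := b) (by omega) hb
  have hJI : entry J (b - 1) < entry I b := by
    obtain rfl | hne := eq_or_ne a (b - 1)
    · exact hlt_ab
    · rwa [← heq ⟨by omega, by omega⟩]
  obtain ⟨I', hI'⟩ := exists_entry_eq_ite (hIb.trans hlt_b)
  obtain ⟨J', hJ'⟩ := exists_entry_eq_ite hJI
  refine ⟨I', J', potential_exchange_lt hab hb h hI' hJ', fun l hl g => ?_⟩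
  rw [hI' l hl, hJ' l hl]
  split_ifs
  exacts [rfl, add_comm _ _]

/-- Two weightings of the `k`-element subsets induce the same weighting of the `l`-th entries, for
every `l`. -/
def SameMarginals (c c' : KSubset k n → ℝ) : Prop :=
  ∀ l < k, ∀ g : ℕ → ℝ, ∑ J, c J * g (entry J l) = ∑ J, c' J * g (entry J l)

theorem SameMarginals.sum_eq {c c' : KSubset k n → ℝ} (h : SameMarginals c c') (hk : 0 < k) :
    ∑ J, c J = ∑ J, c' J := by
  simpa using h 0 hk fun _ => 1

/-- The sets with nonzero weight are pairwise noncrossing. -/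
def NoncrossingSupport (c : KSubset k n → ℝ) : Prop :=
  ∀ I J, c I ≠ 0 → c J ≠ 0 → Noncrossing I J

theorem isCompact_setOf_sameMarginals {T : Set ℝ} (hT : IsClosed T) (hk : 0 < k)
    (c : KSubset k n → ℝ) :
    IsCompact {c' : KSubset k n → ℝ | 0 ≤ c' ∧ (∀ J, c' J ∈ T) ∧ SameMarginals c' c} := by
  refine IsCompact.of_isClosed_subset
    (isCompact_univ_pi fun _ => isCompact_Icc (a := 0) (b := ∑ J, c J)) ?_ ?_
  · simp only [SameMarginals, Set.ofPred_and, Set.ofPred_forall]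
    refine isClosed_Ici.inter (IsClosed.inter ?_ ?_)
    · exact isClosed_iInter fun J => hT.preimage (continuous_apply J)
    · refine isClosed_iInter fun l => isClosed_iInter fun _ => isClosed_iInter fun g =>
        isClosed_eq ?_ continuous_const
      fun_prop
  · rintro c' ⟨hc', -, hm⟩ J -
    rw [← hm.sum_eq hk]
    exact ⟨hc' J, Finset.single_le_sum (fun K _ => hc' K) (Finset.mem_univ J)⟩

/-- The mass `min (c i) (c j)` is moved from `i` and `j` to `i'` and `j'`. -/
theorem exists_transfer {ι : Type*} [Fintype ι] {T : AddSubgroup ℝ} {c : ι → ℝ} (hc : 0 ≤ c)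
    (hcT : ∀ i, c i ∈ T) {i j : ι} (hij : i ≠ j) (hi : c i ≠ 0) (hj : c j ≠ 0) (i' j' : ι) :
    ∃ ε > 0, ∃ c' : ι → ℝ, 0 ≤ c' ∧ (∀ i, c' i ∈ T) ∧
      ∀ g : ι → ℝ, ∑ a, c' a * g a = ∑ a, c a * g a + ε * ((g i' + g j') - (g i + g j)) := by
  classical
  set ε := min (c i) (c j) with hε
  have hε_pos : 0 < ε := lt_min ((hc i).lt_of_ne' hi) ((hc j).lt_of_ne' hj)
  have hεT : ε ∈ T := by
    rcases min_choice (c i) (c j) with h | h <;> rw [hε, h] <;> exact hcT _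
  have hsingleT (a b : ι) : (Pi.single a ε : ι → ℝ) b ∈ T := by
    rw [Pi.single_apply]
    split_ifs
    exacts [hεT, T.zero_mem]
  have hsingle_nonneg (a : ι) : 0 ≤ (Pi.single a ε : ι → ℝ) := Pi.single_nonneg.2 hε_pos.le
  have hle : Pi.single i ε + Pi.single j ε ≤ c := by
    intro a
    simp only [Pi.add_apply, Pi.single_apply]
    split_ifs with h1 h2 h2
    · exact absurd (h1.symm.trans h2) hij
    · rw [h1, add_zero]
      exact min_le_left _ _
    · rw [h2, zero_add]
      exact min_le_right _ _
    · rw [add_zero]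
      exact hc a
  refine ⟨ε, hε_pos, c - (Pi.single i ε + Pi.single j ε) + (Pi.single i' ε + Pi.single j' ε),
    add_nonneg (sub_nonneg.2 hle) (add_nonneg (hsingle_nonneg i') (hsingle_nonneg j')),
    fun a => ?_, fun g => ?_⟩
  · exact T.add_mem (T.sub_mem (hcT a) (T.add_mem (hsingleT _ _) (hsingleT _ _)))
      (T.add_mem (hsingleT _ _) (hsingleT _ _))
  · simp only [Pi.add_apply, Pi.sub_apply, add_mul, sub_mul, Finset.sum_add_distrib,
      Finset.sum_sub_distrib, Pi.single_apply, ite_mul, zero_mul, Finset.sum_ite_eq',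
      Finset.mem_univ, if_true]
    ring

theorem exists_noncrossingSupport {T : AddSubgroup ℝ} (hT : IsClosed (T : Set ℝ)) (hk : 0 < k)
    {c : KSubset k n → ℝ} (hc : 0 ≤ c) (hcT : ∀ J, c J ∈ T) :
    ∃ c' : KSubset k n → ℝ, 0 ≤ c' ∧ (∀ J, c' J ∈ T) ∧ NoncrossingSupport c' ∧
      SameMarginals c' c := by
  obtain ⟨c', ⟨hc', hcT', hm⟩, hmin⟩ :=
    (isCompact_setOf_sameMarginals hT hk c).exists_isMinOn (f := fun c' => ∑ J, c' J * potential J)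
      ⟨c, hc, hcT, fun _ _ _ => rfl⟩ (by fun_prop)
  have hnot : ∀ I J, c' I ≠ 0 → c' J ≠ 0 → ∀ a b, a < b → b < k →
      ¬ CrossAt (entry I) (entry J) a b := by
    intro I J hI hJ a b hab hb hcross
    have hIJ : I ≠ J := by
      rintro rfl
      exact lt_irrefl _ hcross.2.1
    obtain ⟨I', J', hlt, hg⟩ := exists_uncrossing hab hb hcross
    obtain ⟨ε, hε, c'', hc'', hcT'', hsum⟩ := exists_transfer hc' hcT' hIJ hI hJ I' J'
    have hle := isMinOn_iff.1 hmin c'' ⟨hc'', hcT'', fun l hl g => by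
      rw [hsum, hg l hl g, sub_self, mul_zero, add_zero, hm l hl g]⟩
    rw [hsum] at hle
    linarith [mul_neg_of_pos_of_neg hε (sub_neg.2 hlt)]
  refine ⟨c', hc', hcT', fun I J hI hJ => noncrossing_iff.2 fun a b hab hb => ?_, hm⟩
  exact ⟨hnot I J hI hJ a b hab hb, hnot J I hJ hI a b hab hb⟩

/-! ### Uniqueness of noncrossing weightings -/

section Joint

variable {ι α β M : Type*} [Fintype ι] [DecidableEq α] [DecidableEq β] [AddCommMonoid M]
  {c c' : ι → M} {p : ι → α} {q : ι → β} {x : α} {z : β}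

/-- The joint distribution of `p` and `q` under the weighting `c`: the total weight of the elements
at which `p` and `q` take the given values. -/
def joint (c : ι → M) (p : ι → α) (q : ι → β) (x : α) (z : β) : M := ∑ i with p i = x ∧ q i = z, c i

theorem joint_swap (c : ι → M) (p : ι → α) (q : ι → β) (x : α) (z : β) :
    joint c p q x z = joint c q p z x := by
  simp only [joint, and_comm]

theorem exists_of_joint_ne_zero (h : joint c p q x z ≠ 0) : ∃ i, c i ≠ 0 ∧ p i = x ∧ q i = z := by
  obtain ⟨i, hi, hc⟩ := Finset.exists_ne_zero_of_sum_ne_zero h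
  exact ⟨i, hc, (Finset.mem_filter.1 hi).2⟩

theorem sum_joint {s : Finset α} (hs : ∀ i, p i ∈ s) (c : ι → M) (q : ι → β) (z : β) :
    ∑ x ∈ s, joint c p q x z = ∑ i with q i = z, c i := by
  rw [← Finset.sum_fiberwise_of_maps_to (fun i _ => hs i)]
  simp only [joint, Finset.filter_filter, and_comm]

variable [LinearOrder M] [IsOrderedCancelAddMonoid M]

theorem joint_nonneg (hc : 0 ≤ c) (p : ι → α) (q : ι → β) (x : α) (z : β) : 0 ≤ joint c p q x z :=
  Finset.sum_nonneg fun i _ => hc i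

theorem exists_joint_lt_left (hq : ∀ z, ∑ i with q i = z, c i = ∑ i with q i = z, c' i)
    (h : joint c' p q x z < joint c p q x z) : ∃ x', joint c p q x' z < joint c' p q x' z := by
  by_contra! hle
  let s : Finset α := insert x (Finset.univ.image p)
  have hs : ∀ i, p i ∈ s := fun i =>
    Finset.mem_insert_of_mem (Finset.mem_image_of_mem p (Finset.mem_univ i))
  have hlt := Finset.sum_lt_sum (s := s) (fun x' _ => hle x') ⟨x, Finset.mem_insert_self _ _, h⟩
  rw [sum_joint hs, sum_joint hs, hq] at hlt
  exact lt_irrefl _ hlt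

theorem exists_joint_lt_right (hp : ∀ x, ∑ i with p i = x, c i = ∑ i with p i = x, c' i)
    (h : joint c' p q x z < joint c p q x z) : ∃ z', joint c p q x z' < joint c' p q x z' := by
  simp only [joint_swap _ p q] at h ⊢
  exact exists_joint_lt_left hp h

variable [LinearOrder α] [LinearOrder β]

theorem not_joint_lt (hc : 0 ≤ c) (hc' : 0 ≤ c')
    (hp : ∀ x, ∑ i with p i = x, c i = ∑ i with p i = x, c' i)
    (hq : ∀ z, ∑ i with q i = z, c i = ∑ i with q i = z, c' i)
    (hnc : ∀ i j l, c' i ≠ 0 → c' j ≠ 0 → p i < p j → p l = p j → q l = q i → q j ≤ q i)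
    (hx : ∀ x', x < x' → joint c p q x' z = joint c' p q x' z)
    (hz : ∀ x', ∀ z' < z, joint c p q x' z' = joint c' p q x' z') :
    ¬ joint c' p q x z < joint c p q x z := by
  intro hlt
  obtain ⟨x', hx'⟩ := exists_joint_lt_left hq hlt
  obtain ⟨z', hz'⟩ := exists_joint_lt_right hp hlt
  have hx'x : x' < x := by
    by_contra! hle
    rcases hle.eq_or_lt with rfl | h
    exacts [hx'.not_gt hlt, hx'.ne (hx x' h)]
  have hzz' : z < z' := by
    by_contra! hle
    rcases hle.eq_or_lt with rfl | h
    exacts [hz'.not_gt hlt, hz'.ne (hz x z' h)]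
  obtain ⟨l, -, hlp, hlq⟩ := exists_of_joint_ne_zero ((joint_nonneg hc' p q x z).trans_lt hlt).ne'
  obtain ⟨i, hi, rfl, rfl⟩ :=
    exists_of_joint_ne_zero ((joint_nonneg hc p q x' z).trans_lt hx').ne'
  obtain ⟨j, hj, rfl, rfl⟩ :=
    exists_of_joint_ne_zero ((joint_nonneg hc p q x z').trans_lt hz').ne'
  exact hzz'.not_ge (hnc i j l hi hj hx'x hlp hlq)

theorem joint_eq (hc : 0 ≤ c) (hc' : 0 ≤ c')
    (hp : ∀ x, ∑ i with p i = x, c i = ∑ i with p i = x, c' i)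
    (hq : ∀ z, ∑ i with q i = z, c i = ∑ i with q i = z, c' i)
    (hnc : ∀ i j l, c i ≠ 0 → c j ≠ 0 → p i < p j → p l = p j → q l = q i → q j ≤ q i)
    (hnc' : ∀ i j l, c' i ≠ 0 → c' j ≠ 0 → p i < p j → p l = p j → q l = q i → q j ≤ q i)
    (x : α) (z : β) : joint c p q x z = joint c' p q x z := by
  let D : Finset ι := {i | joint c p q (p i) (q i) ≠ joint c' p q (p i) (q i)}
  have exists_mem {x z} (h : joint c p q x z ≠ joint c' p q x z) :
      ∃ i ∈ D, p i = x ∧ q i = z := by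
    obtain ⟨i, -, rfl, rfl⟩ : ∃ i, (c i ≠ 0 ∨ c' i ≠ 0) ∧ p i = x ∧ q i = z := by
      by_cases h0 : joint c p q x z = 0
      · obtain ⟨i, hi⟩ := exists_of_joint_ne_zero (h0 ▸ h).symm
        exact ⟨i, hi.imp_left Or.inr⟩
      · obtain ⟨i, hi⟩ := exists_of_joint_ne_zero h0
        exact ⟨i, hi.imp_left Or.inl⟩
    exact ⟨i, Finset.mem_filter.2 ⟨Finset.mem_univ i, h⟩, rfl, rfl⟩
  by_contra hne
  obtain ⟨i₀, hi₀, -⟩ := exists_mem hne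
  -- a discrepancy with the smallest value of `q` and, among those, the largest value of `p`
  obtain ⟨i, hi, hmax⟩ :=
    D.exists_max_image (fun i => toLex (OrderDual.toDual (q i), p i)) ⟨i₀, hi₀⟩
  have hx : ∀ x', p i < x' → joint c p q x' (q i) = joint c' p q x' (q i) := by
    by_contra! ⟨x', hlt, h⟩
    obtain ⟨j, hj, rfl, hq⟩ := exists_mem h
    exact (hmax j hj).not_gt (Prod.Lex.lt_iff.2 (Or.inr ⟨hq.symm, hlt⟩))
  have hz : ∀ x', ∀ z' < q i, joint c p q x' z' = joint c' p q x' z' := by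
    by_contra! ⟨x', z', hlt, h⟩
    obtain ⟨j, hj, rfl, rfl⟩ := exists_mem h
    exact (hmax j hj).not_gt (Prod.Lex.lt_iff.2 (Or.inl hlt))
  rcases lt_or_gt_of_ne (Finset.mem_filter.1 hi).2 with h | h
  · exact not_joint_lt hc' hc (fun x => (hp x).symm) (fun z => (hq z).symm) hnc
      (fun x' hx' => (hx x' hx').symm) (fun x' z' hz' => (hz x' z' hz').symm) h
  · exact not_joint_lt hc hc' hp hq hnc' hx hz h

end Joint

/-- The first `b` entries of `J`, compared at the last position where they differ. -/
def initialEntries (b : ℕ) (J : KSubset k n) : Colex (Fin b → ℕ) := toColex fun l => entry J l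

theorem initialEntries_eq_iff {b : ℕ} {I J : KSubset k n} :
    initialEntries b I = initialEntries b J ↔ ∀ l < b, entry I l = entry J l := by
  simp only [initialEntries, toColex_inj, funext_iff, Fin.forall_iff]

theorem initialEntries_succ_eq_iff {b : ℕ} {I J : KSubset k n} :
    initialEntries (b + 1) I = initialEntries (b + 1) J ↔
      initialEntries b I = initialEntries b J ∧ entry I b = entry J b := by
  simp only [initialEntries_eq_iff, Nat.forall_lt_succ_right]

theorem exists_of_initialEntries_lt {b : ℕ} {I J : KSubset k n}
    (h : initialEntries b I < initialEntries b J) :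
    ∃ a < b, entry I a < entry J a ∧ Set.EqOn (entry I) (entry J) (Set.Ioo a b) := by
  obtain ⟨a, heq, hlt⟩ := h
  exact ⟨a, a.2, hlt, fun l hl => heq ⟨l, hl.2⟩ hl.1⟩

theorem NoncrossingSupport.entry_le_of_initialEntries_lt {c : KSubset k n → ℝ}
    (hnc : NoncrossingSupport c) {b : ℕ} (hb : b < k) {I J K : KSubset k n} (hI : c I ≠ 0)
    (hJ : c J ≠ 0) (hIJ : initialEntries b I < initialEntries b J)
    (hKJ : initialEntries b K = initialEntries b J) (hKI : entry K b = entry I b) :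
    entry J b ≤ entry I b := by
  obtain ⟨a, hab, hlt, heq⟩ := exists_of_initialEntries_lt hIJ
  by_contra! hgt
  refine (noncrossing_iff.1 (hnc I J hI hJ) a b hab hb).1 ⟨heq, hlt, ?_, hgt⟩
  rw [← hKI, ← initialEntries_eq_iff.1 hKJ a hab]
  exact entry_lt_entry K hab hb

theorem NoncrossingSupport.sum_initialEntries_eq (hk : 0 < k) {c c' : KSubset k n → ℝ}
    (hc : 0 ≤ c) (hc' : 0 ≤ c') (hnc : NoncrossingSupport c) (hnc' : NoncrossingSupport c')
    (hm : SameMarginals c c') {b : ℕ} (hb : b ≤ k) (x : Colex (Fin b → ℕ)) :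
    ∑ J with initialEntries b J = x, c J = ∑ J with initialEntries b J = x, c' J := by
  induction b with
  | zero =>
    have hx (J : KSubset k n) : initialEntries 0 J = x := ofColex.injective (Subsingleton.elim _ _)
    simpa only [hx, Finset.filter_true] using hm.sum_eq hk
  | succ b ih =>
    have hentry (z : ℕ) : ∑ J with entry J b = z, c J = ∑ J with entry J b = z, c' J := by
      simpa [Finset.sum_filter] using hm b hb fun t => if t = z then 1 else 0
    by_cases hx : ∃ K : KSubset k n, initialEntries (b + 1) K = x
    · obtain ⟨K, rfl⟩ := hx
      simp only [initialEntries_succ_eq_iff]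
      exact joint_eq hc hc' (ih (by omega)) hentry
        (fun _ _ _ => hnc.entry_le_of_initialEntries_lt hb)
        (fun _ _ _ => hnc'.entry_le_of_initialEntries_lt hb) _ _
    · push Not at hx
      simp [hx]

theorem NoncrossingSupport.eq_of_sameMarginals (hk : 0 < k) {c c' : KSubset k n → ℝ}
    (hc : 0 ≤ c) (hc' : 0 ≤ c') (hnc : NoncrossingSupport c) (hnc' : NoncrossingSupport c')
    (hm : SameMarginals c c') : c = c' := by
  funext K
  have hinj (J : KSubset k n) : initialEntries k J = initialEntries k K ↔ J = K :=
    ⟨fun h => ext_entry (initialEntries_eq_iff.1 h), congrArg _⟩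
  simpa [hinj, Finset.filter_eq'] using
    hnc.sum_initialEntries_eq hk hc hc' hnc' hm le_rfl (initialEntries k K)

/-! ### Linear combinations of the vectors `f` and `v` -/

/-- The linear combination of the vectors `f q` with given coefficients. -/
noncomputable def fComb : Grid k n →ₗ[ℝ] Grid k n := Fintype.linearCombination ℝ f

theorem fComb_apply (a : Grid k n) : fComb a = ∑ q, a q • f q :=
  Fintype.linearCombination_apply ℝ f a

theorem fComb_apply_finRotate (a : Grid k n) (i : Fin (k - 1)) (j : Fin (n - k)) :
    fComb a (i, finRotate _ j) = a (i, finRotate _ j) - a (i, j) := by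
  have hiff (q : Fin (k - 1) × Fin (n - k)) :
      ((i, finRotate _ j) = (q.1, finRotate _ q.2)) ↔ (i, j) = q := by
    simp only [Prod.ext_iff, EmbeddingLike.apply_eq_iff_eq]
  simp only [fComb_apply, Finset.sum_apply, Pi.smul_apply, f, e, Pi.sub_apply, smul_eq_mul,
    mul_sub, Finset.sum_sub_distrib, Pi.single_apply, mul_ite, mul_one, mul_zero, hiff,
    Finset.sum_ite_eq, Finset.mem_univ, if_true]

theorem eq_of_forall_finRotate {α : Type*} {m : ℕ} {b : Fin m → α}
    (h : ∀ j, b (finRotate m j) = b j) (j j' : Fin m) : b j = b j' := by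
  obtain _ | m := m
  · exact j.elim0
  have hzero (j : Fin (m + 1)) : b j = b 0 := by
    induction j using Fin.induction with
    | zero => rfl
    | succ i ih =>
      rw [← ih, ← h i.castSucc, finRotate_apply, Fin.coeSucc_eq_succ]
  rw [hzero j, hzero j']

theorem fComb_eq_zero_iff {a : Grid k n} : fComb a = 0 ↔ ∀ i j j', a (i, j) = a (i, j') := by
  refine ⟨fun h i => eq_of_forall_finRotate fun j => ?_, fun h => funext fun ⟨i, j⟩ => ?_⟩
  · rw [← sub_eq_zero, ← fComb_apply_finRotate, h, Pi.zero_apply]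
  · obtain ⟨j, rfl⟩ := (finRotate (n - k)).surjective j
    rw [fComb_apply_finRotate, h i _ j, sub_self, Pi.zero_apply]

theorem sum_f_eq_zero (i : Fin (k - 1)) : ∑ j, (f (i, j) : Grid k n) = 0 := by
  simp only [f, Finset.sum_sub_distrib, sub_eq_zero]
  exact (Equiv.sum_comp (finRotate (n - k)) fun j => (e (i, j) : Grid k n)).symm

theorem f_mem_rowZero (q : Fin (k - 1) × Fin (n - k)) : f q ∈ rowZero k n := by
  intro i
  simp only [f, e, Pi.sub_apply, Finset.sum_sub_distrib, Pi.single_apply, Prod.ext_iff]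
  by_cases h : i = q.1 <;> simp [h]

theorem fComb_mem_rowZero (a : Grid k n) : fComb a ∈ rowZero k n := by
  rw [fComb_apply]
  exact Submodule.sum_mem _ fun q _ => Submodule.smul_mem _ _ (f_mem_rowZero q)

theorem val_finRotate_eq_or {m : ℕ} (j : Fin m) :
    ((finRotate m j : ℕ) = j + 1 ∧ (j : ℕ) + 1 < m) ∨
      ((finRotate m j : ℕ) = 0 ∧ (j : ℕ) + 1 = m) := by
  obtain _ | m := m
  · exact j.elim0
  rw [coe_finRotate]
  split_ifs with h
  · simp [h]
  · have : (j : ℕ) ≠ m := fun h' => h (Fin.ext h')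
    omega

theorem exists_fComb_eq {y : Grid k n} (hy : y ∈ rowZero k n) : ∃ a, fComb a = y := by
  refine ⟨fun q => ∑ j ∈ Finset.Iic q.2, y (q.1, j), funext fun ⟨i, j⟩ => ?_⟩
  obtain ⟨j, rfl⟩ := (finRotate (n - k)).surjective j
  rw [fComb_apply_finRotate, sub_eq_iff_eq_add]
  rcases val_finRotate_eq_or j with ⟨hval, -⟩ | ⟨hval, hlast⟩
  · have hIic : Finset.Iic (finRotate (n - k) j) =
        insert (finRotate (n - k) j) (Finset.Iic j) := by
      ext
      simp only [Finset.mem_Iic, Finset.mem_insert, Fin.le_def, Fin.ext_iff]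
      omega
    rw [hIic, Finset.sum_insert (by simp only [Finset.mem_Iic, Fin.le_def]; omega)]
  · have hfirst : Finset.Iic (finRotate (n - k) j) = {finRotate (n - k) j} := by
      ext
      simp only [Finset.mem_Iic, Finset.mem_singleton, Fin.le_def, Fin.ext_iff]
      omega
    have huniv : Finset.Iic j = Finset.univ := by
      ext j'
      have := j'.2
      simp only [Finset.mem_Iic, Finset.mem_univ, Fin.le_def, iff_true]
      omega
    rw [hfirst, Finset.sum_singleton, huniv, hy i, add_zero]

/-- The space of real `k × (n - k)` arrays, in which the `k`-element subsets are represented by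
their order filters. -/
abbrev Arr (k n : ℕ) : Type := Fin k × Fin (n - k) → ℝ

/-- Differences of consecutive rows. -/
def rowDiff : Arr k n →ₗ[ℝ] Grid k n where
  toFun F q := F (⟨q.1, by omega⟩, q.2) - F (⟨q.1 + 1, by omega⟩, q.2)
  map_add' F F' := by
    funext q
    simp only [Pi.add_apply]
    ring
  map_smul' r F := by
    funext q
    simp only [Pi.smul_apply, RingHom.id_apply, smul_eq_mul]
    ring

theorem rowDiff_apply (F : Arr k n) (q : Fin (k - 1) × Fin (n - k)) :
    rowDiff F q = F (⟨q.1, by omega⟩, q.2) - F (⟨q.1 + 1, by omega⟩, q.2) := rfl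

/-- The indicator array of the order filter of `k × (n - k)` that corresponds to `J`: the lattice
path bounding it is read off from `J`. -/
noncomputable def filterArray (J : KSubset k n) : Arr k n := fun p =>
  if entry J p.1 ≤ p.2 + p.1 then 1 else 0

theorem rowDiff_filterArray (J : KSubset k n) (q : Fin (k - 1) × Fin (n - k)) :
    rowDiff (filterArray J) q = if q ∈ cells J then 1 else 0 := by
  have h := entry_lt_entry J (a := q.1) (b := q.1 + 1) (by omega) (by omega)
  have hq : q ∈ cells J ↔ entry J q.1 ≤ q.2 + q.1 ∧ (q.2 : ℕ) + q.1 + 1 < entry J (q.1 + 1) := by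
    simp only [cells, Finset.mem_filter, Finset.mem_univ, true_and, ← entry_of_lt]
  simp only [rowDiff_apply, filterArray, hq]
  split_ifs <;> first | omega | norm_num

theorem v_eq_fComb (J : KSubset k n) : v J = fComb (rowDiff (filterArray J)) := by
  simp only [fComb_apply, rowDiff_filterArray, ite_smul, one_smul, zero_smul, Finset.sum_ite_mem,
    Finset.univ_inter, v]

/-- The linear combination of the vectors `v J` with given coefficients. -/
noncomputable def vComb : (KSubset k n → ℝ) →ₗ[ℝ] Grid k n := Fintype.linearCombination ℝ v

theorem vComb_apply (c : KSubset k n → ℝ) : vComb c = ∑ J, c J • v J :=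
  Fintype.linearCombination_apply ℝ v c

/-- The linear combination of the arrays `filterArray J` with given coefficients. -/
noncomputable def filterComb : (KSubset k n → ℝ) →ₗ[ℝ] Arr k n :=
  Fintype.linearCombination ℝ filterArray

theorem filterComb_eq_sum (c : KSubset k n → ℝ) : filterComb c = ∑ J, c J • filterArray J :=
  Fintype.linearCombination_apply ℝ filterArray c

theorem filterComb_apply (c : KSubset k n → ℝ) (p : Fin k × Fin (n - k)) :
    filterComb c p = ∑ J with entry J p.1 ≤ p.2 + p.1, c J := by
  simp only [filterComb_eq_sum, filterArray, Finset.sum_apply, Pi.smul_apply, smul_eq_mul,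
    mul_ite, mul_one, mul_zero, Finset.sum_filter]

theorem vComb_eq (c : KSubset k n → ℝ) : vComb c = fComb (rowDiff (filterComb c)) := by
  simp only [vComb_apply, filterComb_eq_sum, v_eq_fComb, map_sum, map_smul]

theorem SameMarginals.filterComb_eq {c c' : KSubset k n → ℝ} (h : SameMarginals c c') :
    filterComb c = filterComb c' := by
  funext p
  simpa only [filterComb_apply, Finset.sum_filter, mul_ite, mul_one, mul_zero] using
    h p.1 p.1.2 fun t => if t ≤ p.2 + p.1 then 1 else 0

theorem sum_filter_eq_of_sum_filter_le {ι M : Type*} [Fintype ι] [AddCancelCommMonoid M]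
    {c c' : ι → M} {q : ι → ℕ} (h : ∀ t, ∑ i with q i ≤ t, c i = ∑ i with q i ≤ t, c' i) (t : ℕ) :
    ∑ i with q i = t, c i = ∑ i with q i = t, c' i := by
  classical
  cases t with
  | zero => simpa only [Nat.le_zero] using h 0
  | succ t =>
    have hdisj : Disjoint (Finset.univ.filter (q · ≤ t)) (Finset.univ.filter (q · = t + 1)) :=
      Finset.disjoint_filter.2 fun i _ hi => by omega
    have hsucc := h (t + 1)
    simp only [Nat.le_add_one_iff, Finset.filter_or, Finset.sum_union hdisj, h t] at hsucc
    exact add_left_cancel hsucc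

theorem sum_mul_comp_eq_of_sum_filter_le {ι R : Type*} [Fintype ι] [Ring R] {c c' : ι → R}
    {q : ι → ℕ} (h : ∀ t, ∑ i with q i ≤ t, c i = ∑ i with q i ≤ t, c' i) (g : ℕ → R) :
    ∑ i, c i * g (q i) = ∑ i, c' i * g (q i) := by
  have hfiber (c : ι → R) : ∑ i, c i * g (q i) =
      ∑ t ∈ Finset.univ.image q, (∑ i with q i = t, c i) * g t := by
    rw [← Finset.sum_fiberwise_of_maps_to fun i _ => Finset.mem_image_of_mem q (Finset.mem_univ i)]
    refine Finset.sum_congr rfl fun t _ => ?_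
    rw [Finset.sum_mul]
    exact Finset.sum_congr rfl fun i hi => by rw [(Finset.mem_filter.1 hi).2]
  simp only [hfiber, sum_filter_eq_of_sum_filter_le h]

theorem sameMarginals_of_filterComb_eq {c c' : KSubset k n → ℝ}
    (hF : filterComb c = filterComb c') (hs : ∑ J, c J = ∑ J, c' J) : SameMarginals c c' := by
  intro l hl g
  refine sum_mul_comp_eq_of_sum_filter_le (fun t => ?_) g
  rcases lt_or_ge t l with hlt | hge
  · have (J : KSubset k n) : ¬ entry J l ≤ t := by
      have := le_entry J hl
      omega
    simp [this]
  rcases le_or_gt (n - k + l) t with hle | hgt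
  · have (J : KSubset k n) : entry J l ≤ t := (entry_le_add J hl).trans hle
    simpa [this] using hs
  · have := congrFun hF (⟨l, hl⟩, ⟨t - l, by omega⟩)
    simpa only [filterComb_apply, Nat.sub_add_cancel hge] using this

/-! ### Frozen subsets -/

/-- `J` is the interval that starts at `c`; its order filter consists of the columns from `c` on. -/
def IsColumnFilter (J : KSubset k n) (c : ℕ) : Prop := ∀ l < k, entry J l = c + l

/-- `J` consists of the first `r` and the last `k - r` elements; its order filter consists of the
rows before `r`. -/
def IsRowFilter (J : KSubset k n) (r : ℕ) : Prop :=
  ∀ l < k, entry J l = if l < r then l else n - k + l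

theorem exists_isColumnFilter (hkn : k ≤ n) {c : ℕ} (hc : c ≤ n - k) :
    ∃ J : KSubset k n, IsColumnFilter J c :=
  exists_entry_eq (fun l _ => by omega) (fun l hl => by omega)

theorem exists_isRowFilter (hkn : k ≤ n) (r : ℕ) : ∃ J : KSubset k n, IsRowFilter J r :=
  exists_entry_eq (fun l _ => by split_ifs <;> omega) (fun l hl => by split_ifs <;> omega)

theorem IsColumnFilter.mem_iff {J : KSubset k n} {c : ℕ} (h : IsColumnFilter J c) (hkn : k ≤ n)
    (hc : c ≤ n - k) (x : Fin n) : x ∈ J.1 ↔ ∃ t < k, (x : ℕ) = (c + t) % n := by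
  rw [mem_iff_exists_entry]
  refine exists_congr fun l => and_congr_right fun hl => ?_
  rw [h l hl, Nat.mod_eq_of_lt (by omega), eq_comm]

theorem IsRowFilter.mem_iff {J : KSubset k n} {r : ℕ} (h : IsRowFilter J r) (hkn : k ≤ n)
    (hr : r ≤ k) (x : Fin n) : x ∈ J.1 ↔ ∃ t < k, (x : ℕ) = (n - k + r + t) % n := by
  have hwrap {t : ℕ} (ht : k - r ≤ t) (htk : t < k) :
      (n - k + r + t) % n = t - (k - r) := by
    rw [show n - k + r + t = n + (t - (k - r)) by omega, Nat.add_mod_left,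
      Nat.mod_eq_of_lt (by omega)]
  have hx := x.2
  rw [mem_iff_exists_entry]
  constructor
  · rintro ⟨l, hl, hlx⟩
    rw [h l hl] at hlx
    split_ifs at hlx with hlr
    · exact ⟨l + (k - r), by omega, by rw [hwrap (by omega) (by omega)]; omega⟩
    · exact ⟨l - r, by omega, by rw [Nat.mod_eq_of_lt (by omega)]; omega⟩
  · rintro ⟨t, ht, htx⟩
    by_cases htr : k - r ≤ t
    · rw [hwrap htr ht] at htx
      exact ⟨t - (k - r), by omega, by rw [h _ (by omega), if_pos (by omega), htx]⟩
    · rw [Nat.mod_eq_of_lt (by omega)] at htx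
      exact ⟨t + r, by omega, by rw [h _ (by omega), if_neg (by omega)]; omega⟩

theorem IsColumnFilter.frozen {J : KSubset k n} {c : ℕ} (h : IsColumnFilter J c) (hkn : k ≤ n)
    (hc : c ≤ n - k) : Frozen J :=
  ⟨c, h.mem_iff hkn hc⟩

theorem IsRowFilter.frozen {J : KSubset k n} {r : ℕ} (h : IsRowFilter J r) (hkn : k ≤ n)
    (hr : r ≤ k) : Frozen J :=
  ⟨n - k + r, h.mem_iff hkn hr⟩

theorem Frozen.isColumnFilter_or_isRowFilter {J : KSubset k n} (h : Frozen J) (hkn : k ≤ n)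
    (hn : 0 < n) : (∃ c, IsColumnFilter J c) ∨ ∃ r ≤ k, IsRowFilter J r := by
  obtain ⟨s, hs⟩ := h
  wlog hsn : s < n generalizing s
  · exact this (s % n) (by simpa only [Nat.mod_add_mod] using hs) (Nat.mod_lt _ hn)
  by_cases hsk : s ≤ n - k
  · obtain ⟨J', hJ'⟩ := exists_isColumnFilter hkn hsk
    obtain rfl : J = J' := Subtype.ext <| Finset.ext fun x => by rw [hs, hJ'.mem_iff hkn hsk]
    exact .inl ⟨s, hJ'⟩
  · obtain ⟨r, rfl⟩ : ∃ r, s = n - k + r := ⟨s - (n - k), by omega⟩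
    obtain ⟨J', hJ'⟩ := exists_isRowFilter (k := k) hkn r
    obtain rfl : J = J' :=
      Subtype.ext <| Finset.ext fun x => by rw [hs, hJ'.mem_iff hkn (by omega)]
    exact .inr ⟨r, by omega, hJ'⟩

theorem CrossAt.entry_gap {I J : KSubset k n} {a b : ℕ} (h : CrossAt (entry I) (entry J) a b)
    (hab : a < b) (hb : b < k) :
    entry I a + 1 < entry I (a + 1) ∧ entry J (b - 1) + 1 < entry J b := by
  obtain ⟨heq, h₁, h₂, h₃⟩ := h
  rcases Nat.lt_or_ge (a + 1) b with hlt | hge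
  · have hfst := heq (x := a + 1) ⟨by omega, hlt⟩
    have hlst := heq (x := b - 1) ⟨by omega, by omega⟩
    have := entry_lt_entry J (lt_add_one a) (by omega)
    have := entry_lt_entry I (a := b - 1) (b := b) (by omega) hb
    omega
  · obtain rfl : b = a + 1 := by omega
    simp only [Nat.add_sub_cancel]
    omega

theorem IsColumnFilter.noncrossing {J : KSubset k n} {c : ℕ} (h : IsColumnFilter J c)
    (I : KSubset k n) : Noncrossing J I := by
  rw [noncrossing_iff]
  refine fun a b hab hb => ⟨fun hcross => ?_, fun hcross => ?_⟩
  · have := (hcross.entry_gap hab hb).1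
    rw [h _ (by omega), h _ (by omega)] at this
    omega
  · have := (hcross.entry_gap hab hb).2
    rw [h _ (by omega), h _ (by omega)] at this
    omega

theorem IsRowFilter.noncrossing {J : KSubset k n} {r : ℕ} (h : IsRowFilter J r)
    (I : KSubset k n) : Noncrossing J I := by
  rw [noncrossing_iff]
  refine fun a b hab hb => ⟨fun hcross => ?_, fun hcross => ?_⟩
  · have hgap := (hcross.entry_gap hab hb).1
    have hlast := hcross.2.2.2
    have := entry_le_add I hb
    rw [h b hb] at hlast
    rw [h _ (by omega), h _ (by omega)] at hgap
    split_ifs at * <;> omega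
  · have hgap := (hcross.entry_gap hab hb).2
    have hfirst := hcross.2.1
    have := le_entry I (hab.trans hb)
    rw [h a (by omega)] at hfirst
    rw [h _ (by omega), h _ (by omega)] at hgap
    split_ifs at * <;> omega

theorem Frozen.noncrossing {J : KSubset k n} (h : Frozen J) (hkn : k ≤ n) (hn : 0 < n)
    (I : KSubset k n) : Noncrossing J I := by
  rcases h.isColumnFilter_or_isRowFilter hkn hn with ⟨c, hc⟩ | ⟨r, -, hr⟩
  exacts [hc.noncrossing I, hr.noncrossing I]

theorem IsColumnFilter.filterArray_apply {J : KSubset k n} {c : ℕ} (h : IsColumnFilter J c)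
    (p : Fin k × Fin (n - k)) : filterArray J p = if c ≤ p.2 then 1 else 0 := by
  simp only [filterArray, h p.1 p.1.2, add_le_add_iff_right]

theorem IsRowFilter.filterArray_apply {J : KSubset k n} {r : ℕ} (h : IsRowFilter J r)
    (p : Fin k × Fin (n - k)) : filterArray J p = if (p.1 : ℕ) < r then 1 else 0 := by
  have := p.2.2
  simp only [filterArray, h p.1 p.1.2]
  split_ifs <;> first | rfl | omega

theorem Frozen.v_eq_zero {J : KSubset k n} (h : Frozen J) (hkn : k ≤ n) (hn : 0 < n) :
    v J = 0 := by
  rw [v_eq_fComb, fComb_eq_zero_iff]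
  intro i j j'
  rcases h.isColumnFilter_or_isRowFilter hkn hn with ⟨c, hc⟩ | ⟨r, -, hr⟩
  · simp only [rowDiff_apply, hc.filterArray_apply, sub_self]
  · simp only [rowDiff_apply, hr.filterArray_apply]

theorem entry_zero_lt_of_nonfrozen {J : KSubset k n} (h : J ∈ nonfrozen k n) (hkn : k ≤ n) :
    entry J 0 < n - k := by
  by_contra! hge
  refine h (IsColumnFilter.frozen (c := n - k) (fun l hl => ?_) hkn le_rfl)
  have := entry_add_sub_le J (Nat.zero_le l) hl
  have := entry_le_add J hl
  omega

/-! ### Coordinates adapted to the frozen subsets -/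

/-- The index of the last column. -/
def lastCol (hn : k < n) : Fin (n - k) := ⟨n - k - 1, by omega⟩

/-- The index of the last row. -/
def lastRow (hk : 0 < k) : Fin k := ⟨k - 1, by omega⟩

theorem sum_castLE_add_lastCol {M : Type*} [AddCommMonoid M] (hn : k < n) (g : Fin (n - k) → M) :
    ∑ j : Fin (n - k - 1), g (j.castLE (Nat.sub_le _ _)) + g (lastCol hn) = ∑ j, g j := by
  have hlast {m : ℕ} (hm : m - 1 < m) (g : Fin m → M) :
      ∑ j : Fin (m - 1), g (j.castLE (Nat.sub_le _ _)) + g ⟨m - 1, hm⟩ = ∑ j, g j := by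
    cases m with
    | zero => omega
    | succ m => exact (Fin.sum_univ_castSucc g).symm
  exact hlast _ g

/-- Differences with the last column; by `fComb_eq_zero_iff`, these are the coordinates of an array
modulo the kernel of `fComb`. -/
def gridCoord (hn : k < n) : Grid k n →ₗ[ℝ] (Fin (k - 1) × Fin (n - k - 1) → ℝ) :=
  LinearMap.pi fun q =>
    (LinearMap.proj (q.1, q.2.castLE (Nat.sub_le _ _)) : Grid k n →ₗ[ℝ] ℝ) -
      LinearMap.proj (q.1, lastCol hn)

theorem gridCoord_apply (hn : k < n) (a : Grid k n) (q : Fin (k - 1) × Fin (n - k - 1)) :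
    gridCoord hn a q = a (q.1, q.2.castLE (Nat.sub_le _ _)) - a (q.1, lastCol hn) := rfl

theorem gridCoord_eq_zero (hn : k < n) {a : Grid k n} (h : fComb a = 0) : gridCoord hn a = 0 := by
  funext q
  rw [gridCoord_apply, fComb_eq_zero_iff.1 h q.1 _ (lastCol hn), sub_self, Pi.zero_apply]

/-- Differences of consecutive entries in the last row. -/
noncomputable def lastRowDiff (hk : 0 < k) : Arr k n →ₗ[ℝ] (Fin (n - k) → ℝ) :=
  LinearMap.pi fun c => (LinearMap.proj (lastRow hk, c) : Arr k n →ₗ[ℝ] ℝ) -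
    if (c : ℕ) = 0 then 0 else LinearMap.proj (lastRow hk, ⟨c - 1, by omega⟩)

theorem lastRowDiff_apply (hk : 0 < k) (F : Arr k n) (c : Fin (n - k)) :
    lastRowDiff hk F c =
      F (lastRow hk, c) - if (c : ℕ) = 0 then 0 else F (lastRow hk, ⟨c - 1, by omega⟩) := by
  simp only [lastRowDiff, LinearMap.pi_apply, LinearMap.sub_apply, LinearMap.proj_apply]
  split_ifs <;> rfl

/-- The row differences in the last column and the column differences in the last row. -/
noncomputable def frozenCoord (hk : 0 < k) (hn : k < n) :
    Arr k n →ₗ[ℝ] (Fin (k - 1) ⊕ Fin (n - k) → ℝ) :=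
  LinearMap.pi (Sum.elim (fun l => LinearMap.proj (l, lastCol hn) ∘ₗ rowDiff)
    fun c => LinearMap.proj c ∘ₗ lastRowDiff hk)

theorem frozenCoord_inl (hk : 0 < k) (hn : k < n) (F : Arr k n) (l : Fin (k - 1)) :
    frozenCoord hk hn F (.inl l) = rowDiff F (l, lastCol hn) := rfl

theorem frozenCoord_inr (hk : 0 < k) (hn : k < n) (F : Arr k n) (c : Fin (n - k)) :
    frozenCoord hk hn F (.inr c) = lastRowDiff hk F c := rfl

/-- The order filters of the frozen subsets other than the empty one: initial sets of rows and
final sets of columns. -/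
noncomputable def frozenArray : Fin (k - 1) ⊕ Fin (n - k) → Arr k n :=
  Sum.elim (fun l p => if (p.1 : ℕ) ≤ l then 1 else 0) fun c p => if c ≤ p.2 then 1 else 0

/-- The arrays dual to `gridCoord`: initial segments of a column that do not meet the last row. -/
noncomputable def columnArray (q : Fin (k - 1) × Fin (n - k - 1)) : Arr k n := fun p =>
  if (p.1 : ℕ) ≤ q.1 ∧ p.2 = q.2.castLE (Nat.sub_le _ _) then 1 else 0

theorem exists_frozen_filterArray_eq (hkn : k ≤ n) (i : Fin (k - 1) ⊕ Fin (n - k)) :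
    ∃ J : KSubset k n, Frozen J ∧ filterArray J = frozenArray i := by
  rcases i with l | c
  · obtain ⟨J, hJ⟩ := exists_isRowFilter (k := k) hkn (l + 1)
    refine ⟨J, hJ.frozen hkn (by omega), funext fun p => ?_⟩
    simp only [hJ.filterArray_apply, frozenArray, Sum.elim_inl, Nat.lt_succ_iff]
  · obtain ⟨J, hJ⟩ := exists_isColumnFilter (k := k) hkn c.2.le
    exact ⟨J, hJ.frozen hkn c.2.le, funext fun p => hJ.filterArray_apply p⟩

theorem sum_range_ite_le_sub_succ {M : Type*} [AddCommGroup M] (h : ℕ → M) {l m : ℕ}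
    (hl : l ≤ m) : ∑ i ∈ Finset.range m, (if l ≤ i then h i - h (i + 1) else 0) = h l - h m := by
  induction m, hl using Nat.le_induction with
  | base =>
    rw [sub_self]
    exact Finset.sum_eq_zero fun i hi => if_neg (Finset.mem_range.1 hi).not_ge
  | succ m hm ih => rw [Finset.sum_range_succ, ih, if_pos hm, sub_add_sub_cancel]

theorem sum_range_ite_le_sub_pred {M : Type*} [AddCommGroup M] (h : ℕ → M) {c m : ℕ}
    (hc : c < m) :
    ∑ i ∈ Finset.range m, (if i ≤ c then h i - (if i = 0 then 0 else h (i - 1)) else 0) = h c := by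
  have hrange : (Finset.range m).filter (· ≤ c) = Finset.range (c + 1) := by
    ext i
    simp only [Finset.mem_filter, Finset.mem_range]
    omega
  rw [← Finset.sum_filter, hrange, Finset.sum_range_succ']
  simp only [Nat.add_eq_zero_iff, one_ne_zero, and_false, if_false, Nat.add_sub_cancel,
    Finset.sum_range_sub, if_true, sub_zero, sub_add_cancel]

theorem sum_rowDiff_eq (hk : 0 < k) (F : Arr k n) (p : Fin k × Fin (n - k)) :
    ∑ l : Fin (k - 1), (if (p.1 : ℕ) ≤ l then rowDiff F (l, p.2) else 0) =
      F p - F (lastRow hk, p.2) := by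
  let h : ℕ → ℝ := fun i => if hi : i < k then F (⟨i, hi⟩, p.2) else 0
  have hval {i : ℕ} (hi : i < k) : h i = F (⟨i, hi⟩, p.2) := dif_pos hi
  have hsum := sum_range_ite_le_sub_succ h (l := p.1) (m := k - 1) (by omega)
  rw [hval p.1.2, hval (by omega)] at hsum
  rw [← Fin.sum_univ_eq_sum_range
    (fun i => if (p.1 : ℕ) ≤ i then h i - h (i + 1) else 0)] at hsum
  refine Eq.trans (Finset.sum_congr rfl fun l _ => if_congr Iff.rfl ?_ rfl) hsum
  rw [rowDiff_apply, hval (by omega), hval (by omega)]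

theorem sum_lastRowDiff_eq (hk : 0 < k) (F : Arr k n) (j : Fin (n - k)) :
    ∑ c, (if c ≤ j then lastRowDiff hk F c else 0) = F (lastRow hk, j) := by
  let h : ℕ → ℝ := fun i => if hi : i < n - k then F (lastRow hk, ⟨i, hi⟩) else 0
  have hval {i : ℕ} (hi : i < n - k) : h i = F (lastRow hk, ⟨i, hi⟩) := dif_pos hi
  have hsum := sum_range_ite_le_sub_pred h j.2
  rw [hval j.2, ← Fin.sum_univ_eq_sum_range
    (fun i => if i ≤ (j : ℕ) then h i - (if i = 0 then 0 else h (i - 1)) else 0)] at hsum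
  refine Eq.trans (Finset.sum_congr rfl fun c _ => if_congr Iff.rfl ?_ rfl) hsum
  rw [lastRowDiff_apply, hval c.2, hval (by omega)]

theorem sum_frozenCoord_smul (hk : 0 < k) (hn : k < n) (F : Arr k n) (p : Fin k × Fin (n - k)) :
    (∑ i, frozenCoord hk hn F i • frozenArray i) p =
      ∑ l : Fin (k - 1), (if (p.1 : ℕ) ≤ l then rowDiff F (l, lastCol hn) else 0) +
        F (lastRow hk, p.2) := by
  simp only [Fintype.sum_sum_type, Finset.sum_apply, Pi.smul_apply, smul_eq_mul, frozenCoord_inl,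
    frozenCoord_inr, frozenArray, Sum.elim_inl, Sum.elim_inr, mul_ite, mul_one, mul_zero,
    sum_lastRowDiff_eq]

theorem sum_gridCoord_smul (hn : k < n) (a : Grid k n) (p : Fin k × Fin (n - k)) :
    (∑ q, gridCoord hn a q • columnArray q) p =
      ∑ l : Fin (k - 1), if (p.1 : ℕ) ≤ l then a (l, p.2) - a (l, lastCol hn) else 0 := by
  simp only [Fintype.sum_prod_type, Finset.sum_apply, Pi.smul_apply, smul_eq_mul, gridCoord_apply,
    columnArray, mul_ite, mul_one, mul_zero]
  refine Finset.sum_congr rfl fun l _ => ?_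
  have := sum_castLE_add_lastCol hn fun j =>
    if (p.1 : ℕ) ≤ l ∧ p.2 = j then a (l, j) - a (l, lastCol hn) else 0
  rw [sub_self, ite_self, add_zero] at this
  rw [this]
  split_ifs with h <;> simp [h]

theorem sum_columnArray_add_sum_frozenArray (hk : 0 < k) (hn : k < n) (F : Arr k n) :
    ∑ q, gridCoord hn (rowDiff F) q • columnArray q +
      ∑ i, frozenCoord hk hn F i • frozenArray i = F := by
  funext p
  rw [Pi.add_apply, sum_gridCoord_smul, sum_frozenCoord_smul, ← add_assoc,
    ← Finset.sum_add_distrib]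
  simp only [ite_add_ite, add_zero, sub_add_cancel, sum_rowDiff_eq hk]

theorem sum_frozenArray_of_gridCoord_eq_zero (hk : 0 < k) (hn : k < n) {F : Arr k n}
    (hF : gridCoord hn (rowDiff F) = 0) : ∑ i, frozenCoord hk hn F i • frozenArray i = F := by
  simpa only [hF, Pi.zero_apply, zero_smul, Finset.sum_const_zero, zero_add] using
    sum_columnArray_add_sum_frozenArray hk hn F

theorem filterComb_single [DecidableEq (KSubset k n)] (J : KSubset k n) :
    filterComb (Pi.single J 1) = filterArray J := by
  rw [filterComb, Fintype.linearCombination_apply_single, one_smul]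

theorem exists_frozen_combination (hk : 0 < k) (hn : k < n) {Z : Arr k n}
    (hZ : fComb (rowDiff Z) = 0) (t : ℝ) :
    ∃ r : KSubset k n → ℝ, (∀ J, r J ≠ 0 → Frozen J) ∧ filterComb r = Z ∧ ∑ J, r J = t := by
  classical
  have hrec := sum_frozenArray_of_gridCoord_eq_zero hk hn (gridCoord_eq_zero hn hZ)
  choose S hfrozen hS using exists_frozen_filterArray_eq (k := k) hn.le
  obtain ⟨O, hO⟩ := exists_isColumnFilter (k := k) hn.le le_rfl
  have hO_frozen := hO.frozen hn.le le_rfl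
  have hO_zero : filterArray O = 0 := funext fun p => by
    rw [hO.filterArray_apply, if_neg (by omega), Pi.zero_apply]
  set ρ := frozenCoord hk hn Z
  refine ⟨∑ i, ρ i • Pi.single (S i) 1 + (t - ∑ i, ρ i) • Pi.single O 1, fun J hJ => ?_, ?_, ?_⟩
  · contrapose! hJ
    have hne {I : KSubset k n} (hI : Frozen I) : J ≠ I := fun h => hJ (h ▸ hI)
    simp [Pi.single_eq_of_ne (hne hO_frozen), Pi.single_eq_of_ne (hne (hfrozen _))]
  · simp only [map_add, map_sum, map_smul, filterComb_single, hS, hO_zero, smul_zero, add_zero,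
      hrec]
  · simp only [Pi.add_apply, Finset.sum_apply, Pi.smul_apply, smul_eq_mul, Finset.sum_add_distrib]
    rw [Finset.sum_comm]
    simp [← Finset.mul_sum]

/-! ### Noncrossing representations -/

/-- `c` is a nonnegative weighting supported on pairwise noncrossing nonfrozen subsets; every vector
of `rowZero k n` is `vComb c` for exactly one such `c`. -/
structure IsRep (c : KSubset k n → ℝ) : Prop where
  nonneg : 0 ≤ c
  mem_nonfrozen : ∀ J, c J ≠ 0 → J ∈ nonfrozen k n
  noncrossingSupport : NoncrossingSupport c

theorem IsRep.zero : IsRep (0 : KSubset k n → ℝ) :=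
  ⟨le_rfl, fun _ h => absurd rfl h, fun _ _ h => absurd rfl h⟩

theorem IsRep.of_mem_NC {𝒥 : Finset (KSubset k n)} (h : 𝒥 ∈ NC k n) {c : KSubset k n → ℝ}
    (hc : 0 ≤ c) (hcJ : ∀ J, c J ≠ 0 → J ∈ 𝒥) : IsRep c :=
  ⟨hc, fun J hJ => h.1 J (hcJ J hJ), fun I J hI hJ => h.2 I (hcJ I hI) J (hcJ J hJ)⟩

theorem IsRep.filter_mem_NC {c : KSubset k n → ℝ} (h : IsRep c) :
    (Finset.univ.filter fun J => c J ≠ 0) ∈ NC k n :=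
  ⟨fun J hJ => h.mem_nonfrozen J (Finset.mem_filter.1 hJ).2, fun I hI J hJ =>
    h.noncrossingSupport I J (Finset.mem_filter.1 hI).2 (Finset.mem_filter.1 hJ).2⟩

theorem IsRep.eq_zero_of_frozen {c : KSubset k n → ℝ} (h : IsRep c) {J : KSubset k n}
    (hJ : Frozen J) : c J = 0 :=
  not_not.1 fun hc => h.mem_nonfrozen J hc hJ

theorem NoncrossingSupport.add_of_frozen (hkn : k ≤ n) (hn : 0 < n) {c r : KSubset k n → ℝ}
    (hc : NoncrossingSupport c) (hr : ∀ J, r J ≠ 0 → Frozen J) : NoncrossingSupport (c + r) := by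
  intro I J hI hJ
  by_cases hIf : Frozen I
  · exact hIf.noncrossing hkn hn J
  by_cases hJf : Frozen J
  · exact (hJf.noncrossing hkn hn I).symm
  rw [Pi.add_apply, not_not.1 (mt (hr _) hIf), add_zero] at hI
  rw [Pi.add_apply, not_not.1 (mt (hr _) hJf), add_zero] at hJ
  exact hc I J hI hJ

/-- Frozen subsets are noncrossing with everything and only contribute to the kernel of `vComb`.
Adding suitable multiples of them to both sides turns equality of `vComb` into equality of
marginals. -/
theorem IsRep.eq_of_vComb_eq (hk : 0 < k) (hn : k < n) {c c' : KSubset k n → ℝ} (h : IsRep c)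
    (h' : IsRep c') (he : vComb c = vComb c') : c = c' := by
  have hZ : fComb (rowDiff (filterComb (c - c'))) = 0 := by
    rw [← vComb_eq, map_sub, he, sub_self]
  obtain ⟨r, hr, hrZ, hrt⟩ := exists_frozen_combination hk hn hZ (∑ J, (c - c') J)
  have hdiff : c + r⁻ = c' + r⁺ + ((c - c') - r) := by
    nth_rw 3 [← posPart_sub_negPart r]
    abel
  have hm : SameMarginals (c + r⁻) (c' + r⁺) := by
    rw [hdiff]
    refine sameMarginals_of_filterComb_eq ?_ ?_
    · rw [map_add, map_sub, hrZ, sub_self, add_zero]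
    · simp only [Pi.add_apply, Finset.sum_add_distrib, Pi.sub_apply (c - c'),
        Finset.sum_sub_distrib, hrt, sub_self, add_zero]
  have hneg : ∀ J, r⁻ J ≠ 0 → Frozen J := fun J hJ => hr J fun h0 => hJ (by simp [h0])
  have hpos : ∀ J, r⁺ J ≠ 0 → Frozen J := fun J hJ => hr J fun h0 => hJ (by simp [h0])
  have heq : c + r⁻ = c' + r⁺ := NoncrossingSupport.eq_of_sameMarginals hk
    (add_nonneg h.nonneg (negPart_nonneg r)) (add_nonneg h'.nonneg (posPart_nonneg r))
    (h.noncrossingSupport.add_of_frozen hn.le (by omega) hneg)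
    (h'.noncrossingSupport.add_of_frozen hn.le (by omega) hpos) hm
  funext J
  by_cases hJ : Frozen J
  · rw [h.eq_zero_of_frozen hJ, h'.eq_zero_of_frozen hJ]
  · have := congrFun heq J
    rwa [Pi.add_apply, Pi.add_apply, not_not.1 (mt (hneg J) hJ), not_not.1 (mt (hpos J) hJ),
      add_zero, add_zero] at this

open Classical in
/-- The weighting obtained by setting the weights of the frozen subsets to zero. -/
noncomputable def nonfrozenPart (c : KSubset k n → ℝ) : KSubset k n → ℝ := fun J =>
  if Frozen J then 0 else c J

theorem nonfrozenPart_le {c : KSubset k n → ℝ} (hc : 0 ≤ c) : nonfrozenPart c ≤ c := by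
  intro J
  unfold nonfrozenPart
  split_ifs
  exacts [hc J, le_rfl]

theorem isRep_nonfrozenPart {c : KSubset k n → ℝ} (hc : 0 ≤ c) (hnc : NoncrossingSupport c) :
    IsRep (nonfrozenPart c) := by
  have hne : ∀ J, nonfrozenPart c J ≠ 0 → ¬ Frozen J ∧ c J ≠ 0 := by
    classical
    exact fun J hJ => (ite_ne_left_iff.1 hJ).imp_right Ne.symm
  refine ⟨fun J => ?_, fun J hJ => (hne J hJ).1,
    fun I J hI hJ => hnc I J (hne I hI).2 (hne J hJ).2⟩
  unfold nonfrozenPart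
  split_ifs
  exacts [le_rfl, hc J]

theorem vComb_nonfrozenPart (hkn : k ≤ n) (hn : 0 < n) (c : KSubset k n → ℝ) :
    vComb (nonfrozenPart c) = vComb c := by
  rw [vComb_apply, vComb_apply]
  refine Finset.sum_congr rfl fun J _ => ?_
  unfold nonfrozenPart
  split_ifs with h
  · rw [h.v_eq_zero hkn hn, smul_zero, smul_zero]
  · rfl

theorem exists_isRep {T : AddSubgroup ℝ} (hT : IsClosed (T : Set ℝ)) (hk : 0 < k) (hkn : k ≤ n)
    {c : KSubset k n → ℝ} (hc : 0 ≤ c) (hcT : ∀ J, c J ∈ T) :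
    ∃ c', IsRep c' ∧ (∀ J, c' J ∈ T) ∧ vComb c' = vComb c ∧ ∑ J, c' J ≤ ∑ J, c J := by
  obtain ⟨c', hc', hcT', hnc, hm⟩ := exists_noncrossingSupport hT hk hc hcT
  refine ⟨nonfrozenPart c', isRep_nonfrozenPart hc' hnc, fun J => ?_, ?_, ?_⟩
  · unfold nonfrozenPart
    split_ifs
    exacts [T.zero_mem, hcT' J]
  · rw [vComb_nonfrozenPart hkn (by omega), vComb_eq, vComb_eq, hm.filterComb_eq]
  · rw [← hm.sum_eq hk]
    exact Finset.sum_le_sum fun J _ => nonfrozenPart_le hc' J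

theorem exists_v_eq_f (hkn : k ≤ n) (q : Fin (k - 1) × Fin (n - k)) :
    ∃ J : KSubset k n, v J = f q := by
  obtain ⟨J, hJ⟩ := exists_entry_eq (k := k) (n := n)
    (x := fun i => if i ≤ (q.1 : ℕ) then (q.2 : ℕ) + i else q.2 + i + 1)
    (fun l _ => by split_ifs <;> omega) (fun l hl => by split_ifs <;> omega)
  have hcells : cells J = {q} := by
    ext p
    simp only [cells, Finset.mem_filter, Finset.mem_univ, true_and, Finset.mem_singleton]
    rw [← entry_of_lt, ← entry_of_lt, hJ _ (by omega), hJ _ (by omega), Prod.ext_iff, Fin.ext_iff,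
      Fin.ext_iff]
    split_ifs <;> omega
  exact ⟨J, by rw [v, hcells, Finset.sum_singleton]⟩

theorem vComb_single [DecidableEq (KSubset k n)] (J : KSubset k n) (x : ℝ) :
    vComb (Pi.single J x) = x • v J :=
  Fintype.linearCombination_apply_single ℝ v J x

theorem exists_nonneg_fComb_eq {T : AddSubgroup ℝ} {a : Grid k n} (ha : ∀ q, a q ∈ T) :
    ∃ a' : Grid k n, 0 ≤ a' ∧ (∀ q, a' q ∈ T) ∧ fComb a' = fComb a := by
  let s : Grid k n := fun q => ∑ j, |a (q.1, j)|
  refine ⟨a + s, fun q => ?_, fun q => T.add_mem (ha q) (T.sum_mem fun j _ => ?_), ?_⟩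
  · have : |a q| ≤ s q := Finset.single_le_sum (f := fun j => |a (q.1, j)|)
      (fun _ _ => abs_nonneg _) (Finset.mem_univ q.2)
    have := neg_abs_le (a q)
    simp only [Pi.zero_apply, Pi.add_apply]
    linarith
  · rcases abs_choice (a (q.1, j)) with h | h <;> rw [h]
    exacts [ha _, T.neg_mem (ha _)]
  · rw [map_add, (fComb_eq_zero_iff (a := s)).2 fun _ _ _ => rfl, add_zero]

theorem exists_vComb_eq_fComb (hkn : k ≤ n) {T : AddSubgroup ℝ} {a : Grid k n}
    (ha : ∀ q, a q ∈ T) :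
    ∃ c : KSubset k n → ℝ, 0 ≤ c ∧ (∀ J, c J ∈ T) ∧ vComb c = fComb a := by
  classical
  obtain ⟨a', hpos, haT, haa⟩ := exists_nonneg_fComb_eq ha
  choose S hS using exists_v_eq_f (k := k) hkn
  refine ⟨∑ q, Pi.single (S q) (a' q), Finset.sum_nonneg fun q _ => Pi.single_nonneg.2 (hpos q),
    fun J => ?_, ?_⟩
  · rw [Finset.sum_apply]
    refine T.sum_mem fun q _ => ?_
    rw [Pi.single_apply]
    split_ifs
    exacts [haT q, T.zero_mem]
  · simp only [map_sum, vComb_single, hS, ← haa, fComb_apply]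

theorem exists_isRep_vComb_eq_fComb {T : AddSubgroup ℝ} (hT : IsClosed (T : Set ℝ)) (hk : 0 < k)
    (hkn : k ≤ n) {a : Grid k n} (ha : ∀ q, a q ∈ T) :
    ∃ c, IsRep c ∧ (∀ J, c J ∈ T) ∧ vComb c = fComb a := by
  obtain ⟨c, hc, hcT, hca⟩ := exists_vComb_eq_fComb hkn ha
  obtain ⟨c', hc', hcT', hcc, -⟩ := exists_isRep hT hk hkn hc hcT
  exact ⟨c', hc', hcT', hcc.trans hca⟩

theorem exists_isRep_of_mem_rowZero (hk : 0 < k) (hkn : k ≤ n) {y : Grid k n}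
    (hy : y ∈ rowZero k n) : ∃ c, IsRep c ∧ vComb c = y := by
  obtain ⟨a, rfl⟩ := exists_fComb_eq hy
  obtain ⟨c, hc, -, hca⟩ :=
    exists_isRep_vComb_eq_fComb (T := ⊤) isClosed_univ hk hkn (a := a) fun _ => trivial
  exact ⟨c, hc, hca⟩

theorem isRep_single [DecidableEq (KSubset k n)] {J : KSubset k n} (hJ : J ∈ nonfrozen k n)
    {x : ℝ} (hx : 0 ≤ x) : IsRep (Pi.single J x) := by
  refine IsRep.of_mem_NC (𝒥 := {J}) ⟨?_, ?_⟩ (Pi.single_nonneg.2 hx) fun I hI => ?_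
  · simpa only [Finset.mem_singleton, forall_eq] using hJ
  · simpa only [Finset.mem_singleton, forall_eq] using Noncrossing.refl J
  · exact Finset.mem_singleton.2 (not_not.1 fun h => hI (by simp [h]))

theorem v_injOn (hk : 0 < k) (hn : k < n) : Set.InjOn v (nonfrozen k n) := by
  classical
  intro I hI J hJ h
  have heq := (isRep_single hI zero_le_one).eq_of_vComb_eq hk hn (isRep_single hJ zero_le_one)
    (by rw [vComb_single, vComb_single, h])
  by_contra hne
  simpa [hne] using congrFun heq I

theorem v_ne_zero (hk : 0 < k) (hn : k < n) {J : KSubset k n} (hJ : J ∈ nonfrozen k n) :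
    v J ≠ 0 := by
  classical
  intro h
  have heq := (isRep_single hJ zero_le_one).eq_of_vComb_eq hk hn IsRep.zero
    (by rw [vComb_single, h, smul_zero, map_zero])
  simpa using congrFun heq J

/-! ### The triangulation -/

theorem sum_smul_mem_of_sum_le_one {ι E : Type*} [Fintype ι] [AddCommGroup E] [Module ℝ E]
    {s : Set E} (hs : Convex ℝ s) {c : ι → ℝ} {z : ι → E} (hc : 0 ≤ c) (hc1 : ∑ i, c i ≤ 1)
    (h0 : ∑ i, c i < 1 → (0 : E) ∈ s) (hz : ∀ i, c i ≠ 0 → z i ∈ s) : ∑ i, c i • z i ∈ s := by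
  have hmem := hs.finsum_mem (w := fun o : Option ι => o.elim (1 - ∑ i, c i) c)
    (z := fun o => o.elim 0 z)
    (by rintro (_ | i)
        exacts [sub_nonneg.2 hc1, hc i])
    (by simp [finsum_eq_sum_of_fintype, Fintype.sum_option])
    (by rintro (_ | i) hi
        exacts [h0 (hc1.lt_of_ne fun h => hi (sub_eq_zero.2 h.symm)), hz i hi])
  simpa [finsum_eq_sum_of_fintype, Fintype.sum_option] using hmem

theorem linearIndepOn_v (hk : 0 < k) (hn : k < n) {𝒥 : Finset (KSubset k n)} (h𝒥 : 𝒥 ∈ NC k n) :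
    LinearIndepOn ℝ v (𝒥 : Set (KSubset k n)) := by
  classical
  rw [linearIndepOn_finset_iff]
  intro g hg
  let c : KSubset k n → ℝ := fun J => if J ∈ 𝒥 then g J else 0
  have hc : ∀ J, c J ≠ 0 → J ∈ 𝒥 := fun J hJ => (ite_ne_right_iff.1 hJ).1
  have hcv : vComb c = 0 := by
    rw [vComb_apply, ← hg, ← Finset.sum_subset 𝒥.subset_univ fun J _ hJ => ?_]
    · exact Finset.sum_congr rfl fun J hJ => by simp only [c, if_pos hJ]
    · simp only [c, if_neg hJ, zero_smul]
  have hpos : IsRep c⁺ := IsRep.of_mem_NC h𝒥 (posPart_nonneg c) fun J hJ =>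
    hc J fun h => hJ (by simp [h])
  have hneg : IsRep c⁻ := IsRep.of_mem_NC h𝒥 (negPart_nonneg c) fun J hJ =>
    hc J fun h => hJ (by simp [h])
  have heq : c⁺ = c⁻ := hpos.eq_of_vComb_eq hk hn hneg
    (by rw [← sub_eq_zero, ← map_sub, posPart_sub_negPart, hcv])
  intro J hJ
  have hcJ : c J = 0 := by rw [← posPart_sub_negPart c, heq, sub_self, Pi.zero_apply]
  simpa only [c, if_pos hJ] using hcJ

/-- The faces of the triangulation: the nonempty subsets of the sets `{0} ∪ {v_J : J ∈ 𝒥}`, where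
`𝒥` runs through the reduced noncrossing complex. -/
def ncFaces (k n : ℕ) : Set (Finset (Grid k n)) :=
  {s | s.Nonempty ∧ ∃ 𝒥 ∈ NC k n, s ⊆ insert 0 (𝒥.image v)}

theorem affineIndependent_of_mem_ncFaces (hk : 0 < k) (hn : k < n) {s : Finset (Grid k n)}
    (hs : s ∈ ncFaces k n) : AffineIndependent ℝ ((↑) : s → Grid k n) := by
  obtain ⟨-, 𝒥, h𝒥, hs⟩ := hs
  have hne : ∀ x ∈ v '' (𝒥 : Set (KSubset k n)), x ≠ 0 := by
    rintro _ ⟨J, hJ, rfl⟩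
    exact v_ne_zero hk hn (h𝒥.1 J hJ)
  have hind := (linearIndependent_set_iff_affineIndependent_vadd_union_singleton ℝ hne
    (0 : Grid k n)).1 (linearIndepOn_v hk hn h𝒥).id_image
  refine hind.mono (s := (s : Set (Grid k n))) fun x hx => ?_
  rcases Finset.mem_insert.1 (hs hx) with h | h
  · exact Or.inl h
  · obtain ⟨J, hJ, he⟩ := Finset.mem_image.1 h
    exact Or.inr ⟨x, ⟨J, hJ, he⟩, add_zero x⟩

theorem mem_of_v_mem (hk : 0 < k) (hn : k < n) {𝒥 : Finset (KSubset k n)} (h𝒥 : 𝒥 ∈ NC k n)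
    {s : Finset (Grid k n)} (hs : s ⊆ insert 0 (𝒥.image v)) {J : KSubset k n}
    (hJ : J ∈ nonfrozen k n) (hJs : v J ∈ s) : J ∈ 𝒥 := by
  rcases Finset.mem_insert.1 (hs hJs) with h | h
  · exact absurd h (v_ne_zero hk hn hJ)
  · obtain ⟨I, hI, he⟩ := Finset.mem_image.1 h
    rwa [← v_injOn hk hn (h𝒥.1 I hI) hJ he]

theorem exists_isRep_of_mem_convexHull (hk : 0 < k) (hn : k < n) {s : Finset (Grid k n)}
    (hs : s ∈ ncFaces k n) {x : Grid k n} (hx : x ∈ convexHull ℝ (s : Set (Grid k n))) :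
    ∃ c, IsRep c ∧ vComb c = x ∧ ∑ J, c J ≤ 1 ∧ (∑ J, c J < 1 → 0 ∈ s) ∧
      ∀ J, c J ≠ 0 → v J ∈ s := by
  classical
  obtain ⟨-, 𝒥, h𝒥, hs⟩ := hs
  refine convexHull_min (t := {x | ∃ c, IsRep c ∧ vComb c = x ∧ ∑ J, c J ≤ 1 ∧
    (∑ J, c J < 1 → 0 ∈ s) ∧ ∀ J, c J ≠ 0 → v J ∈ s}) ?_ ?_ hx
  · intro y hy
    rcases Finset.mem_insert.1 (hs hy) with rfl | h
    · exact ⟨0, IsRep.zero, map_zero _, by simp, fun _ => hy, fun J hJ => absurd rfl hJ⟩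
    · obtain ⟨J, hJ, rfl⟩ := Finset.mem_image.1 h
      refine ⟨Pi.single J 1, isRep_single (h𝒥.1 J hJ) zero_le_one,
        by rw [vComb_single, one_smul], by simp, by simp, fun I hI => ?_⟩
      rwa [show I = J from not_not.1 fun h => hI (by simp [h])]
  · rintro _ ⟨c, hc, rfl, hc1, hc0, hcs⟩ _ ⟨c', hc', rfl, hc1', hc0', hcs'⟩ a b ha hb hab
    have hsum : ∑ J, (a • c + b • c') J = a * ∑ J, c J + b * ∑ J, c' J := by
      simp [Finset.sum_add_distrib, Finset.mul_sum]
    have hmem : ∀ J, (a • c + b • c') J ≠ 0 → v J ∈ s ∧ J ∈ 𝒥 := by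
      intro J hJ
      by_cases h : c J = 0
      · have h' : c' J ≠ 0 := fun h' => hJ (by simp [h, h'])
        exact ⟨hcs' J h', mem_of_v_mem hk hn h𝒥 hs (hc'.mem_nonfrozen J h') (hcs' J h')⟩
      · exact ⟨hcs J h, mem_of_v_mem hk hn h𝒥 hs (hc.mem_nonfrozen J h) (hcs J h)⟩
    refine ⟨a • c + b • c', IsRep.of_mem_NC h𝒥
      (add_nonneg (smul_nonneg ha hc.nonneg) (smul_nonneg hb hc'.nonneg)) fun J hJ => (hmem J hJ).2,
      by rw [map_add, map_smul, map_smul], ?_, fun hlt => ?_, fun J hJ => (hmem J hJ).1⟩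
    · rw [hsum]
      nlinarith
    · by_contra h0
      rw [hsum, hc1.antisymm (not_lt.1 (mt hc0 h0)), hc1'.antisymm (not_lt.1 (mt hc0' h0)), mul_one,
        mul_one, hab] at hlt
      exact lt_irrefl _ hlt

theorem inter_subset_convexHull_of_mem_ncFaces (hk : 0 < k) (hn : k < n)
    {s t : Finset (Grid k n)} (hs : s ∈ ncFaces k n) (ht : t ∈ ncFaces k n) :
    convexHull ℝ (s : Set (Grid k n)) ∩ convexHull ℝ (t : Set (Grid k n)) ⊆
      convexHull ℝ (s ∩ t : Set (Grid k n)) := by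
  rintro x ⟨hxs, hxt⟩
  obtain ⟨c, hc, hcx, hc1, hc0, hcs⟩ := exists_isRep_of_mem_convexHull hk hn hs hxs
  obtain ⟨c', hc', hcx', -, hc0', hcs'⟩ := exists_isRep_of_mem_convexHull hk hn ht hxt
  obtain rfl := hc.eq_of_vComb_eq hk hn hc' (hcx.trans hcx'.symm)
  rw [← hcx, vComb_apply]
  exact sum_smul_mem_of_sum_le_one (convex_convexHull ℝ _) hc.nonneg hc1
    (fun h => subset_convexHull ℝ _ ⟨hc0 h, hc0' h⟩)
    fun J hJ => subset_convexHull ℝ _ ⟨hcs J hJ, hcs' J hJ⟩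

/-- The triangulation of the root polytope by the reduced noncrossing complex. -/
def ncComplex (hk : 0 < k) (hn : k < n) : Geometry.SimplicialComplex ℝ (Grid k n) where
  faces := ncFaces k n
  isRelLowerSet_faces _ hs :=
    ⟨hs.1, fun _ hts ht => ⟨ht, hs.2.imp fun _ h => ⟨h.1, hts.trans h.2⟩⟩⟩
  indep := affineIndependent_of_mem_ncFaces hk hn
  inter_subset_convexHull := inter_subset_convexHull_of_mem_ncFaces hk hn

theorem isFlag_ncComplex (hk : 0 < k) (hn : k < n) : IsFlag (ncComplex hk hn) := by
  classical
  intro s hne hs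
  refine ⟨hne, Finset.univ.filter fun J => J ∈ nonfrozen k n ∧ v J ∈ s,
    ⟨fun J hJ => ?_, fun I hI J hJ => ?_⟩, fun x hx => ?_⟩
  · exact (Finset.mem_filter.1 hJ).2.1
  · obtain ⟨hI, hIs⟩ := (Finset.mem_filter.1 hI).2
    obtain ⟨hJ, hJs⟩ := (Finset.mem_filter.1 hJ).2
    obtain ⟨-, 𝒥, h𝒥, hsub⟩ := hs _ hIs _ hJs
    exact h𝒥.2 I (mem_of_v_mem hk hn h𝒥 hsub hI (by simp))
      J (mem_of_v_mem hk hn h𝒥 hsub hJ (by simp))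
  · obtain ⟨-, 𝒥, h𝒥, hsub⟩ := hs x hx x hx
    rcases Finset.mem_insert.1 (hsub (Finset.mem_insert_self _ _)) with h | h
    · exact Finset.mem_insert.2 (Or.inl h)
    · obtain ⟨J, hJ, rfl⟩ := Finset.mem_image.1 h
      refine Finset.mem_insert_of_mem (Finset.mem_image_of_mem _ ?_)
      exact Finset.mem_filter.2 ⟨Finset.mem_univ _, h𝒥.1 J hJ, hx⟩

theorem f_ne_zero (hn : k + 2 ≤ n) (q : Fin (k - 1) × Fin (n - k)) : f q ≠ 0 := by
  intro h
  have hne : q ≠ (q.1, finRotate (n - k) q.2) := fun h => by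
    have hval : (finRotate (n - k) q.2 : ℕ) = q.2 := congrArg (fun p => (p.2 : ℕ)) h.symm
    rcases val_finRotate_eq_or q.2 with h | h <;> omega
  have hq := congrFun h q
  rw [f, e, e, Pi.sub_apply, Pi.single_eq_same, Pi.single_eq_of_ne hne, sub_zero] at hq
  exact one_ne_zero hq

theorem zero_mem_rootPolytope (hk : 2 ≤ k) (hn : k + 2 ≤ n) :
    (0 : Grid k n) ∈ rootPolytope k n := by
  have hm : (n - k : ℕ) ≠ (0 : ℝ) := Nat.cast_ne_zero.2 (by omega)
  let i : Fin (k - 1) := ⟨0, by omega⟩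
  have hmem :
      ∑ j : Fin (n - k), ((n - k : ℕ) : ℝ)⁻¹ • (f (i, j) : Grid k n) ∈ rootPolytope k n := by
    refine sum_smul_mem_of_sum_le_one (convex_convexHull ℝ _) (fun _ => by positivity)
      (by simp [hm]) (by simp [hm]) fun j _ => subset_convexHull ℝ _ ?_
    obtain ⟨J, hJ⟩ := exists_v_eq_f (k := k) (n := n) (by omega) (i, j)
    refine ⟨J, fun hfr => f_ne_zero hn (i, j) ?_, hJ⟩
    rw [← hJ, hfr.v_eq_zero (by omega) (by omega)]
  rwa [← Finset.smul_sum, sum_f_eq_zero, smul_zero] at hmem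

theorem mem_rootPolytope_iff (hk : 2 ≤ k) (hn : k + 2 ≤ n) {x : Grid k n} :
    x ∈ rootPolytope k n ↔ ∃ c, IsRep c ∧ vComb c = x ∧ ∑ J, c J ≤ 1 := by
  classical
  constructor
  · intro hx
    refine convexHull_min (t := {x | ∃ c, IsRep c ∧ vComb c = x ∧ ∑ J, c J ≤ 1}) ?_ ?_ hx
    · rintro _ ⟨J, hJ, rfl⟩
      exact ⟨Pi.single J 1, isRep_single hJ zero_le_one, by rw [vComb_single, one_smul], by simp⟩
    · rintro _ ⟨c, hc, rfl, hc1⟩ _ ⟨c', hc', rfl, hc1'⟩ a b ha hb hab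
      obtain ⟨d, hd, -, hdv, hdc⟩ := exists_isRep (T := ⊤) isClosed_univ (by omega) (by omega)
        (add_nonneg (smul_nonneg ha hc.nonneg) (smul_nonneg hb hc'.nonneg)) fun _ => trivial
      refine ⟨d, hd, by rw [hdv, map_add, map_smul, map_smul], hdc.trans ?_⟩
      simp only [Pi.add_apply, Pi.smul_apply, smul_eq_mul, Finset.sum_add_distrib,
        ← Finset.mul_sum]
      nlinarith
  · rintro ⟨c, hc, rfl, hc1⟩
    rw [vComb_apply]
    exact sum_smul_mem_of_sum_le_one (convex_convexHull ℝ _) hc.nonneg hc1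
      (fun _ => zero_mem_rootPolytope hk hn)
      fun J hJ => subset_convexHull ℝ _ ⟨J, hc.mem_nonfrozen J hJ, rfl⟩

theorem exists_mem_NC_vComb_mem_convexHull (hk : 0 < k) (hkn : k ≤ n) {c : KSubset k n → ℝ}
    (hc : 0 ≤ c) (hc1 : ∑ J, c J ≤ 1) :
    ∃ 𝒥 ∈ NC k n, vComb c ∈ convexHull ℝ (insert 0 (v '' (𝒥 : Set (KSubset k n)))) := by
  obtain ⟨d, hd, -, hdv, hdc⟩ := exists_isRep (T := ⊤) isClosed_univ hk hkn hc fun _ => trivial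
  refine ⟨_, hd.filter_mem_NC, ?_⟩
  rw [← hdv, vComb_apply]
  exact sum_smul_mem_of_sum_le_one (convex_convexHull ℝ _) hd.nonneg (hdc.trans hc1)
    (fun _ => subset_convexHull ℝ _ (Set.mem_insert _ _)) fun J hJ =>
      subset_convexHull ℝ _ (Set.mem_insert_of_mem _ ⟨J, by simpa using hJ, rfl⟩)

theorem space_ncComplex (hk : 2 ≤ k) (hn : k + 2 ≤ n) :
    (ncComplex (k := k) (n := n) (by omega) (by omega)).space = rootPolytope k n := by
  ext x
  rw [Geometry.SimplicialComplex.mem_space_iff, mem_rootPolytope_iff hk hn]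
  constructor
  · rintro ⟨s, hs, hx⟩
    obtain ⟨c, hc, hcx, hc1, -⟩ := exists_isRep_of_mem_convexHull (by omega) (by omega) hs hx
    exact ⟨c, hc, hcx, hc1⟩
  · rintro ⟨c, hc, rfl, hc1⟩
    obtain ⟨𝒥, h𝒥, hmem⟩ := exists_mem_NC_vComb_mem_convexHull (by omega) (by omega) hc.nonneg hc1
    refine ⟨insert 0 (𝒥.image v), ⟨Finset.insert_nonempty _ _, 𝒥, h𝒥, subset_rfl⟩, ?_⟩
    rwa [Finset.coe_insert, Finset.coe_image]

/-! ### Volume and exponential integrals -/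

section Volume

variable {ι κ : Type*} [Fintype ι] [Fintype κ]

theorem exists_int_cast_eq_det [DecidableEq ι] {M : Matrix ι ι ℝ}
    (hM : ∀ i j, M i j ∈ (Int.castAddHom ℝ).range) : ∃ z : ℤ, (z : ℝ) = M.det := by
  choose Z hZ using hM
  have hmap : M = (Matrix.of Z).map (Int.castRingHom ℝ) := by
    ext i j
    exact (hZ i j).symm
  exact ⟨(Matrix.of Z).det, by rw [hmap]; exact (Int.castRingHom ℝ).map_det _⟩

theorem abs_det_eq_one_of_int {η : Type*} [Finite η] [DecidableEq η] {A B : (η → ℝ) →ₗ[ℝ] η → ℝ}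
    (hBA : B ∘ₗ A = LinearMap.id) (hA : ∀ i j, A (Pi.single i 1) j ∈ (Int.castAddHom ℝ).range)
    (hB : ∀ i j, B (Pi.single i 1) j ∈ (Int.castAddHom ℝ).range) : |LinearMap.det A| = 1 := by
  cases nonempty_fintype η
  obtain ⟨a, ha⟩ := exists_int_cast_eq_det (M := LinearMap.toMatrix' A) fun i j => by
    rw [LinearMap.toMatrix'_apply]
    exact hA j i
  obtain ⟨b, hb⟩ := exists_int_cast_eq_det (M := LinearMap.toMatrix' B) fun i j => by
    rw [LinearMap.toMatrix'_apply]
    exact hB j i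
  rw [LinearMap.det_toMatrix'] at ha hb
  have hba : b * a = 1 := by
    have hdet : LinearMap.det B * LinearMap.det A = 1 := by
      rw [← LinearMap.det_comp, hBA, LinearMap.det_id]
    rw [← ha, ← hb] at hdet
    exact_mod_cast hdet
  rw [← ha]
  exact_mod_cast Int.isUnit_iff_abs_eq.1 (IsUnit.of_mul_eq_one_right b hba)

theorem measurePreserving_of_abs_det_eq_one {A : (ι → ℝ) →ₗ[ℝ] ι → ℝ}
    (hA : |LinearMap.det A| = 1) : MeasurePreserving A := by
  refine ⟨(LinearMap.continuous_on_pi A).measurable, ?_⟩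
  have hne : LinearMap.det A ≠ 0 := fun h => by simp [h] at hA
  rw [Real.map_linearMap_volume_pi_eq_smul_volume_pi hne, abs_inv, hA, inv_one,
    ENNReal.ofReal_one, one_smul]

theorem measurePreserving_comp_symm (σ : ι ≃ κ) :
    MeasurePreserving fun (x : ι → ℝ) => x ∘ σ.symm := by
  convert! volume_measurePreserving_piCongrLeft (fun _ : κ => ℝ) σ using 1
  funext x j
  obtain ⟨i, rfl⟩ := σ.surjective j
  rw [MeasurableEquiv.coe_piCongrLeft, Equiv.piCongrLeft_apply_apply, Function.comp_apply,
    Equiv.symm_apply_apply]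

theorem measurePreserving_of_int [DecidableEq ι] [DecidableEq κ] {A : (ι → ℝ) →ₗ[ℝ] κ → ℝ}
    {B : (κ → ℝ) →ₗ[ℝ] ι → ℝ} (hBA : B ∘ₗ A = LinearMap.id)
    (hcard : Fintype.card ι = Fintype.card κ)
    (hA : ∀ i j, A (Pi.single i 1) j ∈ (Int.castAddHom ℝ).range)
    (hB : ∀ j i, B (Pi.single j 1) i ∈ (Int.castAddHom ℝ).range) : MeasurePreserving A := by
  obtain ⟨σ⟩ := Fintype.card_eq.1 hcard
  let R : (κ → ℝ) ≃ₗ[ℝ] (ι → ℝ) := LinearEquiv.funCongrLeft ℝ ℝ σ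
  have hR : ∀ i, R.symm (Pi.single i 1) = Pi.single (σ i) 1 := fun i => by
    rw [LinearEquiv.symm_apply_eq]
    funext i'
    simp [R, LinearEquiv.funCongrLeft_apply, LinearMap.funLeft_apply, Pi.single_apply]
  have hdet : |LinearMap.det (R.toLinearMap ∘ₗ A)| = 1 := by
    refine abs_det_eq_one_of_int (B := B ∘ₗ R.symm.toLinearMap) ?_ (fun i j => hA i (σ j))
      fun i j => ?_
    · rw [← hBA]
      ext
      simp
    · rw [LinearMap.comp_apply, LinearEquiv.coe_coe, hR]
      exact hB (σ i) j
  convert! (measurePreserving_comp_symm σ).comp (measurePreserving_of_abs_det_eq_one hdet) using 1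
  funext x j
  exact congrArg (A x) (σ.apply_symm_apply j).symm

theorem lintegral_exp_neg_Ici (a : ℝ) :
    ∫⁻ t in Set.Ici a, ENNReal.ofReal (Real.exp (-t)) = ENNReal.ofReal (Real.exp (-a)) := by
  rw [← setLIntegral_congr Ioi_ae_eq_Ici, ← integral_exp_neg_Ioi a,
    ofReal_integral_eq_lintegral_ofReal (integrableOn_exp_neg_Ioi a)
      (Filter.Eventually.of_forall fun _ => (Real.exp_pos _).le)]

theorem lintegral_exp_neg_mul_pow (d : ℕ) :
    ∫⁻ t in Set.Ioi (0 : ℝ), ENNReal.ofReal (Real.exp (-t)) * ENNReal.ofReal (t ^ d) = d ! := by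
  have hGamma : ((d ! : ℕ) : ℝ) = ∫ t in Set.Ioi (0 : ℝ), Real.exp (-t) * t ^ d := by
    rw [← Real.Gamma_nat_eq_factorial, Real.Gamma_eq_integral (by positivity)]
    simp
  have hint : IntegrableOn (fun t : ℝ => Real.exp (-t) * t ^ d) (Set.Ioi 0) := by
    simpa using Real.GammaIntegral_convergent (s := d + 1) (by positivity)
  rw [← ENNReal.ofReal_natCast, hGamma, ofReal_integral_eq_lintegral_ofReal hint]
  · exact lintegral_congr fun t => (ENNReal.ofReal_mul (Real.exp_pos _).le).symm
  · exact ae_restrict_of_forall_mem measurableSet_Ioi fun t ht =>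
      mul_nonneg (Real.exp_pos _).le (pow_nonneg (Set.mem_Ioi.1 ht).le d)

theorem lintegral_exp_neg_eq_lintegral_measure_le {α : Type*} [MeasurableSpace α] (μ : Measure α)
    [SFinite μ] {g : α → ℝ} (hg : Measurable g) :
    ∫⁻ x, ENNReal.ofReal (Real.exp (-g x)) ∂μ =
      ∫⁻ t, ENNReal.ofReal (Real.exp (-t)) * μ {x | g x ≤ t} := by
  let h : α → ℝ → ℝ≥0∞ := fun x t =>
    Set.indicator {p : α × ℝ | g p.1 ≤ p.2} (fun p => ENNReal.ofReal (Real.exp (-p.2))) (x, t)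
  have hmeas : Measurable (Function.uncurry h) :=
    (by fun_prop : Measurable fun p : α × ℝ => ENNReal.ofReal (Real.exp (-p.2))).indicator
      (measurableSet_le (hg.comp measurable_fst) measurable_snd)
  have hleft : ∀ x, ENNReal.ofReal (Real.exp (-g x)) = ∫⁻ t, h x t := fun x => by
    rw [← lintegral_exp_neg_Ici, ← lintegral_indicator measurableSet_Ici]
    rfl
  have hright : ∀ t, ENNReal.ofReal (Real.exp (-t)) * μ {x | g x ≤ t} = ∫⁻ x, h x t ∂μ := by
    intro t
    rw [← setLIntegral_const, ← lintegral_indicator (measurableSet_le hg measurable_const)]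
    rfl
  simp only [hleft, hright]
  exact lintegral_lintegral_swap hmeas.aemeasurable

theorem volume_inter_le_eq_pow_mul {D : Set (ι → ℝ)} {g : (ι → ℝ) → ℝ}
    (hDs : ∀ s > (0 : ℝ), ∀ x ∈ D, s • x ∈ D)
    (hgs : ∀ s > (0 : ℝ), ∀ x ∈ D, g (s • x) = s * g x) {t : ℝ} (ht : 0 < t) :
    volume (D ∩ {x | g x ≤ t}) =
      ENNReal.ofReal (t ^ Fintype.card ι) * volume (D ∩ {x | g x ≤ 1}) := by
  open scoped Pointwise in
  have hset : D ∩ {x | g x ≤ t} = t • (D ∩ {x | g x ≤ 1}) := by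
    ext x
    rw [Set.mem_smul_set_iff_inv_smul_mem₀ ht.ne']
    constructor
    · rintro ⟨hxD, hxt⟩
      refine ⟨hDs _ (inv_pos.2 ht) x hxD, ?_⟩
      rw [Set.mem_ofPred_eq, hgs _ (inv_pos.2 ht) x hxD, inv_mul_le_iff₀ ht, mul_one]
      exact hxt
    · rintro ⟨hxD, hx1⟩
      have hxD' := hDs t ht _ hxD
      have hgt := hgs t ht _ hxD
      rw [smul_inv_smul₀ ht.ne'] at hxD' hgt
      refine ⟨hxD', ?_⟩
      rw [Set.mem_ofPred_eq, hgt]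
      exact mul_le_of_le_one_right ht.le hx1
  rw [hset, Measure.addHaar_smul, Module.finrank_fintype_fun_eq_card, abs_of_pos (by positivity)]

theorem lintegral_exp_neg_eq_factorial_mul_volume {D : Set (ι → ℝ)} {g : (ι → ℝ) → ℝ}
    (hg : Measurable g) (hDs : ∀ s > (0 : ℝ), ∀ x ∈ D, s • x ∈ D)
    (hgs : ∀ s > (0 : ℝ), ∀ x ∈ D, g (s • x) = s * g x) (hg0 : ∀ x ∈ D, 0 ≤ g x) :
    ∫⁻ x in D, ENNReal.ofReal (Real.exp (-g x)) =
      (Fintype.card ι)! * volume (D ∩ {x | g x ≤ 1}) := by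
  have hlevel : ∀ t, volume.restrict D {x | g x ≤ t} = volume (D ∩ {x | g x ≤ t}) := fun t => by
    rw [Measure.restrict_apply (measurableSet_le hg measurable_const), Set.inter_comm]
  have hneg : ∀ t < (0 : ℝ), D ∩ {x | g x ≤ t} = ∅ := fun t ht =>
    Set.eq_empty_of_forall_notMem fun x ⟨hxD, hxt⟩ => (ht.trans_le (hg0 x hxD)).not_ge hxt
  rw [lintegral_exp_neg_eq_lintegral_measure_le _ hg, ← lintegral_exp_neg_mul_pow,
    ← lintegral_mul_const _ (by fun_prop), ← lintegral_indicator measurableSet_Ioi]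
  refine lintegral_congr_ae ?_
  filter_upwards [Measure.ae_ne volume (0 : ℝ)] with t ht
  rw [hlevel]
  rcases ht.lt_or_gt with ht | ht
  · rw [Set.indicator_of_notMem (by simpa using ht.le), hneg t ht, measure_empty, mul_zero]
  · rw [Set.indicator_of_mem (Set.mem_Ioi.2 ht), volume_inter_le_eq_pow_mul hDs hgs ht, mul_assoc]

theorem lintegral_exp_neg_sum_Ici (a : ι → ℝ) :
    ∫⁻ x in Set.Ici a, ENNReal.ofReal (Real.exp (-∑ i, x i)) =
      ENNReal.ofReal (Real.exp (-∑ i, a i)) := by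
  have hexp : ∀ x : ι → ℝ, Real.exp (-∑ i, x i) = ∏ i, Real.exp (-x i) := fun x => by
    rw [← Finset.sum_neg_distrib, Real.exp_sum]
  have hint : ∀ i, IntegrableOn (fun t : ℝ => Real.exp (-t)) (Set.Ici (a i)) := fun i =>
    integrableOn_Ici_iff_integrableOn_Ioi (by simp) |>.2 (integrableOn_exp_neg_Ioi _)
  simp only [hexp]
  rw [← Set.pi_univ_Ici, volume_pi, Measure.restrict_pi_pi, ← ofReal_integral_eq_lintegral_ofReal,
    integral_fintype_prod_eq_prod (𝕜 := ℝ) fun _ t => Real.exp (-t)]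
  · simp only [integral_Ici_eq_integral_Ioi, integral_exp_neg_Ioi]
  · exact Integrable.fintype_prod hint
  · exact Filter.Eventually.of_forall fun x => Finset.prod_nonneg fun _ _ => (Real.exp_pos _).le

theorem volume_simplex :
    volume {x : ι → ℝ | 0 ≤ x ∧ ∑ i, x i ≤ 1} = 1 / ((Fintype.card ι)! : ℝ≥0∞) := by
  have hvol := lintegral_exp_neg_eq_factorial_mul_volume (D := Set.Ici (0 : ι → ℝ))
    (g := fun x => ∑ i, x i) (by fun_prop) (fun s hs x hx => Set.mem_Ici.2 (smul_nonneg hs.le hx))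
    (fun s _ x _ => by simp [Finset.mul_sum])
    (fun x hx => Finset.sum_nonneg fun i _ => hx i)
  rw [lintegral_exp_neg_sum_Ici] at hvol
  simp only [Pi.zero_apply, Finset.sum_const_zero, neg_zero, Real.exp_zero,
    ENNReal.ofReal_one] at hvol
  rw [ENNReal.eq_div_iff (by exact_mod_cast (Nat.factorial_pos _).ne') (ENNReal.natCast_ne_top _)]
  exact hvol.symm

end Volume

/-! ### Order cones -/

theorem ae_injective (P : Type*) [Fintype P] : ∀ᵐ F : P → ℝ, Function.Injective F := by
  classical
  have hne : ∀ p q : P, p ≠ q → ∀ᵐ F : P → ℝ, F p ≠ F q := by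
    intro p q hpq
    let L : (P → ℝ) →ₗ[ℝ] ℝ :=
      (LinearMap.proj p : (P → ℝ) →ₗ[ℝ] ℝ) - (LinearMap.proj q : (P → ℝ) →ₗ[ℝ] ℝ)
    have hker : {F : P → ℝ | ¬ F p ≠ F q} = (LinearMap.ker L : Set (P → ℝ)) := by
      ext F
      simp [L, sub_eq_zero]
    rw [ae_iff, hker]
    refine Measure.addHaar_submodule _ _ fun htop => ?_
    have hsingle : Pi.single p (1 : ℝ) ∈ LinearMap.ker L := htop ▸ Submodule.mem_top
    simp [L, hpq.symm] at hsingle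
  have hall : ∀ᵐ F : P → ℝ, ∀ p q : P, p ≠ q → F p ≠ F q := by
    simpa only [ae_all_iff] using hne
  filter_upwards [hall] with F hF p q
  exact not_imp_not.1 (hF p q)

/-- The cone of nonnegative monotone functions on a preordered set. -/
def orderCone (P : Type*) [Preorder P] : Set (P → ℝ) := {F | 0 ≤ F ∧ Monotone F}

theorem measurableSet_orderCone (P : Type*) [Preorder P] [Countable P] :
    MeasurableSet (orderCone P) := by
  refine (measurableSet_Ici (a := (0 : P → ℝ))).inter (?_ : MeasurableSet {F : P → ℝ | Monotone F})
  simp only [Monotone, Set.ofPred_forall]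
  exact MeasurableSet.iInter fun i => MeasurableSet.iInter fun j => MeasurableSet.iInter fun _ =>
    measurableSet_le (measurable_pi_apply _) (measurable_pi_apply _)

/-- The passage from a sequence to its partial sums, as a linear map. -/
noncomputable def partialSum (m : ℕ) : (Fin (m + 1) → ℝ) →ₗ[ℝ] Fin (m + 1) → ℝ :=
  Matrix.toLin' (Matrix.of fun i j => if j ≤ i then 1 else 0)

theorem partialSum_apply {m : ℕ} (z : Fin (m + 1) → ℝ) (i : Fin (m + 1)) :
    partialSum m z i = ∑ j ∈ Finset.Iic i, z j := by
  simp [partialSum, Matrix.mulVec, dotProduct, ← Finset.sum_filter, Finset.filter_ge_eq_Iic]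

theorem partialSum_succ {m : ℕ} (z : Fin (m + 1) → ℝ) (i : Fin m) :
    partialSum m z i.succ = partialSum m z i.castSucc + z i.succ := by
  have hIic : Finset.Iic i.succ = insert i.succ (Finset.Iic i.castSucc) := by
    ext j
    simp only [Finset.mem_Iic, Finset.mem_insert, Fin.le_def, Fin.ext_iff, Fin.val_succ,
      Fin.val_castSucc]
    omega
  rw [partialSum_apply, partialSum_apply, hIic, Finset.sum_insert, add_comm]
  simp [Fin.le_def]

theorem measurePreserving_partialSum (m : ℕ) : MeasurePreserving (partialSum m) := by
  refine measurePreserving_of_abs_det_eq_one ?_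
  rw [partialSum, LinearMap.det_toLin', Matrix.det_of_isLowerTriangular _ fun i j hij => ?_]
  · simp
  · exact if_neg (not_le.2 hij)

theorem partialSum_preimage_orderCone (m : ℕ) :
    partialSum m ⁻¹' orderCone (Fin (m + 1)) = Set.Ici 0 := by
  ext z
  constructor
  · rintro ⟨h0, hmono⟩ i
    refine Fin.cases ?_ (fun i => ?_) i
    · have hz := h0 0
      rwa [partialSum_apply, ← bot_eq_zero, Finset.Iic_bot, Finset.sum_singleton] at hz
    · exact (le_add_iff_nonneg_right _).1 (partialSum_succ z i ▸ hmono (Fin.castSucc_le_succ i))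
  · intro hz
    refine ⟨fun i => ?_, Fin.monotone_iff_le_succ.2 fun i => ?_⟩
    · rw [partialSum_apply]
      exact Finset.sum_nonneg fun j _ => hz j
    · rw [partialSum_succ]
      exact le_add_of_nonneg_right (hz i.succ)

theorem lintegral_orderCone_fin (m : ℕ) :
    ∫⁻ F in orderCone (Fin (m + 1)), ENNReal.ofReal (Real.exp (-F (Fin.last m))) = 1 := by
  rw [← (measurePreserving_partialSum m).setLIntegral_comp_preimage
    (measurableSet_orderCone _) (by fun_prop), partialSum_preimage_orderCone]
  have hlast : ∀ z, partialSum m z (Fin.last m) = ∑ i, z i := fun z => by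
    rw [partialSum_apply, ← Fin.top_eq_last, Finset.Iic_top]
  simp [hlast, lintegral_exp_neg_sum_Ici]

section Enumeration

variable {P : Type*} {N : ℕ}

theorem exists_strictMono_comp_symm (σ : P ≃ Fin N) {F : P → ℝ} (hF : Function.Injective F) :
    ∃ T : P ≃ Fin N, StrictMono (F ∘ T.symm) := by
  let τ := Tuple.sort (F ∘ σ.symm)
  have hmono : Monotone ((F ∘ σ.symm) ∘ τ) := Tuple.monotone_sort _
  exact ⟨σ.trans τ.symm,
    hmono.strictMono_of_injective (hF.comp (σ.symm.injective.comp τ.injective))⟩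

theorem eq_of_strictMono_comp_symm {T T' : P ≃ Fin N} {F : P → ℝ} (h : StrictMono (F ∘ T.symm))
    (h' : StrictMono (F ∘ T'.symm)) : T = T' := by
  have hmono : StrictMono (T.symm.trans T') := fun i j hij => by
    rw [← h'.lt_iff_lt]
    simpa using h hij
  have hrefl : hmono.orderIsoOfSurjective _ (T.symm.trans T').surjective = OrderIso.refl (Fin N) :=
    Subsingleton.elim _ _
  ext p
  simpa using congrArg Fin.val (DFunLike.congr_fun hrefl (T p)).symm

/-- The nonnegative functions that are strictly increasing along the enumeration `T`. -/
def chamber (T : P ≃ Fin N) : Set (P → ℝ) := {F | 0 ≤ F ∧ StrictMono (F ∘ T.symm)}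

theorem chamber_ae_eq [Fintype P] (T : P ≃ Fin N) :
    chamber T =ᵐ[volume] (fun F => F ∘ T.symm) ⁻¹' orderCone (Fin N) := by
  filter_upwards [ae_injective P] with F hF
  refine propext ⟨fun h => ⟨fun i => h.1 _, h.2.monotone⟩, fun h => ⟨fun p => ?_, ?_⟩⟩
  · simpa using h.1 (T p)
  · exact h.2.strictMono_of_injective (hF.comp T.symm.injective)

variable [Fintype P] [PartialOrder P]

theorem orderCone_ae_eq_iUnion_chamber (σ : P ≃ Fin N) :
    orderCone P =ᵐ[volume] ⋃ T : {T : P ≃ Fin N // StrictMono T}, chamber T.1 := by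
  filter_upwards [ae_injective P] with F hF
  refine propext ⟨fun ⟨h0, hmono⟩ => ?_, fun h => ?_⟩
  · obtain ⟨T, hT⟩ := exists_strictMono_comp_symm σ hF
    refine Set.mem_iUnion.2 ⟨⟨T, fun p q hpq => ?_⟩, h0, hT⟩
    rw [← hT.lt_iff_lt]
    simpa using hmono.strictMono_of_injective hF hpq
  · obtain ⟨T, h0, hT⟩ := Set.mem_iUnion.1 h
    exact ⟨h0, fun p q hpq => by simpa using hT.monotone (T.2.monotone hpq)⟩

theorem lintegral_chamber {T : P ≃ Fin N} (hT : StrictMono T) {top : P} (htop : IsTop top) :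
    ∫⁻ F in chamber T, ENNReal.ofReal (Real.exp (-F top)) = 1 := by
  obtain _ | m := N
  · exact (T top).elim0
  have hlast : T.symm (Fin.last m) = top := by
    rw [Equiv.symm_apply_eq]
    exact Fin.le_last _ |>.antisymm' (by simpa using hT.monotone (htop (T.symm (Fin.last m))))
  rw [setLIntegral_congr (chamber_ae_eq T), ← lintegral_orderCone_fin m,
    ← (measurePreserving_comp_symm T).setLIntegral_comp_preimage (measurableSet_orderCone _)
      (by fun_prop)]
  simp only [Function.comp_apply, hlast]

theorem lintegral_orderCone (σ : P ≃ Fin N) {top : P} (htop : IsTop top) :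
    ∫⁻ F in orderCone P, ENNReal.ofReal (Real.exp (-F top)) =
      Nat.card {T : P ≃ Fin N // StrictMono T} := by
  classical
  rw [setLIntegral_congr (orderCone_ae_eq_iUnion_chamber σ), lintegral_iUnion₀]
  · simp only [fun T : {T : P ≃ Fin N // StrictMono T} => lintegral_chamber T.2 htop, tsum_fintype,
      Finset.sum_const, Finset.card_univ, nsmul_eq_mul, mul_one, Nat.card_eq_fintype_card]
  · exact fun T => (((measurePreserving_comp_symm T.1).measurable
      (measurableSet_orderCone _)).nullMeasurableSet).congr (chamber_ae_eq T.1).symm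
  · exact fun T T' hne => (Set.disjoint_left.2 fun F h h' =>
      hne (Subtype.ext (eq_of_strictMono_comp_symm h.2 h'.2))).aedisjoint

end Enumeration

/-! ### Unimodularity -/

/-- The linear combination of the simple roots with given coefficients. -/
noncomputable def rootSum : (Fin (k - 1) × Fin (n - k - 1) → ℝ) →ₗ[ℝ] Grid k n :=
  Fintype.linearCombination ℝ simpleRoot

theorem rootSum_apply (x : Fin (k - 1) × Fin (n - k - 1) → ℝ) :
    rootSum x = ∑ q, x q • (simpleRoot q : Grid k n) :=
  Fintype.linearCombination_apply ℝ simpleRoot x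

theorem gridCoord_surjective (hn : k < n) :
    Function.Surjective (gridCoord hn : Grid k n → Fin (k - 1) × Fin (n - k - 1) → ℝ) := by
  intro x
  refine ⟨fun q => if h : (q.2 : ℕ) < n - k - 1 then x (q.1, ⟨q.2, h⟩) else 0, ?_⟩
  funext q
  simp [gridCoord_apply, lastCol]

theorem rootSum_gridCoord (hn : k < n) (a : Grid k n) : rootSum (gridCoord hn a) = fComb a := by
  simp only [rootSum_apply, fComb_apply, Fintype.sum_prod_type, gridCoord_apply, simpleRoot]
  refine Finset.sum_congr rfl fun i _ => ?_
  have hsum := sum_castLE_add_lastCol hn fun j => (a (i, j) - a (i, lastCol hn)) • f (i, j)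
  simp only [sub_self, zero_smul, add_zero] at hsum
  rw [hsum]
  simp only [sub_smul, Finset.sum_sub_distrib, ← Finset.smul_sum, sum_f_eq_zero, smul_zero,
    sub_zero]

theorem rootSum_injective (hn : k < n) :
    Function.Injective (rootSum : (Fin (k - 1) × Fin (n - k - 1) → ℝ) → Grid k n) := by
  rw [injective_iff_map_eq_zero]
  intro x hx
  obtain ⟨a, rfl⟩ := gridCoord_surjective hn x
  exact gridCoord_eq_zero hn (by rwa [← rootSum_gridCoord hn])

theorem rootSum_mem_rowZero (x : Fin (k - 1) × Fin (n - k - 1) → ℝ) :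
    (rootSum x : Grid k n) ∈ rowZero k n := by
  rw [rootSum_apply]
  exact Submodule.sum_mem _ fun q _ => Submodule.smul_mem _ _ (f_mem_rowZero _)

theorem rootSum_gridCoord_rowDiff_filterArray (hn : k < n) (J : KSubset k n) :
    rootSum (gridCoord hn (rowDiff (filterArray J))) = v J := by
  rw [rootSum_gridCoord, v_eq_fComb]

theorem filterArray_mem_range_intCast (J : KSubset k n) (p : Fin k × Fin (n - k)) :
    filterArray J p ∈ (Int.castAddHom ℝ).range := by
  unfold filterArray
  split_ifs
  exacts [⟨1, by simp⟩, zero_mem _]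

theorem rowDiff_apply_mem {T : AddSubgroup ℝ} {F : Arr k n} (hF : ∀ p, F p ∈ T)
    (q : Fin (k - 1) × Fin (n - k)) : rowDiff F q ∈ T :=
  sub_mem (hF _) (hF _)

theorem gridCoord_apply_mem {T : AddSubgroup ℝ} (hn : k < n) {a : Grid k n} (ha : ∀ q, a q ∈ T)
    (q : Fin (k - 1) × Fin (n - k - 1)) : gridCoord hn a q ∈ T :=
  sub_mem (ha _) (ha _)

theorem gridCoord_rowDiff_filterArray_mem_range_intCast (hn : k < n) (J : KSubset k n)
    (q : Fin (k - 1) × Fin (n - k - 1)) :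
    gridCoord hn (rowDiff (filterArray J)) q ∈ (Int.castAddHom ℝ).range :=
  gridCoord_apply_mem hn (rowDiff_apply_mem (filterArray_mem_range_intCast J)) q

theorem v_mem_rootLattice (hn : k < n) (J : KSubset k n) : v J ∈ rootLattice k n := by
  rw [← rootSum_gridCoord_rowDiff_filterArray hn, rootSum_apply]
  refine Submodule.sum_mem _ fun q _ => ?_
  obtain ⟨z, hz⟩ := gridCoord_rowDiff_filterArray_mem_range_intCast hn J q
  rw [← hz, Int.coe_castAddHom, Int.cast_smul_eq_zsmul]
  exact Submodule.smul_mem _ _ (Submodule.subset_span ⟨q, rfl⟩)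

theorem IsRep.mem_of_vComb_mem_convexHull (hk : 0 < k) (hn : k < n) {c : KSubset k n → ℝ}
    (hc : IsRep c) {𝒥 : Finset (KSubset k n)} (h𝒥 : 𝒥 ∈ NC k n)
    (hmem : vComb c ∈ convexHull ℝ (insert 0 (v '' (𝒥 : Set (KSubset k n))))) {J : KSubset k n}
    (hJ : c J ≠ 0) : J ∈ 𝒥 := by
  obtain ⟨c', hc', hcc', -, -, hc's⟩ := exists_isRep_of_mem_convexHull hk hn
    (s := insert 0 (𝒥.image v)) ⟨Finset.insert_nonempty _ _, 𝒥, h𝒥, subset_rfl⟩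
    (by simpa using hmem)
  obtain rfl := hc'.eq_of_vComb_eq hk hn hc hcc'
  exact mem_of_v_mem hk hn h𝒥 subset_rfl (hc.mem_nonfrozen J hJ) (hc's J hJ)

theorem eventually_forall_mem_imp_mem {ι X Y : Type*} [Finite ι] [TopologicalSpace X]
    [TopologicalSpace Y] {S : ι → Set Y} (hS : ∀ i, IsClosed (S i)) {g : X → Y} {x : X}
    (hg : ContinuousAt g x) : ∀ᶠ t in nhds x, ∀ i, g t ∈ S i → g x ∈ S i := by
  refine Filter.eventually_all.2 fun i => ?_
  by_cases hx : g x ∈ S i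
  · exact .of_forall fun _ _ => hx
  · exact (hg.eventually_mem ((hS i).isOpen_compl.mem_nhds hx)).mono fun _ ht ht' => absurd ht' ht

theorem exists_pos_vComb_add_smul_mem_convexHull (hk : 0 < k) (hkn : k ≤ n)
    {b c : KSubset k n → ℝ} (hb : 0 ≤ b) (hc : 0 ≤ c) (hc1 : ∑ J, c J < 1) :
    ∃ t > (0 : ℝ), ∃ 𝒥 ∈ NC k n,
      vComb c ∈ convexHull ℝ (insert 0 (v '' (𝒥 : Set (KSubset k n)))) ∧
        vComb (c + t • b) ∈ convexHull ℝ (insert 0 (v '' (𝒥 : Set (KSubset k n)))) := by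
  let simplex (𝒥 : Finset (KSubset k n)) : Set (Grid k n) :=
    convexHull ℝ (insert 0 (v '' (𝒥 : Set (KSubset k n))))
  have hsum : ∀ᶠ t : ℝ in nhdsWithin 0 (Set.Ioi 0), ∑ J, (c + t • b) J < 1 := by
    have hcont : Continuous fun t : ℝ => ∑ J, (c + t • b) J := by
      simp only [Pi.add_apply, Pi.smul_apply]
      fun_prop
    exact nhdsWithin_le_nhds (hcont.continuousAt.eventually_lt_const (by simpa using hc1))
  have hclosed : ∀ᶠ t : ℝ in nhdsWithin 0 (Set.Ioi 0), ∀ 𝒥 : Finset (KSubset k n),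
      vComb (c + t • b) ∈ simplex 𝒥 → vComb c ∈ simplex 𝒥 := by
    have hcont : Continuous fun t : ℝ => vComb (c + t • b) := by
      simp only [map_add, map_smul]
      fun_prop
    have h := eventually_forall_mem_imp_mem (S := simplex)
      (fun 𝒥 => ((𝒥.finite_toSet.image v).insert 0).isClosed_convexHull (𝕜 := ℝ))
      (hcont.continuousAt (x := 0))
    simpa only [zero_smul, add_zero] using Filter.Eventually.filter_mono nhdsWithin_le_nhds h
  obtain ⟨t, ⟨hsum, hclosed⟩, ht : 0 < t⟩ :=
    ((hsum.and hclosed).and self_mem_nhdsWithin).exists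
  obtain ⟨𝒥, h𝒥, hmem⟩ := exists_mem_NC_vComb_mem_convexHull hk hkn
    (add_nonneg hc (smul_nonneg ht.le hb)) hsum.le
  exact ⟨t, ht, 𝒥, h𝒥, hclosed 𝒥 hmem, hmem⟩

/- Move a little from an interior point of the cone over `𝒥` towards a given point: the simplices
being closed and finite in number, the new point lies in one which also contains the old point, and
by maximality of `𝒥` this is the simplex of `𝒥`. -/
theorem rowZero_le_span_of_maximal (hk : 0 < k) (hn : k < n) {𝒥 : Finset (KSubset k n)}
    (h𝒥 : Maximal (· ∈ NC k n) 𝒥) :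
    rowZero k n ≤ Submodule.span ℝ (v '' (𝒥 : Set (KSubset k n))) := by
  classical
  intro z hz
  obtain ⟨b, hb, rfl⟩ := exists_isRep_of_mem_rowZero hk hn.le hz
  let c : KSubset k n → ℝ := fun J => if J ∈ 𝒥 then (𝒥.card + 1 : ℝ)⁻¹ else 0
  have hc : IsRep c := IsRep.of_mem_NC h𝒥.prop (fun J => by dsimp [c]; positivity)
    fun J hJ => (ite_ne_right_iff.1 hJ).1
  have hc1 : ∑ J, c J < 1 := by
    simp only [c, Finset.sum_ite_mem, Finset.univ_inter, Finset.sum_const, nsmul_eq_mul]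
    rw [← div_eq_mul_inv, div_lt_one (by positivity)]
    exact lt_add_one _
  obtain ⟨t, ht, 𝒥', h𝒥', hmem, hmem_add⟩ :=
    exists_pos_vComb_add_smul_mem_convexHull hk hn.le hb.nonneg hc.nonneg hc1
  have hsub : 𝒥 ⊆ 𝒥' := fun J hJ => hc.mem_of_vComb_mem_convexHull hk hn h𝒥' hmem (by
    simp only [c, if_pos hJ]
    positivity)
  have hspan : convexHull ℝ (insert 0 (v '' (𝒥' : Set (KSubset k n)))) ⊆
      Submodule.span ℝ (v '' (𝒥 : Set (KSubset k n))) := by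
    refine convexHull_min (Set.insert_subset (zero_mem _) ?_) (Submodule.convex _)
    exact (Set.image_mono (h𝒥.le_of_ge h𝒥' hsub)).trans Submodule.subset_span
  have hdiff := sub_mem (hspan hmem_add) (hspan hmem)
  rw [map_add, add_sub_cancel_left, map_smul] at hdiff
  exact (Submodule.smul_mem_iff _ ht.ne').1 hdiff

theorem vComb_extend (𝒥 : Finset (KSubset k n)) (c : 𝒥 → ℝ) :
    vComb (Function.extend Subtype.val c 0) = ∑ J, c J • v J.1 := by
  rw [vComb_apply]
  refine (Fintype.sum_of_injective _ Subtype.val_injective _ _ (fun J hJ => ?_) fun J => ?_).symm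
  · rw [Function.extend_apply' _ _ _ hJ, Pi.zero_apply, zero_smul]
  · rw [Subtype.val_injective.extend_apply]

theorem isRep_extend {𝒥 : Finset (KSubset k n)} (h𝒥 : 𝒥 ∈ NC k n) {c : 𝒥 → ℝ} (hc : 0 ≤ c) :
    IsRep (Function.extend Subtype.val c 0) := by
  refine IsRep.of_mem_NC h𝒥 (Function.extend_nonneg hc le_rfl) fun J hJ => ?_
  by_contra hJ𝒥
  exact hJ (Function.extend_apply' _ _ _ fun ⟨I, hI⟩ => hJ𝒥 (hI ▸ I.2))

/- Adding a large integer to all coefficients makes them nonnegative, and then they must agree with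
those of an integral noncrossing representation. -/
theorem mem_range_intCast_of_sum_smul_v_eq (hk : 0 < k) (hn : k < n) {𝒥 : Finset (KSubset k n)}
    (h𝒥 : 𝒥 ∈ NC k n) {c : 𝒥 → ℝ} {a : Grid k n} (ha : ∀ q, a q ∈ (Int.castAddHom ℝ).range)
    (h : ∑ J, c J • v J.1 = fComb a) (J : 𝒥) : c J ∈ (Int.castAddHom ℝ).range := by
  obtain ⟨N, hN⟩ := exists_nat_gt (∑ J, |c J|)
  have hNc : 0 ≤ c + fun _ => (N : ℝ) := fun I => by
    have hI := Finset.single_le_sum (fun I _ => abs_nonneg (c I)) (Finset.mem_univ I)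
    have := neg_abs_le (c I)
    simp only [Pi.zero_apply, Pi.add_apply]
    linarith
  let a' : Grid k n := a + ∑ I : 𝒥, (N : ℝ) • rowDiff (filterArray I.1)
  have ha' (q) : a' q ∈ (Int.castAddHom ℝ).range := by
    refine add_mem (ha q) ?_
    rw [Finset.sum_apply]
    refine sum_mem fun I _ => ?_
    rw [Pi.smul_apply, Nat.cast_smul_eq_nsmul]
    exact nsmul_mem (rowDiff_apply_mem (filterArray_mem_range_intCast I.1) q) N
  obtain ⟨d, hd, hdT, hda⟩ := exists_isRep_vComb_eq_fComb
    (by rw [AddMonoidHom.coe_range]; exact Int.isClosedEmbedding_coe_real.isClosed_range)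
    hk hn.le ha'
  have heq : d = Function.extend (fun J : 𝒥 => J.1) (c + fun _ => (N : ℝ)) 0 := by
    refine hd.eq_of_vComb_eq hk hn (isRep_extend h𝒥 hNc) ?_
    simp only [hda, a', vComb_extend, map_add, map_sum, map_smul, ← v_eq_fComb, ← h, Pi.add_apply,
      add_smul, Finset.sum_add_distrib]
  have hJ := hdT J.1
  rw [heq, Subtype.val_injective.extend_apply] at hJ
  have hNT : (N : ℝ) ∈ (Int.castAddHom ℝ).range := ⟨N, by simp⟩
  simpa only [Pi.add_apply, add_sub_cancel_right] using sub_mem hJ hNT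

theorem sum_smul_mem_convexHull_insert_zero_range_iff {ι E : Type*} [Fintype ι] [AddCommGroup E]
    [Module ℝ E] {b : ι → E} (hb : LinearIndependent ℝ b) {c : ι → ℝ} :
    ∑ i, c i • b i ∈ convexHull ℝ (insert 0 (Set.range b)) ↔ 0 ≤ c ∧ ∑ i, c i ≤ 1 := by
  classical
  refine ⟨fun hmem => ?_, fun ⟨hc, hc1⟩ => sum_smul_mem_of_sum_le_one (convex_convexHull ℝ _) hc hc1
    (fun _ => subset_convexHull ℝ _ (Set.mem_insert _ _))
    fun i _ => subset_convexHull ℝ _ (Set.mem_insert_of_mem _ ⟨i, rfl⟩)⟩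
  have hsub : convexHull ℝ (insert 0 (Set.range b)) ⊆
      Fintype.linearCombination ℝ b '' {c | 0 ≤ c ∧ ∑ i, c i ≤ 1} := by
    refine convexHull_min (Set.insert_subset ⟨0, by simp⟩ ?_) (Convex.linear_image ?_ _)
    · rintro _ ⟨i, rfl⟩
      exact ⟨Pi.single i 1, by simp [Pi.single_nonneg]⟩
    · rintro c ⟨hc, hc1⟩ c' ⟨hc', hc1'⟩ s t hs ht hst
      refine ⟨add_nonneg (smul_nonneg hs hc) (smul_nonneg ht hc'), ?_⟩
      simp only [Pi.add_apply, Pi.smul_apply, smul_eq_mul, Finset.sum_add_distrib, ← Finset.mul_sum]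
      nlinarith
  obtain ⟨c', hc', he⟩ := hsub hmem
  rw [← Fintype.linearCombination_apply ℝ b] at he
  rwa [← hb.fintypeLinearCombination_injective he]

/-- The coordinates with respect to the simple roots of the linear combination of the vectors `v J`,
`J ∈ 𝒥`, with given coefficients. -/
noncomputable def simpleRootCoord (hn : k < n) (𝒥 : Finset (KSubset k n)) :
    (𝒥 → ℝ) →ₗ[ℝ] (Fin (k - 1) × Fin (n - k - 1) → ℝ) :=
  Fintype.linearCombination ℝ fun J : 𝒥 => gridCoord hn (rowDiff (filterArray J.1))

theorem rootSum_simpleRootCoord (hn : k < n) {𝒥 : Finset (KSubset k n)} (c : 𝒥 → ℝ) :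
    rootSum (simpleRootCoord hn 𝒥 c) = ∑ J, c J • v J.1 := by
  simp only [simpleRootCoord, Fintype.linearCombination_apply, map_sum, map_smul,
    rootSum_gridCoord_rowDiff_filterArray]

theorem simpleRootCoord_injective (hk : 0 < k) (hn : k < n) {𝒥 : Finset (KSubset k n)}
    (h𝒥 : 𝒥 ∈ NC k n) : Function.Injective (simpleRootCoord hn 𝒥) := by
  intro c c' h
  have hsum := congrArg rootSum h
  simp only [rootSum_simpleRootCoord] at hsum
  exact LinearIndependent.fintypeLinearCombination_injective (linearIndepOn_v hk hn h𝒥) hsum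

theorem simpleRootCoord_surjective (hk : 0 < k) (hn : k < n) {𝒥 : Finset (KSubset k n)}
    (h𝒥 : Maximal (· ∈ NC k n) 𝒥) : Function.Surjective (simpleRootCoord hn 𝒥) := by
  intro x
  have hmem := rowZero_le_span_of_maximal hk hn h𝒥 (rootSum_mem_rowZero x)
  rw [Set.image_eq_range, Submodule.mem_span_range_iff_exists_fun] at hmem
  obtain ⟨c, hc⟩ := hmem
  exact ⟨c, rootSum_injective hn ((rootSum_simpleRootCoord hn c).trans hc)⟩

theorem card_eq_of_maximal (hk : 0 < k) (hn : k < n) {𝒥 : Finset (KSubset k n)}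
    (h𝒥 : Maximal (· ∈ NC k n) 𝒥) : 𝒥.card = (k - 1) * (n - k - 1) := by
  have h := (LinearEquiv.ofBijective (simpleRootCoord hn 𝒥)
    ⟨simpleRootCoord_injective hk hn h𝒥.prop, simpleRootCoord_surjective hk hn h𝒥⟩).finrank_eq
  simpa using h

theorem measurePreserving_simpleRootCoord (hk : 0 < k) (hn : k < n) {𝒥 : Finset (KSubset k n)}
    (h𝒥 : Maximal (· ∈ NC k n) 𝒥) : MeasurePreserving (simpleRootCoord hn 𝒥) := by
  classical
  let A := LinearEquiv.ofBijective (simpleRootCoord hn 𝒥)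
    ⟨simpleRootCoord_injective hk hn h𝒥.prop, simpleRootCoord_surjective hk hn h𝒥⟩
  refine measurePreserving_of_int (B := A.symm.toLinearMap)
    (LinearMap.ext fun c => A.symm_apply_apply c) (by simp [card_eq_of_maximal hk hn h𝒥])
    (fun J q => ?_) fun q J => ?_
  · rw [simpleRootCoord, Fintype.linearCombination_apply_single, one_smul]
    exact gridCoord_rowDiff_filterArray_mem_range_intCast hn J.1 q
  · refine mem_range_intCast_of_sum_smul_v_eq hk hn h𝒥.prop
      (a := Pi.single (q.1, q.2.castLE (Nat.sub_le _ _)) 1) (fun p => ?_) ?_ J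
    · rw [Pi.single_apply]
      split_ifs
      exacts [⟨1, by simp⟩, zero_mem _]
    · have h : simpleRootCoord hn 𝒥 (A.symm (Pi.single q 1)) = Pi.single q 1 :=
        A.apply_symm_apply _
      rw [LinearEquiv.coe_coe, ← rootSum_simpleRootCoord hn, h, rootSum, fComb,
        Fintype.linearCombination_apply_single, Fintype.linearCombination_apply_single, simpleRoot]

theorem relVolume_eq (S : Set (Grid k n)) : relVolume S = volume (rootSum ⁻¹' S) := by
  simp only [relVolume, ← rootSum_apply]
  rfl

theorem relVolume_convexHull_of_maximal (hk : 0 < k) (hn : k < n) {𝒥 : Finset (KSubset k n)}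
    (h𝒥 : Maximal (· ∈ NC k n) 𝒥) :
    relVolume (convexHull ℝ (insert 0 (v '' (𝒥 : Set (KSubset k n))))) =
      1 / (((k - 1) * (n - k - 1)) ! : ℝ≥0∞) := by
  set S := convexHull ℝ (insert 0 (v '' (𝒥 : Set (KSubset k n)))) with hS
  have hclosed : IsClosed S := ((𝒥.finite_toSet.image v).insert 0).isClosed_convexHull (𝕜 := ℝ)
  have hmeas : MeasurableSet (rootSum ⁻¹' S : Set (Fin (k - 1) × Fin (n - k - 1) → ℝ)) :=
    (hclosed.preimage (LinearMap.continuous_on_pi rootSum)).measurableSet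
  have hpre : simpleRootCoord hn 𝒥 ⁻¹' (rootSum ⁻¹' S) = {c | 0 ≤ c ∧ ∑ J, c J ≤ 1} := by
    ext c
    rw [Set.mem_preimage, Set.mem_preimage, rootSum_simpleRootCoord, hS, Set.image_eq_range]
    exact sum_smul_mem_convexHull_insert_zero_range_iff (linearIndepOn_v hk hn h𝒥.prop)
  rw [relVolume_eq, ← (measurePreserving_simpleRootCoord hk hn h𝒥).measure_preimage
    hmeas.nullMeasurableSet, hpre, volume_simplex, Fintype.card_coe, card_eq_of_maximal hk hn h𝒥]

theorem isUnimodular_ncComplex (hk : 0 < k) (hn : k < n) : IsUnimodular (ncComplex hk hn) := by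
  constructor
  · rintro x ⟨-, 𝒥, -, hsub⟩
    rcases Finset.mem_insert.1 (hsub (Finset.mem_singleton_self x)) with h | h
    · rw [h]
      exact Submodule.zero_mem _
    · obtain ⟨J, -, rfl⟩ := Finset.mem_image.1 h
      exact v_mem_rootLattice hn J
  · intro s hs
    rw [Geometry.SimplicialComplex.mem_facets] at hs
    obtain ⟨⟨-, 𝒥, h𝒥, hsub⟩, hfacet⟩ := hs
    have hface : ∀ 𝒥' ∈ NC k n, insert 0 (𝒥'.image v) ∈ (ncComplex hk hn).faces :=
      fun 𝒥' h => ⟨Finset.insert_nonempty _ _, 𝒥', h, subset_rfl⟩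
    obtain rfl := hfacet _ (hface 𝒥 h𝒥) hsub
    rw [Finset.coe_insert, Finset.coe_image]
    refine relVolume_convexHull_of_maximal hk hn ⟨h𝒥, fun 𝒥' h𝒥' h J hJ => ?_⟩
    refine mem_of_v_mem hk hn h𝒥 subset_rfl (h𝒥'.1 J hJ) ?_
    rw [hfacet _ (hface 𝒥' h𝒥') (Finset.insert_subset_insert _ (Finset.image_subset_image h))]
    exact Finset.mem_insert_of_mem (Finset.mem_image_of_mem _ hJ)

/-- The coefficients of the noncrossing representation of `rootSum x`. -/
noncomputable def ncCoeff (hk : 0 < k) (hn : k < n) (x : Fin (k - 1) × Fin (n - k - 1) → ℝ) :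
    KSubset k n → ℝ :=
  (exists_isRep_of_mem_rowZero hk hn.le (rootSum_mem_rowZero x)).choose

theorem isRep_ncCoeff (hk : 0 < k) (hn : k < n) (x : Fin (k - 1) × Fin (n - k - 1) → ℝ) :
    IsRep (ncCoeff hk hn x) :=
  (exists_isRep_of_mem_rowZero hk hn.le (rootSum_mem_rowZero x)).choose_spec.1

theorem vComb_ncCoeff (hk : 0 < k) (hn : k < n) (x : Fin (k - 1) × Fin (n - k - 1) → ℝ) :
    vComb (ncCoeff hk hn x) = rootSum x :=
  (exists_isRep_of_mem_rowZero hk hn.le (rootSum_mem_rowZero x)).choose_spec.2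

theorem IsRep.eq_ncCoeff (hk : 0 < k) (hn : k < n) {c : KSubset k n → ℝ} (h : IsRep c)
    {x : Fin (k - 1) × Fin (n - k - 1) → ℝ} (hx : vComb c = rootSum x) : c = ncCoeff hk hn x :=
  h.eq_of_vComb_eq hk hn (isRep_ncCoeff hk hn x) (hx.trans (vComb_ncCoeff hk hn x).symm)

theorem IsRep.smul {c : KSubset k n → ℝ} (h : IsRep c) {s : ℝ} (hs : 0 ≤ s) : IsRep (s • c) :=
  ⟨fun J => mul_nonneg hs (h.nonneg J), fun J hJ => h.mem_nonfrozen J (right_ne_zero_of_mul hJ),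
    fun I J hI hJ =>
      h.noncrossingSupport I J (right_ne_zero_of_mul hI) (right_ne_zero_of_mul hJ)⟩

theorem ncCoeff_smul (hk : 0 < k) (hn : k < n) {s : ℝ} (hs : 0 ≤ s)
    (x : Fin (k - 1) × Fin (n - k - 1) → ℝ) : ncCoeff hk hn (s • x) = s • ncCoeff hk hn x :=
  (((isRep_ncCoeff hk hn x).smul hs).eq_ncCoeff hk hn
    (by rw [map_smul, map_smul, vComb_ncCoeff])).symm

/-- The sum of the coefficients of the noncrossing representation of `rootSum x`: the gauge of the
root polytope, read in the coordinates of the simple roots. -/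
noncomputable def ncGauge (hk : 0 < k) (hn : k < n) (x : Fin (k - 1) × Fin (n - k - 1) → ℝ) : ℝ :=
  ∑ J, ncCoeff hk hn x J

theorem ncGauge_nonneg (hk : 0 < k) (hn : k < n) (x : Fin (k - 1) × Fin (n - k - 1) → ℝ) :
    0 ≤ ncGauge hk hn x :=
  Finset.sum_nonneg fun J _ => (isRep_ncCoeff hk hn x).nonneg J

theorem ncGauge_smul (hk : 0 < k) (hn : k < n) {s : ℝ} (hs : 0 ≤ s)
    (x : Fin (k - 1) × Fin (n - k - 1) → ℝ) : ncGauge hk hn (s • x) = s * ncGauge hk hn x := by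
  simp only [ncGauge, ncCoeff_smul hk hn hs, Pi.smul_apply, smul_eq_mul, Finset.mul_sum]

theorem ncGauge_le_sum (hk : 0 < k) (hn : k < n) {c : KSubset k n → ℝ} (hc : 0 ≤ c)
    {x : Fin (k - 1) × Fin (n - k - 1) → ℝ} (hx : vComb c = rootSum x) :
    ncGauge hk hn x ≤ ∑ J, c J := by
  obtain ⟨c', hc', -, hv, hle⟩ := exists_isRep (T := ⊤) isClosed_univ hk hn.le hc fun _ => trivial
  rwa [hc'.eq_ncCoeff hk hn (hv.trans hx)] at hle

theorem convexOn_ncGauge (hk : 0 < k) (hn : k < n) :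
    ConvexOn ℝ Set.univ (ncGauge (k := k) (n := n) hk hn) := by
  refine ⟨convex_univ, fun x _ y _ s t hs ht _ => ?_⟩
  have h := ncGauge_le_sum hk hn (x := s • x + t • y)
    (c := s • ncCoeff hk hn x + t • ncCoeff hk hn y)
    (add_nonneg (smul_nonneg hs (isRep_ncCoeff hk hn x).nonneg)
      (smul_nonneg ht (isRep_ncCoeff hk hn y).nonneg))
    (by simp only [map_add, map_smul, vComb_ncCoeff])
  simpa only [ncGauge, Pi.add_apply, Pi.smul_apply, smul_eq_mul, Finset.sum_add_distrib,
    Finset.mul_sum] using h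

theorem continuous_ncGauge (hk : 0 < k) (hn : k < n) :
    Continuous (ncGauge (k := k) (n := n) hk hn) :=
  continuousOn_univ.1 ((convexOn_ncGauge hk hn).continuousOn isOpen_univ)

theorem ncGauge_le_one_iff (hk : 2 ≤ k) (hn : k + 2 ≤ n)
    (x : Fin (k - 1) × Fin (n - k - 1) → ℝ) :
    ncGauge (k := k) (n := n) (by omega) (by omega) x ≤ 1 ↔ rootSum x ∈ rootPolytope k n := by
  rw [mem_rootPolytope_iff hk hn]
  refine ⟨fun h => ⟨_, isRep_ncCoeff _ _ x, vComb_ncCoeff _ _ x, h⟩, ?_⟩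
  rintro ⟨c, hc, hcx, hsum⟩
  rwa [ncGauge, ← hc.eq_ncCoeff (by omega) (by omega) hcx]

theorem normalizedVolume_eq_lintegral (hk : 2 ≤ k) (hn : k + 2 ≤ n) :
    normalizedVolume (rootPolytope k n) =
      ∫⁻ x, ENNReal.ofReal (Real.exp (-ncGauge (k := k) (n := n) (by omega) (by omega) x)) := by
  have hvol := lintegral_exp_neg_eq_factorial_mul_volume (D := Set.univ)
    (continuous_ncGauge (k := k) (n := n) (by omega) (by omega)).measurable
    (fun _ _ _ _ => trivial) (fun s hs x _ => ncGauge_smul _ _ hs.le x)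
    (fun x _ => ncGauge_nonneg _ _ x)
  simp only [ncGauge_le_one_iff hk hn, Set.univ_inter, Measure.restrict_univ, Fintype.card_prod,
    Fintype.card_fin] at hvol
  rw [hvol, normalizedVolume, relVolume_eq]
  rfl

/-- The nonnegative arrays that decrease along columns and increase along rows. -/
def arrayCone (k n : ℕ) : PointedCone ℝ (Arr k n) where
  carrier := {F | 0 ≤ F ∧ ∀ p p' : Fin k × Fin (n - k), p'.1 ≤ p.1 → p.2 ≤ p'.2 → F p ≤ F p'}
  add_mem' h h' := ⟨add_nonneg h.1 h'.1,
    fun p p' h₁ h₂ => add_le_add (h.2 p p' h₁ h₂) (h'.2 p p' h₁ h₂)⟩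
  zero_mem' := ⟨le_rfl, fun _ _ _ _ => le_rfl⟩
  smul_mem' s _ h := ⟨smul_nonneg s.2 h.1,
    fun p p' h₁ h₂ => mul_le_mul_of_nonneg_left (h.2 p p' h₁ h₂) s.2⟩

theorem mem_arrayCone {F : Arr k n} : F ∈ arrayCone k n ↔
    0 ≤ F ∧ ∀ p p' : Fin k × Fin (n - k), p'.1 ≤ p.1 → p.2 ≤ p'.2 → F p ≤ F p' :=
  Iff.rfl

theorem filterArray_mem_arrayCone (J : KSubset k n) : filterArray J ∈ arrayCone k n := by
  refine mem_arrayCone.2 ⟨fun p => ?_, fun p p' h₁ h₂ => ?_⟩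
  · unfold filterArray
    split_ifs
    exacts [zero_le_one, le_rfl]
  · have := entry_add_sub_le J h₁ p.1.2
    unfold filterArray
    split_ifs
    exacts [le_rfl, by omega, zero_le_one, le_rfl]

theorem filterComb_mem_arrayCone {c : KSubset k n → ℝ} (hc : 0 ≤ c) :
    filterComb c ∈ arrayCone k n := by
  rw [filterComb_eq_sum]
  exact sum_mem fun J _ => PointedCone.smul_mem _ (hc J) (filterArray_mem_arrayCone J)

theorem exists_le_iff_of_upward {m : ℕ} {P : Fin m → Prop} (hP : ∀ i j, i ≤ j → P i → P j) :
    ∃ u ≤ m, ∀ j : Fin m, u ≤ j ↔ P j := by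
  classical
  have hex : ∃ u, ∀ h : u < m, P ⟨u, h⟩ := ⟨m, fun h => absurd h (lt_irrefl m)⟩
  refine ⟨Nat.find hex, Nat.find_min' _ fun h => absurd h (lt_irrefl m), fun j => ⟨fun h => ?_,
    fun h => Nat.find_min' _ fun _ => h⟩⟩
  exact hP ⟨Nat.find hex, h.trans_lt j.2⟩ j h (Nat.find_spec hex _)

theorem ne_zero_of_mem_arrayCone {F : Arr k n} (hF : F ∈ arrayCone k n)
    {p p' : Fin k × Fin (n - k)} (h₁ : p'.1 ≤ p.1) (h₂ : p.2 ≤ p'.2) (hp : F p ≠ 0) : F p' ≠ 0 :=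
  ((lt_of_le_of_ne (hF.1 p) hp.symm).trans_le (hF.2 p p' h₁ h₂)).ne'

theorem exists_filterArray_eq_ite (hkn : k ≤ n) {F : Arr k n} (hF : F ∈ arrayCone k n) :
    ∃ J : KSubset k n, ∀ p, filterArray J p = if F p = 0 then 0 else 1 := by
  have hrow : ∀ l : ℕ, ∃ u ≤ n - k, ∀ (h : l < k) (j : Fin (n - k)), u ≤ j ↔ F (⟨l, h⟩, j) ≠ 0 := by
    intro l
    obtain ⟨u, hu, hiff⟩ := exists_le_iff_of_upward (m := n - k)
      (P := fun j => ∀ h : l < k, F (⟨l, h⟩, j) ≠ 0)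
      fun i j hij hi h => ne_zero_of_mem_arrayCone hF (p := (_, i)) le_rfl hij (hi h)
    exact ⟨u, hu, fun h j => (hiff j).trans ⟨fun h' => h' h, fun h' _ => h'⟩⟩
  choose u hu hiff using hrow
  have hmono : ∀ l, l + 1 < k → u l ≤ u (l + 1) := by
    intro l hl
    by_contra! hlt
    refine hlt.not_ge ((hiff l (by omega) ⟨u (l + 1), hlt.trans_le (hu l)⟩).2 ?_)
    exact ne_zero_of_mem_arrayCone hF (p := (⟨l + 1, hl⟩, _)) (Fin.le_def.2 l.le_succ) le_rfl
      ((hiff (l + 1) hl ⟨u (l + 1), hlt.trans_le (hu l)⟩).1 le_rfl)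
  obtain ⟨J, hJ⟩ := exists_entry_eq (k := k) (n := n) (x := fun l => u l + l)
    (fun l hl => by have := hmono l hl; omega) (fun l hl => by have := hu l; omega)
  refine ⟨J, fun p => ?_⟩
  simp only [filterArray, hJ _ p.1.2, add_le_add_iff_right, hiff p.1 p.1.2, ite_not]

theorem sub_smul_filterArray_mem_arrayCone {F : Arr k n} (hF : F ∈ arrayCone k n) {s : ℝ}
    (hs : ∀ p, F p ≠ 0 → s ≤ F p) {J : KSubset k n}
    (hJ : ∀ p, filterArray J p = if F p = 0 then 0 else 1) :
    F - s • filterArray J ∈ arrayCone k n := by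
  have hval (p) : (F - s • filterArray J) p = if F p = 0 then 0 else F p - s := by
    rw [Pi.sub_apply, Pi.smul_apply, hJ]
    split_ifs with h <;> simp [h]
  have hnonneg : 0 ≤ F - s • filterArray J := by
    intro p
    rw [hval]
    split_ifs with h
    exacts [le_rfl, sub_nonneg.2 (hs p h)]
  refine ⟨hnonneg, fun p p' h₁ h₂ => ?_⟩
  by_cases hp : F p = 0
  · rw [hval p, if_pos hp]
    exact hnonneg p'
  · rw [hval, hval, if_neg hp, if_neg (ne_zero_of_mem_arrayCone hF h₁ h₂ hp)]
    exact sub_le_sub_right (hF.2 p p' h₁ h₂) s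

theorem exists_filterComb_eq (hkn : k ≤ n) {F : Arr k n} (hF : F ∈ arrayCone k n) :
    ∃ c : KSubset k n → ℝ, 0 ≤ c ∧ filterComb c = F := by
  classical
  induction hs : Finset.univ.filter (fun p => F p ≠ 0) using Finset.strongInduction
    generalizing F with
  | _ s ih =>
    obtain hempty | hne := s.eq_empty_or_nonempty
    · refine ⟨0, le_rfl, ?_⟩
      rw [map_zero]
      funext p
      by_contra h
      exact Finset.notMem_empty p (hempty ▸ hs ▸ Finset.mem_filter.2 ⟨Finset.mem_univ p, Ne.symm h⟩)
    · obtain ⟨p₀, hp₀, hmin⟩ := Finset.exists_min_image s F hne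
      simp only [← hs, Finset.mem_filter, Finset.mem_univ, true_and] at hp₀ hmin
      obtain ⟨J, hJ⟩ := exists_filterArray_eq_ite hkn hF
      have hsub : Finset.univ.filter (fun p => (F - F p₀ • filterArray J) p ≠ 0) ⊂ s := by
        rw [← hs, Finset.ssubset_iff_of_subset]
        · exact ⟨p₀, by simpa using hp₀, by simp [hJ, hp₀]⟩
        · intro p
          simp only [Finset.mem_filter, Finset.mem_univ, true_and, Pi.sub_apply, Pi.smul_apply, hJ]
          exact fun h hp => h (by simp [hp])
      obtain ⟨c, hc, hcF⟩ := ih _ hsub (sub_smul_filterArray_mem_arrayCone hF hmin hJ) rfl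
      refine ⟨c + F p₀ • Pi.single J 1, add_nonneg hc (smul_nonneg (hF.1 p₀) ?_), ?_⟩
      · exact Pi.single_nonneg.2 zero_le_one
      · rw [map_add, map_smul, filterComb_single, hcF, sub_add_cancel]

/-- The order on cells for which the arrays in `arrayCone k n` are the nonnegative monotone ones. -/
@[reducible]
def cellOrder (k n : ℕ) : PartialOrder (Fin k × Fin (n - k)) :=
  PartialOrder.lift (fun p => (OrderDual.toDual p.1, p.2)) fun _ _ h =>
    Prod.ext (OrderDual.toDual.injective (congrArg Prod.fst h)) (congrArg Prod.snd h)

theorem cellOrder_le_iff {p q : Fin k × Fin (n - k)} :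
    (cellOrder k n).le p q ↔ q.1 ≤ p.1 ∧ p.2 ≤ q.2 :=
  Iff.rfl

theorem coe_arrayCone : (arrayCone k n : Set (Arr k n)) = @orderCone _ (cellOrder k n).toPreorder :=
  Set.ext fun _ => and_congr_right fun _ =>
    ⟨fun h p p' hp => h p p' hp.1 hp.2, fun h _ _ h₁ h₂ => h ⟨h₁, h₂⟩⟩

theorem measurableSet_arrayCone : MeasurableSet (arrayCone k n : Set (Arr k n)) :=
  coe_arrayCone ▸ @measurableSet_orderCone _ (cellOrder k n).toPreorder _

/-- The pair of coordinate maps `gridCoord ∘ rowDiff` and `frozenCoord`; the first one is the image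
of an array under `fComb ∘ rowDiff`, in the coordinates of the simple roots. -/
noncomputable def gridFrozenCoord (hk : 0 < k) (hn : k < n) :
    Arr k n →ₗ[ℝ] (Fin (k - 1) × Fin (n - k - 1) → ℝ) × (Fin (k - 1) ⊕ Fin (n - k) → ℝ) :=
  (gridCoord hn ∘ₗ rowDiff).prod (frozenCoord hk hn)

theorem gridFrozenCoord_injective (hk : 0 < k) (hn : k < n) :
    Function.Injective (gridFrozenCoord (k := k) (n := n) hk hn) := by
  intro F F' h
  obtain ⟨hgrid, hfrozen⟩ := Prod.mk.inj h
  rw [LinearMap.comp_apply, LinearMap.comp_apply] at hgrid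
  rw [← sum_columnArray_add_sum_frozenArray hk hn F, hgrid, hfrozen,
    sum_columnArray_add_sum_frozenArray]

theorem card_gridFrozenIndex (hk : 0 < k) (hn : k < n) : Fintype.card (Fin k × Fin (n - k)) =
    Fintype.card ((Fin (k - 1) × Fin (n - k - 1)) ⊕ (Fin (k - 1) ⊕ Fin (n - k))) := by
  obtain ⟨a, rfl⟩ : ∃ a, k = a + 1 := ⟨k - 1, by omega⟩
  obtain ⟨b, hb⟩ : ∃ b, n - (a + 1) = b + 1 := ⟨n - (a + 1) - 1, by omega⟩
  simp only [Fintype.card_prod, Fintype.card_sum, Fintype.card_fin, hb, Nat.add_sub_cancel]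
  ring

theorem gridFrozenCoord_bijective (hk : 0 < k) (hn : k < n) :
    Function.Bijective (gridFrozenCoord (k := k) (n := n) hk hn) := by
  refine ⟨gridFrozenCoord_injective hk hn,
    (LinearMap.injective_iff_surjective_of_finrank_eq_finrank ?_).1
      (gridFrozenCoord_injective hk hn)⟩
  simp only [Module.finrank_prod, Module.finrank_fintype_fun_eq_card, card_gridFrozenIndex hk hn,
    Fintype.card_sum]

theorem measurePreserving_gridFrozenCoord (hk : 0 < k) (hn : k < n) :
    MeasurePreserving (gridFrozenCoord (k := k) (n := n) hk hn) := by
  have hsingle {ι : Type} [DecidableEq ι] (i j : ι) :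
      (Pi.single i (1 : ℝ) : ι → ℝ) j ∈ (Int.castAddHom ℝ).range := by
    rw [Pi.single_apply]
    split_ifs
    exacts [⟨1, by simp⟩, zero_mem _]
  let S := LinearEquiv.sumPiEquivProdPi ℝ (Fin (k - 1) × Fin (n - k - 1))
    (Fin (k - 1) ⊕ Fin (n - k)) fun _ => ℝ
  have hmp : MeasurePreserving (S.symm.toLinearMap ∘ₗ gridFrozenCoord (k := k) (n := n) hk hn) := by
    refine measurePreserving_of_int
      (B := Fintype.linearCombination ℝ (Sum.elim columnArray frozenArray)) ?_
      (card_gridFrozenIndex hk hn) (fun p i => ?_) fun i p => ?_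
    · refine LinearMap.ext fun F => ?_
      rw [LinearMap.comp_apply, Fintype.linearCombination_apply, Fintype.sum_sum_type]
      exact sum_columnArray_add_sum_frozenArray hk hn F
    · rcases i with q | l | c
      · exact gridCoord_apply_mem hn (rowDiff_apply_mem (hsingle p)) q
      · exact rowDiff_apply_mem (hsingle p) (l, lastCol hn)
      · change lastRowDiff hk (Pi.single p 1) c ∈ _
        rw [lastRowDiff_apply]
        split_ifs
        exacts [sub_mem (hsingle _ _) (zero_mem _), sub_mem (hsingle _ _) (hsingle _ _)]
    · rw [Fintype.linearCombination_apply_single, one_smul]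
      rcases i with q | l | c
      all_goals
        simp only [Sum.elim_inl, Sum.elim_inr, columnArray, frozenArray]
        split_ifs
        exacts [⟨1, by simp⟩, zero_mem _]
  exact (volume_measurePreserving_sumPiEquivProdPi fun _ => ℝ).comp hmp

/-- The cell in the first row and the last column: `filterArray J` is `1` there for nonfrozen `J`,
and arrays in `arrayCone k n` are largest there. -/
def corner (hk : 0 < k) (hn : k < n) : Fin k × Fin (n - k) := (⟨0, hk⟩, lastCol hn)

theorem le_lastCol (hn : k < n) (c : Fin (n - k)) : c ≤ lastCol hn :=
  Fin.le_def.2 (Nat.le_sub_one_of_lt c.2)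

theorem apply_corner_eq_sum_frozenCoord (hk : 0 < k) (hn : k < n) (F : Arr k n) :
    F (corner hk hn) = ∑ i, frozenCoord hk hn F i := by
  have hcolumn (q) : columnArray (k := k) (n := n) q (corner hk hn) = 0 := by
    refine if_neg fun h => ?_
    have := congrArg Fin.val h.2
    simp only [corner, lastCol, Fin.val_castLE] at this
    omega
  have hfrozen (i) : frozenArray (k := k) (n := n) i (corner hk hn) = 1 := by
    rcases i with l | c
    · simp only [frozenArray, corner, Sum.elim_inl, Nat.zero_le, if_true]
    · exact if_pos (le_lastCol hn c)
  conv_lhs => rw [← sum_columnArray_add_sum_frozenArray hk hn F]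
  simp only [Pi.add_apply, Finset.sum_apply, Pi.smul_apply, hcolumn, hfrozen, smul_eq_mul,
    mul_zero, Finset.sum_const_zero, mul_one, zero_add]

theorem frozenCoord_nonneg (hk : 0 < k) (hn : k < n) {F : Arr k n} (hF : F ∈ arrayCone k n) :
    0 ≤ frozenCoord hk hn F := by
  rintro (l | c)
  · exact sub_nonneg.2 (hF.2 _ _ (Fin.le_def.2 (Nat.le_succ _)) le_rfl)
  · rw [Pi.zero_apply, frozenCoord_inr, lastRowDiff_apply]
    split_ifs
    · rw [sub_zero]
      exact hF.1 _
    · exact sub_nonneg.2 (hF.2 _ _ le_rfl (Fin.le_def.2 (Nat.sub_le _ _)))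

theorem mem_arrayCone_iff_frozenCoord_nonneg (hk : 0 < k) (hn : k < n) {F : Arr k n}
    (hF : gridCoord hn (rowDiff F) = 0) : F ∈ arrayCone k n ↔ 0 ≤ frozenCoord hk hn F := by
  refine ⟨frozenCoord_nonneg hk hn, fun h => ?_⟩
  rw [← sum_frozenArray_of_gridCoord_eq_zero hk hn hF]
  refine sum_mem fun i _ => PointedCone.smul_mem _ (h i) ?_
  obtain ⟨J, -, hJ⟩ := exists_frozen_filterArray_eq hn.le i
  exact hJ ▸ filterArray_mem_arrayCone J

/-- The array with the coefficients of the noncrossing representation of `rootSum x`. -/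
noncomputable def ncArray (hk : 0 < k) (hn : k < n) (x : Fin (k - 1) × Fin (n - k - 1) → ℝ) :
    Arr k n := filterComb (ncCoeff hk hn x)

theorem gridCoord_rowDiff_ncArray (hk : 0 < k) (hn : k < n)
    (x : Fin (k - 1) × Fin (n - k - 1) → ℝ) : gridCoord hn (rowDiff (ncArray hk hn x)) = x := by
  apply rootSum_injective hn
  rw [rootSum_gridCoord, ncArray, ← vComb_eq, vComb_ncCoeff]

theorem ncArray_corner (hk : 0 < k) (hn : k < n) (x : Fin (k - 1) × Fin (n - k - 1) → ℝ) :
    ncArray hk hn x (corner hk hn) = ncGauge hk hn x := by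
  rw [ncArray, filterComb_apply, ncGauge]
  refine Finset.sum_filter_of_ne fun J _ hJ => ?_
  have := entry_zero_lt_of_nonfrozen ((isRep_ncCoeff hk hn x).mem_nonfrozen J hJ) hn.le
  simp only [corner, lastCol]
  omega

theorem ncArray_mem_arrayCone (hk : 0 < k) (hn : k < n) (x : Fin (k - 1) × Fin (n - k - 1) → ℝ) :
    ncArray hk hn x ∈ arrayCone k n :=
  filterComb_mem_arrayCone (isRep_ncCoeff hk hn x).nonneg

theorem sub_ncArray_mem_arrayCone (hk : 0 < k) (hn : k < n) {F : Arr k n}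
    (hF : F ∈ arrayCone k n) : F - ncArray hk hn (gridCoord hn (rowDiff F)) ∈ arrayCone k n := by
  obtain ⟨c, hc, rfl⟩ := exists_filterComb_eq hn.le hF
  obtain ⟨c', hc', -, hnc, hm⟩ :=
    exists_noncrossingSupport (T := ⊤) isClosed_univ hk hc fun _ => trivial
  have hpart : nonfrozenPart c' = ncCoeff hk hn (gridCoord hn (rowDiff (filterComb c))) := by
    refine (isRep_nonfrozenPart hc' hnc).eq_ncCoeff hk hn ?_
    rw [vComb_nonfrozenPart hn.le (by omega), rootSum_gridCoord, vComb_eq, hm.filterComb_eq]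
  rw [ncArray, ← hpart, ← hm.filterComb_eq, ← map_sub]
  exact filterComb_mem_arrayCone fun J => sub_nonneg.2 (nonfrozenPart_le hc' J)

/-- For fixed coordinates modulo the frozen subsets, the cone is a translated orthant. -/
theorem mem_arrayCone_iff_ncArray_le (hk : 0 < k) (hn : k < n) (F : Arr k n) :
    F ∈ arrayCone k n ↔
      frozenCoord hk hn (ncArray hk hn (gridCoord hn (rowDiff F))) ≤ frozenCoord hk hn F := by
  have hgrid : gridCoord hn (rowDiff (F - ncArray hk hn (gridCoord hn (rowDiff F)))) = 0 := by
    rw [map_sub, map_sub, gridCoord_rowDiff_ncArray, sub_self]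
  rw [← sub_nonneg, ← map_sub, ← mem_arrayCone_iff_frozenCoord_nonneg hk hn hgrid]
  refine ⟨sub_ncArray_mem_arrayCone hk hn, fun h => ?_⟩
  exact sub_add_cancel F (ncArray hk hn _) ▸ add_mem h (ncArray_mem_arrayCone hk hn _)

theorem setLIntegral_snd_of_le {α κ : Type*} [MeasurableSpace α] [Countable κ] {μ : Measure α}
    {ν : Measure (κ → ℝ)} [SFinite ν] {ρ : α → κ → ℝ}
    (hρ : MeasurableSet {w : α × (κ → ℝ) | ρ w.1 ≤ w.2}) {h : (κ → ℝ) → ℝ≥0∞}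
    (hh : Measurable h) :
    ∫⁻ w in {w : α × (κ → ℝ) | ρ w.1 ≤ w.2}, h w.2 ∂μ.prod ν =
      ∫⁻ x, ∫⁻ r in Set.Ici (ρ x), h r ∂ν ∂μ := by
  rw [← lintegral_indicator hρ,
    lintegral_prod _ (Measurable.indicator (by fun_prop) hρ).aemeasurable]
  refine lintegral_congr fun x => ?_
  rw [← lintegral_indicator measurableSet_Ici]
  rfl

theorem lintegral_arrayCone (hk : 0 < k) (hn : k < n) :
    ∫⁻ F in (arrayCone k n : Set (Arr k n)), ENNReal.ofReal (Real.exp (-F (corner hk hn))) =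
      ∫⁻ x, ENNReal.ofReal (Real.exp (-ncGauge hk hn x)) := by
  set D := {w : (Fin (k - 1) × Fin (n - k - 1) → ℝ) × (Fin (k - 1) ⊕ Fin (n - k) → ℝ) |
    frozenCoord hk hn (ncArray hk hn w.1) ≤ w.2}
  have hcone : (arrayCone k n : Set (Arr k n)) = gridFrozenCoord hk hn ⁻¹' D :=
    Set.ext (mem_arrayCone_iff_ncArray_le hk hn)
  have hD : MeasurableSet D := by
    let Φ := LinearEquiv.ofBijective _ (gridFrozenCoord_bijective (k := k) (n := n) hk hn)
    have hD_preimage : D = Φ.symm ⁻¹' (arrayCone k n) := by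
      rw [hcone, ← Set.preimage_comp]
      exact (congrArg (· ⁻¹' D) (funext Φ.apply_symm_apply)).symm
    rw [hD_preimage]
    exact Φ.symm.toLinearMap.continuous_of_finiteDimensional.measurable measurableSet_arrayCone
  have hh : Measurable fun r : Fin (k - 1) ⊕ Fin (n - k) → ℝ =>
      ENNReal.ofReal (Real.exp (-∑ i, r i)) := by fun_prop
  calc ∫⁻ F in (arrayCone k n : Set (Arr k n)), ENNReal.ofReal (Real.exp (-F (corner hk hn)))
    _ = ∫⁻ w in D, ENNReal.ofReal (Real.exp (-∑ i, w.2 i)) := by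
      simp only [apply_corner_eq_sum_frozenCoord]
      rw [hcone]
      exact (measurePreserving_gridFrozenCoord hk hn).setLIntegral_comp_preimage hD
        (hh.comp measurable_snd)
    _ = ∫⁻ x, ∫⁻ r in Set.Ici (frozenCoord hk hn (ncArray hk hn x)),
          ENNReal.ofReal (Real.exp (-∑ i, r i)) :=
      setLIntegral_snd_of_le (μ := volume) (ν := volume)
        (ρ := fun x => frozenCoord hk hn (ncArray hk hn x)) hD hh
    _ = ∫⁻ x, ENNReal.ofReal (Real.exp (-ncGauge hk hn x)) := by
      simp only [lintegral_exp_neg_sum_Ici, ← apply_corner_eq_sum_frozenCoord, ncArray_corner]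

theorem strictMono_cellOrder_iff {T : Fin k × Fin (n - k) → Fin (k * (n - k))}
    (hT : Function.Injective T) :
    @StrictMono _ _ (cellOrder k n).toPreorder _ T ↔
      (∀ i, StrictMono fun j => T (Fin.rev i, j)) ∧ ∀ j, StrictMono fun i => T (Fin.rev i, j) := by
  constructor
  · intro h
    have hlt {p q : Fin k × Fin (n - k)} (hle : q.1 ≤ p.1 ∧ p.2 ≤ q.2) (hne : p ≠ q) : T p < T q :=
      h (@lt_of_le_of_ne _ (cellOrder k n) p q (cellOrder_le_iff.2 hle) hne)
    exact ⟨fun i j j' hj => hlt ⟨le_rfl, hj.le⟩ fun he => hj.ne (congrArg Prod.snd he),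
      fun j i i' hi => hlt ⟨Fin.rev_le_rev.2 hi.le, le_rfl⟩
        fun he => hi.ne (Fin.rev_injective (congrArg Prod.fst he))⟩
  · rintro ⟨hrow, hcol⟩
    refine @Monotone.strictMono_of_injective _ _ (cellOrder k n).toPreorder _ T
      (fun p q hpq => ?_) hT
    obtain ⟨h₁, h₂⟩ := cellOrder_le_iff.1 hpq
    have hle₁ := (hrow (Fin.rev p.1)).monotone h₂
    have hle₂ := (hcol q.2).monotone (Fin.rev_le_rev.2 h₁)
    simp only [Fin.rev_rev] at hle₁ hle₂
    exact hle₁.trans hle₂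

theorem card_strictMono_cellOrder : Nat.card {T : Fin k × Fin (n - k) ≃ Fin (k * (n - k)) //
    @StrictMono _ _ (cellOrder k n).toPreorder _ T} = multiCatalan k (n - k) := by
  let τ : Fin k × Fin (n - k) ≃ Fin k × Fin (n - k) := Equiv.prodCongr Fin.revPerm (Equiv.refl _)
  exact Nat.card_congr (Equiv.subtypeEquiv (Equiv.equivCongr τ (Equiv.refl _))
    fun T => strictMono_cellOrder_iff T.injective)

theorem lintegral_arrayCone_eq_multiCatalan (hk : 0 < k) (hn : k < n) :
    ∫⁻ F in (arrayCone k n : Set (Arr k n)), ENNReal.ofReal (Real.exp (-F (corner hk hn))) =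
      multiCatalan k (n - k) := by
  have htop : @IsTop _ (cellOrder k n).toLE (corner hk hn) := fun p =>
    cellOrder_le_iff.2 ⟨Fin.le_def.2 (Nat.zero_le _), le_lastCol hn p.2⟩
  rw [coe_arrayCone, @lintegral_orderCone _ _ _ (cellOrder k n) finProdFinEquiv _ htop,
    card_strictMono_cellOrder]

/-- The functional `∑ q, a q α_q` on `rowZero k n`, where `α_q` is the coordinate function at `q`;
it is the counterpart of `fComb a` in the dual space. -/
noncomputable def coordComb : Grid k n →ₗ[ℝ] Module.Dual ℝ (rowZero k n) :=
  Fintype.linearCombination ℝ fun q =>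
    (LinearMap.proj q : Module.Dual ℝ (Grid k n)).domRestrict (rowZero k n)

theorem coordComb_apply (a : Grid k n) (y : rowZero k n) :
    coordComb a y = ∑ q, a q * (y : Grid k n) q := by
  simp [coordComb, Fintype.linearCombination_apply]

theorem coordComb_surjective : Function.Surjective (coordComb (k := k) (n := n)) := by
  intro w
  obtain ⟨W, rfl⟩ := w.exists_extend
  refine ⟨fun q => W (e q), LinearMap.ext fun y => ?_⟩
  rw [coordComb_apply, LinearMap.comp_apply, Submodule.subtype_apply,
    LinearMap.pi_apply_eq_sum_univ W]
  exact Finset.sum_congr rfl fun q _ => by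
    rw [smul_eq_mul, mul_comm]
    congr 2
    ext p
    simp [e, Pi.single_apply, eq_comm]

theorem e_sub_e_mem_rowZero (i : Fin (k - 1)) (j j' : Fin (n - k)) :
    e (i, j) - e (i, j') ∈ rowZero k n := by
  intro i'
  simp [e, Pi.single_apply, Prod.ext_iff, Finset.sum_sub_distrib, ite_and]

theorem coordComb_eq_zero_iff {a : Grid k n} :
    coordComb a = 0 ↔ ∀ i j j', a (i, j) = a (i, j') := by
  constructor
  · intro h i j j'
    have hdiff := LinearMap.congr_fun h ⟨_, e_sub_e_mem_rowZero i j j'⟩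
    simpa [coordComb_apply, e, mul_sub, Finset.sum_sub_distrib, Pi.single_apply, sub_eq_zero]
      using hdiff
  · refine fun h => LinearMap.ext fun y => ?_
    rw [coordComb_apply, Fintype.sum_prod_type, LinearMap.zero_apply]
    refine Finset.sum_eq_zero fun i _ => ?_
    rcases isEmpty_or_nonempty (Fin (n - k)) with _ | ⟨⟨j₀⟩⟩
    · exact Finset.sum_of_isEmpty _
    · simp only [h i _ j₀, ← Finset.mul_sum, y.2 i, mul_zero]

theorem ker_coordComb :
    LinearMap.ker (coordComb (k := k) (n := n)) =
      LinearMap.ker (fComb.codRestrict (rowZero k n) fComb_mem_rowZero) := by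
  ext a
  rw [LinearMap.ker_codRestrict, LinearMap.mem_ker, LinearMap.mem_ker, coordComb_eq_zero_iff,
    fComb_eq_zero_iff]

theorem codRestrict_fComb_surjective :
    Function.Surjective (fComb.codRestrict (rowZero k n) fComb_mem_rowZero) := fun y =>
  (exists_fComb_eq y.2).imp fun _ ha => Subtype.ext ha

/-- The isomorphism which sends the coordinate function `α_q` to `f q`. -/
noncomputable def dualEquiv (k n : ℕ) : Module.Dual ℝ (rowZero k n) ≃ₗ[ℝ] rowZero k n :=
  (coordComb.quotKerEquivOfSurjective coordComb_surjective).symm ≪≫ₗ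
    Submodule.quotEquivOfEq _ _ ker_coordComb ≪≫ₗ
    LinearMap.quotKerEquivOfSurjective _ codRestrict_fComb_surjective

theorem dualEquiv_coordComb (a : Grid k n) :
    (dualEquiv k n (coordComb a) : Grid k n) = fComb a := by
  have hmk : (coordComb.quotKerEquivOfSurjective coordComb_surjective).symm (coordComb a) =
      Submodule.Quotient.mk a := by
    rw [LinearEquiv.symm_apply_eq, LinearMap.quotKerEquivOfSurjective_apply_mk]
  rw [dualEquiv, LinearEquiv.trans_apply, LinearEquiv.trans_apply, hmk,
    Submodule.quotEquivOfEq_mk, LinearMap.quotKerEquivOfSurjective_apply_mk,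
    LinearMap.codRestrict_apply]

theorem dualEquiv_proj (q : Fin (k - 1) × Fin (n - k)) :
    (dualEquiv k n ((LinearMap.proj q : Module.Dual ℝ (Grid k n)).domRestrict (rowZero k n)) :
      Grid k n) = f q := by
  have hproj : (LinearMap.proj q : Module.Dual ℝ (Grid k n)).domRestrict (rowZero k n) =
      coordComb (Pi.single q 1) := by
    rw [coordComb, Fintype.linearCombination_apply_single, one_smul]
  rw [hproj, dualEquiv_coordComb, fComb, Fintype.linearCombination_apply_single, one_smul]

theorem dualEquiv_gamma (J : KSubset k n) :
    (dualEquiv k n ((gamma J).domRestrict (rowZero k n)) : Grid k n) = v J := by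
  have hgamma : (gamma J).domRestrict (rowZero k n) = ∑ q ∈ cells J,
      (LinearMap.proj q : Module.Dual ℝ (Grid k n)).domRestrict (rowZero k n) :=
    LinearMap.ext fun y => by simp [gamma]
  rw [hgamma, map_sum, Submodule.coe_sum, v]
  exact Finset.sum_congr rfl fun q _ => dualEquiv_proj q

theorem image_dualEquiv_dualRootPolytope :
    (fun w => (dualEquiv k n w : Grid k n)) '' dualRootPolytope k n = rootPolytope k n := by
  change ((rowZero k n).subtype ∘ₗ (dualEquiv k n).toLinearMap) '' convexHull ℝ _ = convexHull ℝ _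
  rw [LinearMap.image_convexHull, Set.image_image]
  exact congrArg _ (Set.image_congr fun J _ => dualEquiv_gamma J)

end RootPolytope

open RootPolytope in
theorem mainTheorem1 (k n : ℕ) (hk : 2 ≤ k) (hn : k + 2 ≤ n) :
    -- the two realizations of the root polytope correspond under a linear isomorphism
    (∃ Φ : Module.Dual ℝ (rowZero k n) ≃ₗ[ℝ] rowZero k n,
      (∀ q : Fin (k - 1) × Fin (n - k),
        (Φ ((LinearMap.proj q : Module.Dual ℝ (Grid k n)).domRestrict (rowZero k n)) : Grid k n)
          = f q) ∧
      (∀ J : KSubset k n, (Φ ((gamma J).domRestrict (rowZero k n)) : Grid k n) = v J) ∧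
      (fun w => (Φ w : Grid k n)) '' dualRootPolytope k n = rootPolytope k n) ∧
    -- the points `0` and `v_J`, for `J` nonfrozen, are pairwise distinct
    (Set.InjOn v (nonfrozen k n) ∧ ∀ J ∈ nonfrozen k n, v J ≠ 0) ∧
    -- the simplices `conv {0, v_J : J ∈ 𝒥}` and their faces form a flag unimodular triangulation
    (∃ K : Geometry.SimplicialComplex ℝ (Grid k n),
      K.faces = {s | s.Nonempty ∧ ∃ 𝒥 ∈ NC k n, s ⊆ insert 0 (𝒥.image v)} ∧
      K.space = rootPolytope k n ∧
      IsFlag K ∧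
      IsUnimodular K) ∧
    normalizedVolume (rootPolytope k n) = (multiCatalan k (n - k) : ℝ≥0∞) := by
  have hk0 : 0 < k := by omega
  have hkn : k < n := by omega
  refine ⟨⟨dualEquiv k n, dualEquiv_proj, dualEquiv_gamma, image_dualEquiv_dualRootPolytope⟩,
    ⟨v_injOn hk0 hkn, fun J hJ => v_ne_zero hk0 hkn hJ⟩,
    ⟨ncComplex hk0 hkn, rfl, space_ncComplex hk hn, isFlag_ncComplex hk0 hkn,
      isUnimodular_ncComplex hk0 hkn⟩, ?_⟩
  rw [normalizedVolume_eq_lintegral hk hn, ← lintegral_arrayCone hk0 hkn,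
    lintegral_arrayCone_eq_multiCatalan hk0 hkn]
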